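/- Let $(Y,\nu)$ be a precompact (totally bounded) translation surface whose frontier $\partial Y=\overline Y\setminus Y$ is finite and nonempty, where $\overline{Y}$ is the completion of $Y$ with respect to the flat length metric. Let $(X,\mu)$ be its universal cover with the pulled-back translation structure, and assume that $\partial X=\overline X\setminus X$ is a discrete subset of the completion $\overline X$. A set $U\subset X$ is convex if any two of its points are joined by a geodesic segment (a path developing to a straight segment) contained in $U$. A subconic of $X$ is a convex set $U\subset X$ whose image under a developing map $X\to\mathbb R^2$ has the form $\{(x_1,x_2)\mid q(x_1,x_2,1)<0\}$ for some quadratic form $q$ on $\mathbb R^3$; $\partial U$ denotes the complement of the interior of $U$ in its closure, both taken in $\overline X$. For $Z\subset\partial X$ let $\mathcal S_Z$ be the set of subconics $U$ such that $Z=\partial U\cap\partial X$ and $Z$ intersects each connected component of $\partial U$. The set $Z$ is realizable if $\mathrm{Card}(Z)\ge 3$ and $\mathcal S_Z\neq\emptyset$. Points $x,y\in\partial U\cap\partial X$ are adjacent in $\partial U\cap\partial X$ if some connected component of $\partial U\setminus\{x,y\}$ does not intersect $\partial X$. Let $Z\subset\partial X$ be realizable and let $Z'\subset Z$. (1) If $\mathrm{Card}(Z')=4$,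 then $Z'$ is realizable if and only if there exists $U\in\mathcal S_Z$ such that $Z'$ intersects each connected component of $\partial U$ and $Z'$ can be partitioned into two pairs $\{x_-,y_-\}$, $\{x_+,y_+\}$, each of which is adjacent in $\partial U\cap\partial X$. (2) If $\mathrm{Card}(Z')=3$, then $Z'$ is realizable if and only if there exists $U\in\mathcal S_Z$ such that $Z'$ intersects each connected component of $\partial U$ and $Z'$ contains a pair of distinct points $\{x,x'\}$ that is adjacent in $\partial U\cap\partial X$. -/

import Mathlib

open Set Filter Topology UniformSpace

noncomputable section

/-- The Euclidean plane. -/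
abbrev Plane : Type := EuclideanSpace ℝ (Fin 2)

/-- `δ` is a development in the plane of the path `γ`: near each time it agrees, up to a
translation, with `γ` read in any chart. -/
def IsDevelopmentAlong {X : Type*} [TopologicalSpace X] [ChartedSpace Plane X] {x y : X}
    (γ : Path x y) (δ : unitInterval → Plane) : Prop :=
  ∀ t : unitInterval, ∀ e ∈ atlas Plane X, γ t ∈ e.source →
    ∃ v : Plane, ∀ᶠ s in 𝓝 t, δ s = e (γ s) + v

/-- The length distance of a translation atlas: the infimum of the Euclidean lengths (total
variations) of the developments of the paths joining `x` to `y`. -/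
def lengthEDist {X : Type*} [TopologicalSpace X] [ChartedSpace Plane X] (x y : X) : ENNReal :=
  ⨅ (γ : Path x y) (δ : unitInterval → Plane) (_ : IsDevelopmentAlong γ δ),
    eVariationOn δ univ

/-- A translation surface, with the (Hausdorff) distance that its structure determines:
the transition maps of the atlas are locally translations, and the distance is the length
distance of the flat metric `dx² + dy²`. -/
class TranslationSurface (X : Type*) [MetricSpace X] [ChartedSpace Plane X] : Prop where
  transition : ∀ e ∈ atlas Plane X, ∀ e' ∈ atlas Plane X, ∀ x ∈ e.source ∩ e'.source,
    ∃ v : Plane, ∀ᶠ y in 𝓝 x, e' y = e y + v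
  edist_eq : ∀ x y : X, edist x y = lengthEDist x y

/-- A translation map: a translation in all charts, locally. -/
def IsTranslationMap {X Y : Type*} [TopologicalSpace X] [ChartedSpace Plane X]
    [TopologicalSpace Y] [ChartedSpace Plane Y] (p : X → Y) : Prop :=
  Continuous p ∧ ∀ e ∈ atlas Plane X, ∀ e' ∈ atlas Plane Y, ∀ x ∈ e.source, p x ∈ e'.source →
    ∃ v : Plane, ∀ᶠ y in 𝓝 x, e' (p y) = e y + v

/-- A developing map: locally a chart followed by a translation. On a simply connected
translation surface it exists and is unique up to a translation of the plane. -/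
def IsDevelopingMap {X : Type*} [TopologicalSpace X] [ChartedSpace Plane X]
    (D : X → Plane) : Prop :=
  ∀ e ∈ atlas Plane X, ∀ x ∈ e.source, ∃ v : Plane, ∀ᶠ y in 𝓝 x, D y = e y + v

/-- A subset of the surface is convex if any two of its points are joined by a geodesic segment
inside it, that is, by a path that develops onto a straight segment. -/
def IsFlatConvex {X : Type*} [TopologicalSpace X] [ChartedSpace Plane X] (U : Set X) : Prop :=
  ∀ x ∈ U, ∀ y ∈ U, ∃ γ : Path x y, (∀ t, γ t ∈ U) ∧
    ∃ a v : Plane, IsDevelopmentAlong γ (fun t => a + (t : ℝ) • v)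

/-- The planar subconic `{(x₁, x₂) | q(x₁, x₂, 1) < 0}` of a quadratic form on `ℝ³`. -/
def planarSubconic (q : QuadraticForm ℝ (Fin 3 → ℝ)) : Set Plane :=
  {x | q ![x 0, x 1, 1] < 0}

/-- A subconic of a (simply connected) translation surface: a convex set which the developing
map sends onto a planar subconic. -/
def IsSubconic {X : Type*} [TopologicalSpace X] [ChartedSpace Plane X] (U : Set X) : Prop :=
  IsFlatConvex U ∧ ∃ D : X → Plane, IsDevelopingMap D ∧
    ∃ q : QuadraticForm ℝ (Fin 3 → ℝ), D '' U = planarSubconic q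

/-- The frontier `∂X = X̄ ∖ X` of `X` in its metric completion `X̄`. -/
def surfaceFrontier (X : Type*) [MetricSpace X] : Set (Completion X) :=
  (range ((↑) : X → Completion X))ᶜ

/-- The boundary `∂U` of `U ⊆ X`: the complement of its interior in its closure, both taken in
the metric completion of `X`. -/
def bdry {X : Type*} [MetricSpace X] (U : Set X) : Set (Completion X) :=
  frontier (((↑) : X → Completion X) '' U)

/-- `Z` intersects each connected component of `∂U`. -/
def MeetsEachComponent {X : Type*} [MetricSpace X] (Z : Set (Completion X)) (U : Set X) : Prop :=
  ∀ x ∈ bdry U, (Z ∩ connectedComponentIn (bdry U) x).Nonempty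

/-- `𝒮_Z`: the subconics `U` such that `Z = ∂U ∩ ∂X` and `Z` intersects each component
of `∂U`. -/
def subconicsOf {X : Type*} [MetricSpace X] [ChartedSpace Plane X] (Z : Set (Completion X)) :
    Set (Set X) :=
  {U | IsSubconic U ∧ Z = bdry U ∩ surfaceFrontier X ∧ MeetsEachComponent Z U}

/-- `Z` is realizable: it has at least three points, and `𝒮_Z` is not empty. -/
def Realizable {X : Type*} [MetricSpace X] [ChartedSpace Plane X] (Z : Set (Completion X)) :
    Prop :=
  3 ≤ Z.encard ∧ (subconicsOf Z).Nonempty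

/-- `x` and `y` are adjacent in `∂U ∩ ∂X`: some connected component of `∂U ∖ {x, y}` does not
intersect `∂X`. -/
def Adjacent {X : Type*} [MetricSpace X] (U : Set X) (x y : Completion X) : Prop :=
  x ∈ bdry U ∩ surfaceFrontier X ∧ y ∈ bdry U ∩ surfaceFrontier X ∧
    ∃ p ∈ bdry U \ {x, y},
      Disjoint (connectedComponentIn (bdry U \ {x, y}) p) (surfaceFrontier X)

end

noncomputable section

set_option linter.unusedSectionVars false

section

/-! ### Developing maps, unique lifting and lengths. -/

section Development

variable {X : Type*} [MetricSpace X] [ChartedSpace Plane X] {D : X → Plane}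

/-! The plan is to move everything to plane conics. A developing map `D` carries a subconic `U`
bijectively onto an open convex region `F < 0` (`IsFlatConvex.isSheet`), and its extension to the
completion is an isometry on the closure of `U` (`IsSheet.dist_devExt`). Thus `∂U` is a copy of the
planar frontier, and `∂U ∩ ∂X` becomes a set of marked points on it. Since `Y` is precompact with
nonempty frontier, no subconic contains arbitrarily large developed discs
(`exists_radius_not_ball_subset`), so `F < 0` is the interior of an ellipse or a strip
(`Conic.isElliptic_or_strip`). For a strip with marked points on both lines, pigeonhole in `Y` makes
these points periodic (`IsSheet.exists_period`). Hence a subconic realizing a finite set is an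
ellipse.

From adjacency to realizability: find a product `G` of two affine forms that is nonnegative at all
marked points of `U` and vanishes exactly at those of `Z'`. Over an ellipse the factors are the
chords of the two adjacent pairs, or a chord and the tangent at the third point. Over a strip they
are two transversal lines, each joining a point of one pair to a point of the other. For small `ε >
0` the region `F + ε G < 0` is an ellipse close to `F ≤ 0`. As `∂X` is discrete, rays from a point
of `U` meet no new frontier point near the closure of `U` (`IsSheet.exists_isOpen_isVisible`), so
this ellipse lifts to the surface, and its boundary contains exactly `Z'`
(`IsSheet.subconicsOf_nonempty`).

From realizability to adjacency: let the ellipse `G < 0` develop a subconic `V` realizing `Z'`.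
Simple connectedness and three common frontier points force `U` and `V` to overlap
(`IsSheet.inter_nonempty`), so their developments are compatible and `G > 0` at every marked point
of `U` outside `Z'` (`IsSheet.exists_conic_of_realizable`). What remains is about two plane conics.
If `F` is an ellipse, a degenerate member of the pencil of `F` and `G` shows that the points of `F =
0` with `G > 0` lie on one side of suitable chords (`Conic.exists_oneSided_three`,
`Conic.exists_oneSided_four`); the arc cut off by such a chord has no marked point. If `F` is a
strip, each of its two lines meets `G = 0` at most twice, and `G < 0` between two such points. -/

theorem IsDevelopingMap.isLocalHomeomorph (hD : IsDevelopingMap D) : IsLocalHomeomorph D := by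
  refine IsLocalHomeomorph.mk D fun x => ?_
  obtain ⟨v, hv⟩ := hD _ (chart_mem_atlas Plane x) x (mem_chart_source Plane x)
  obtain ⟨W, hW, hWo, hxW⟩ := eventually_nhds_iff.1 hv
  refine ⟨((chartAt Plane x).restrOpen W hWo).transHomeomorph (Homeomorph.addRight v), ?_, ?_⟩
  · simpa using hxW
  · intro y hy
    simp only [OpenPartialHomeomorph.transHomeomorph_source,
      OpenPartialHomeomorph.restrOpen_source, mem_inter_iff] at hy
    simpa using hW y hy.2

theorem IsDevelopingMap.continuous (hD : IsDevelopingMap D) : Continuous D :=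
  hD.isLocalHomeomorph.continuous

/-- Uniqueness of lifts through a local homeomorphism with Hausdorff source. Almost every
identification of two paths or sections below comes from it. -/
theorem IsDevelopingMap.eqOn_of_eqOn (hD : IsDevelopingMap D) {E : Type*} [TopologicalSpace E]
    {s : Set E} {g₁ g₂ : E → X} (hs : IsPreconnected s) (h₁ : ContinuousOn g₁ s)
    (h₂ : ContinuousOn g₂ s) (he : ∀ a ∈ s, D (g₁ a) = D (g₂ a)) {a : E} (ha : a ∈ s)
    (haa : g₁ a = g₂ a) : EqOn g₁ g₂ s :=
  (T2Space.isSeparatedMap D).eqOn_of_comp_eqOn hD.isLocalHomeomorph.isLocallyInjective hs h₁ h₂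
    he ha haa

theorem IsDevelopingMap.isDevelopmentAlong (hD : IsDevelopingMap D) {x y : X} (γ : Path x y)
    (c : Plane) : IsDevelopmentAlong γ fun t => D (γ t) + c := by
  intro t e he hte
  obtain ⟨v, hv⟩ := hD e he _ hte
  refine ⟨v + c, ?_⟩
  filter_upwards [γ.continuous.continuousAt.eventually hv] with s hs
  rw [hs, add_assoc]

theorem IsDevelopingMap.exists_eq_of_isDevelopmentAlong (hD : IsDevelopingMap D) {x y : X}
    {γ : Path x y} {δ : unitInterval → Plane} (hδ : IsDevelopmentAlong γ δ) :
    ∃ c : Plane, ∀ t, δ t = D (γ t) + c := by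
  have hc : IsLocallyConstant fun t => δ t - D (γ t) := by
    rw [IsLocallyConstant.iff_eventually_eq]
    intro t
    obtain ⟨v, hv⟩ := hδ t _ (chart_mem_atlas Plane (γ t)) (mem_chart_source Plane (γ t))
    obtain ⟨w, hw⟩ := hD _ (chart_mem_atlas Plane (γ t)) _ (mem_chart_source Plane (γ t))
    have hw' := γ.continuous.continuousAt.eventually hw
    filter_upwards [hv, hw'] with s hs hs'
    rw [hs, hs', hv.self_of_nhds, hw'.self_of_nhds]
    abel
  refine ⟨δ 0 - D (γ 0), fun t => ?_⟩
  rw [← hc.apply_eq_of_preconnectedSpace t 0]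
  abel

theorem IsDevelopingMap.exists_eq_add [PreconnectedSpace X] [Nonempty X] {D' : X → Plane}
    (hD : IsDevelopingMap D) (hD' : IsDevelopingMap D') : ∃ c : Plane, ∀ x, D' x = D x + c := by
  have hc : IsLocallyConstant fun x => D' x - D x := by
    rw [IsLocallyConstant.iff_eventually_eq]
    intro x
    obtain ⟨v, hv⟩ := hD _ (chart_mem_atlas Plane x) _ (mem_chart_source Plane x)
    obtain ⟨w, hw⟩ := hD' _ (chart_mem_atlas Plane x) _ (mem_chart_source Plane x)
    filter_upwards [hv, hw] with s hs hs'
    rw [hs, hs', hv.self_of_nhds, hw.self_of_nhds]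
    abel
  obtain ⟨o⟩ := ‹Nonempty X›
  refine ⟨D' o - D o, fun x => ?_⟩
  rw [← hc.apply_eq_of_preconnectedSpace x o]
  abel

theorem eVariationOn_segment_le (a v : Plane) :
    eVariationOn (fun t : unitInterval => a + (t : ℝ) • v) univ ≤ ‖v‖ₑ := by
  have hl : LipschitzOnWith ‖v‖₊ (fun r : ℝ => a + r • v) univ := by
    refine LipschitzWith.lipschitzOnWith (LipschitzWith.of_dist_le_mul fun r s => ?_)
    rw [dist_add_left, dist_eq_norm, ← sub_smul, norm_smul, coe_nnnorm, mul_comm, Real.dist_eq,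
      Real.norm_eq_abs]
  have h1 := hl.comp_eVariationOn_le (g := fun t : unitInterval => (t : ℝ)) (s := univ)
    (fun _ _ => mem_univ _)
  have h2 : eVariationOn (fun t : unitInterval => (t : ℝ)) univ = 1 := by
    have h := MonotoneOn.eVariationOn_eq (f := fun t : unitInterval => (t : ℝ)) (s := univ)
      (a := 0) (b := 1) (fun _ _ _ _ h => h) (mem_univ _) (mem_univ _)
    have hI : Icc (0 : unitInterval) 1 = univ := by
      exact eq_univ_of_forall fun t => ⟨t.2.1, t.2.2⟩
    rw [hI, univ_inter] at h
    simpa using h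
  rw [h2, mul_one] at h1
  exact h1

variable [TranslationSurface X]

/-- The distance is an infimum of lengths of developed curves, and a curve is never shorter than its
chord. -/
theorem IsDevelopingMap.edist_le (hD : IsDevelopingMap D) (x y : X) :
    edist (D x) (D y) ≤ edist x y := by
  rw [TranslationSurface.edist_eq x y]
  refine le_iInf fun γ => le_iInf fun δ => le_iInf fun hδ => ?_
  obtain ⟨c, hc⟩ := hD.exists_eq_of_isDevelopmentAlong hδ
  have h := eVariationOn.edist_le δ (mem_univ 0) (mem_univ 1)
  rwa [hc, hc, γ.source, γ.target, edist_add_right] at h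

theorem IsDevelopingMap.lipschitz (hD : IsDevelopingMap D) : LipschitzWith 1 D :=
  fun x y => by simpa using hD.edist_le x y

theorem IsDevelopingMap.edist_le_of_segment (hD : IsDevelopingMap D) {x y : X} (γ : Path x y)
    {a v : Plane} (h : ∀ t : unitInterval, D (γ t) = a + (t : ℝ) • v) : edist x y ≤ ‖v‖ₑ := by
  rw [TranslationSurface.edist_eq x y]
  refine (iInf₂_le_of_le γ (fun t => D (γ t) + 0) <|
    iInf_le_of_le (hD.isDevelopmentAlong γ 0) le_rfl).trans ?_
  simpa [h] using eVariationOn_segment_le a v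

theorem exists_path_of_edist_lt {x y : X} {r : ENNReal} (h : edist x y < r) :
    ∃ (γ : Path x y) (δ : unitInterval → Plane), IsDevelopmentAlong γ δ ∧
      ∀ s t, edist (δ s) (δ t) < r := by
  rw [TranslationSurface.edist_eq x y] at h
  simp only [lengthEDist, iInf_lt_iff] at h
  obtain ⟨γ, δ, hδ, h⟩ := h
  exact ⟨γ, δ, hδ, fun s t =>
    (eVariationOn.edist_le δ (mem_univ s) (mem_univ t)).trans_lt h⟩

theorem IsDevelopingMap.exists_path (hD : IsDevelopingMap D) {x y : X} {r : ENNReal}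
    (h : edist x y < r) : ∃ γ : Path x y, ∀ t, edist (D x) (D (γ t)) < r := by
  obtain ⟨γ, δ, hδ, h⟩ := exists_path_of_edist_lt h
  obtain ⟨c, hc⟩ := hD.exists_eq_of_isDevelopmentAlong hδ
  refine ⟨γ, fun t => ?_⟩
  have := h 0 t
  rwa [hc, hc, γ.source, edist_add_right] at this

end Development

/-! ### Sheets: open sets developing bijectively onto convex planar sets. -/

section Sheet

variable {X : Type*} [MetricSpace X] [ChartedSpace Plane X] {D : X → Plane}

/-- `U` is an open subset which `D` maps bijectively onto the convex set `A`. -/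
structure IsSheet (D : X → Plane) (U : Set X) (A : Set Plane) : Prop where
  isOpen : IsOpen U
  convex : Convex ℝ A
  bijOn : BijOn D U A

/-- The inverse of `D` on `U`. -/
def sheetSection [Nonempty X] (D : X → Plane) (U : Set X) : Plane → X := Function.invFunOn D U

namespace IsSheet

variable {U : Set X} {A : Set Plane} [Nonempty X]

theorem section_mem (h : IsSheet D U A) {a : Plane} (ha : a ∈ A) : sheetSection D U a ∈ U :=
  Function.invFunOn_mem (by obtain ⟨x, hx, rfl⟩ := h.bijOn.surjOn ha; exact ⟨x, hx, rfl⟩)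

theorem map_section (h : IsSheet D U A) {a : Plane} (ha : a ∈ A) : D (sheetSection D U a) = a :=
  Function.invFunOn_eq (by obtain ⟨x, hx, rfl⟩ := h.bijOn.surjOn ha; exact ⟨x, hx, rfl⟩)

theorem section_map (h : IsSheet D U A) {x : X} (hx : x ∈ U) : sheetSection D U (D x) = x :=
  h.bijOn.injOn (h.section_mem (h.bijOn.mapsTo hx)) hx (h.map_section (h.bijOn.mapsTo hx))

theorem isOpen_target (hD : IsDevelopingMap D) (h : IsSheet D U A) : IsOpen A :=
  h.bijOn.image_eq ▸ hD.isLocalHomeomorph.isOpenMap U h.isOpen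

theorem continuousOn_section (hD : IsDevelopingMap D) (h : IsSheet D U A) :
    ContinuousOn (sheetSection D U) A := by
  refine continuousOn_iff'.2 fun W hW => ⟨D '' (W ∩ U),
    hD.isLocalHomeomorph.isOpenMap _ (hW.inter h.isOpen), ?_⟩
  ext a
  constructor
  · rintro ⟨hw, ha⟩
    exact ⟨⟨_, ⟨hw, h.section_mem ha⟩, h.map_section ha⟩, ha⟩
  · rintro ⟨⟨x, ⟨hxW, hxU⟩, rfl⟩, ha⟩
    refine ⟨?_, ha⟩
    rw [mem_preimage, h.section_map hxU]
    exact hxW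

theorem eqOn_section (hD : IsDevelopingMap D) (h : IsSheet D U A) {E : Type*}
    [TopologicalSpace E] {s : Set E} {g : E → X} (hs : IsPreconnected s) (hg : ContinuousOn g s)
    (hA : ∀ t ∈ s, D (g t) ∈ A) {t : E} (ht : t ∈ s) (htU : g t ∈ U) :
    ∀ t ∈ s, g t = sheetSection D U (D (g t)) :=
  hD.eqOn_of_eqOn hs hg
    ((h.continuousOn_section hD).comp (hD.continuous.comp_continuousOn hg) hA)
    (fun a ha => (h.map_section (hA a ha)).symm) ht (h.section_map htU).symm

/-- The intersection `A ∩ B` is convex, hence connected, so a single common point of the two sheets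
propagates to all of it. -/
theorem eq_section_of_section (hD : IsDevelopingMap D) {V : Set X} {B : Set Plane}
    (h : IsSheet D U A) (h' : IsSheet D V B) (hUV : (U ∩ V).Nonempty) {a : Plane}
    (ha : a ∈ A ∩ B) : sheetSection D U a = sheetSection D V a := by
  obtain ⟨x, hxU, hxV⟩ := hUV
  refine hD.eqOn_of_eqOn (h.convex.inter h'.convex).isPreconnected
    ((h.continuousOn_section hD).mono inter_subset_left)
    ((h'.continuousOn_section hD).mono inter_subset_right)
    (fun b hb => by rw [h.map_section hb.1, h'.map_section hb.2])
    (a := D x) ⟨h.bijOn.mapsTo hxU, h'.bijOn.mapsTo hxV⟩ ?_ ha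
  rw [h.section_map hxU, h'.section_map hxV]

theorem exists_path (hD : IsDevelopingMap D) (h : IsSheet D U A) {x y : X} (hx : x ∈ U)
    (hy : y ∈ U) : ∃ γ : Path x y, ∀ t, γ t ∈ U ∧ D (γ t) = D x + (t : ℝ) • (D y - D x) := by
  have hA : ∀ t : unitInterval, D x + (t : ℝ) • (D y - D x) ∈ A := fun t =>
    h.convex.add_smul_sub_mem (h.bijOn.mapsTo hx) (h.bijOn.mapsTo hy) t.2
  refine ⟨⟨⟨fun t => sheetSection D U (D x + (t : ℝ) • (D y - D x)), ?_⟩, ?_, ?_⟩, fun t => ?_⟩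
  · exact (h.continuousOn_section hD).comp_continuous (by fun_prop) hA
  · simp [h.section_map hx]
  · simp [h.section_map hy]
  · exact ⟨h.section_mem (hA t), h.map_section (hA t)⟩

theorem isFlatConvex (hD : IsDevelopingMap D) (h : IsSheet D U A) : IsFlatConvex U := by
  intro x hx y hy
  obtain ⟨γ, hγ⟩ := h.exists_path hD hx hy
  refine ⟨γ, fun t => (hγ t).1, D x, D y - D x, ?_⟩
  have := hD.isDevelopmentAlong γ 0
  simpa only [(hγ _).2, add_zero] using this

end IsSheet

theorem IsFlatConvex.exists_path {U : Set X} (hU : IsFlatConvex U) (hD : IsDevelopingMap D)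
    {x y : X} (hx : x ∈ U) (hy : y ∈ U) : ∃ γ : Path x y, (∀ t, γ t ∈ U) ∧
      ∀ t, D (γ t) = D x + (t : ℝ) • (D y - D x) := by
  obtain ⟨γ, hγU, a, v, hδ⟩ := hU x hx y hy
  obtain ⟨c, hc⟩ := hD.exists_eq_of_isDevelopmentAlong hδ
  have h0 := hc 0
  have h1 := hc 1
  simp only [γ.source, γ.target, Icc.coe_zero, Icc.coe_one, zero_smul, one_smul,
    add_zero] at h0 h1
  refine ⟨γ, hγU, fun t => ?_⟩
  rw [← sub_eq_iff_eq_add.2 (hc t), h0]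
  have hv : v = D y - D x := by
    rw [h0] at h1
    have := congrArg (fun z => z - (D x + c)) h1
    simp only [add_sub_cancel_left] at this
    rw [this]; abel
  rw [hv]; abel

/-- Geodesics inside `U` develop to straight segments, which gives convexity of the image at once.
Openness and injectivity come from comparing these geodesics with other lifts of the same segment.
-/
theorem IsFlatConvex.isSheet {U : Set X} (hU : IsFlatConvex U) (hD : IsDevelopingMap D)
    (hA : IsOpen (D '' U)) : IsSheet D U (D '' U) := by
  refine ⟨?_, ?_, ?_⟩
  · rw [isOpen_iff_mem_nhds]
    intro x hx
    obtain ⟨e, hxe, rfl⟩ := hD.isLocalHomeomorph x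
    obtain ⟨r, hr, hB⟩ := Metric.isOpen_iff.1 (hA.inter e.open_target) (e x)
      ⟨mem_image_of_mem e hx, e.map_source hxe⟩
    have hnhds : e.source ∩ e ⁻¹' Metric.ball (e x) r ∈ 𝓝 x :=
      (e.isOpen_inter_preimage Metric.isOpen_ball).mem_nhds ⟨hxe, Metric.mem_ball_self hr⟩
    filter_upwards [hnhds] with y hy
    obtain ⟨u, huU, hu⟩ := (hB hy.2).1
    obtain ⟨γ, hγU, hγ⟩ := hU.exists_path hD hx huU
    have hball : ∀ t, e (γ t) ∈ Metric.ball (e x) r := fun t => by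
      rw [hγ]
      refine (convex_ball _ _).add_smul_sub_mem (Metric.mem_ball_self hr) ?_ t.2
      rw [hu]; exact hy.2
    -- The geodesic from `x` to the point `u` of `U` over `e y` stays over the ball, so it is the
    -- lift given by the local inverse of `D` and ends at `y`. Hence `y = u` lies in `U`.
    have heq := hD.eqOn_of_eqOn (s := univ) isPreconnected_univ γ.continuous.continuousOn
      (g₂ := fun t => e.symm (e (γ t)))
      (e.continuousOn_symm.comp (hD.continuous.comp γ.continuous).continuousOn
        fun t _ => (hB (hball t)).2)
      (fun t _ => (e.right_inv (hB (hball t)).2).symm) (mem_univ 0)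
      (by simp [e.left_inv hxe])
    have h1 := heq (mem_univ 1)
    simp only [γ.target] at h1
    rw [hu, e.left_inv hy.1] at h1
    exact h1 ▸ huU
  · rintro _ ⟨x, hx, rfl⟩ _ ⟨y, hy, rfl⟩ a b ha hb hab
    obtain ⟨γ, hγU, hγ⟩ := hU.exists_path hD hx hy
    refine ⟨γ ⟨b, hb, by linarith⟩, hγU _, ?_⟩
    rw [hγ]
    obtain rfl : a = 1 - b := eq_sub_of_add_eq hab
    simp only
    module
  · refine ⟨mapsTo_image _ _, fun x hx y hy hxy => ?_, surjOn_image _ _⟩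
    obtain ⟨γ, hγU, hγ⟩ := hU.exists_path hD hx hy
    -- When `D x = D y` the geodesic develops to a constant, so it is constant.
    have heq := hD.eqOn_of_eqOn (s := univ) isPreconnected_univ γ.continuous.continuousOn
      (g₂ := fun _ => x) continuousOn_const (fun t _ => by rw [hγ, hxy]; simp) (mem_univ 0)
      γ.source
    have h1 := heq (mem_univ 1)
    simp only [γ.target] at h1
    exact h1.symm

end Sheet

end

section

/-! ### Extension of the developing map to the completion. -/

section Completion

variable {X : Type*} [MetricSpace X] [ChartedSpace Plane X] {D : X → Plane}

/-- The continuous extension of a developing map to the metric completion. -/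
def devExt (D : X → Plane) : Completion X → Plane := Completion.extension D

/-- A compact neighbourhood of `x` in `X` stays closed in the completion, and by density it absorbs
a whole ball of the completion around `x`. -/
theorem isOpen_range_coe_completion : IsOpen (range ((↑) : X → Completion X)) := by
  have : LocallyCompactSpace X := ChartedSpace.locallyCompactSpace Plane X
  rw [isOpen_iff_mem_nhds]
  rintro _ ⟨x, rfl⟩
  obtain ⟨K, hK, hxK⟩ := exists_compact_mem_nhds x
  obtain ⟨r, hr, hrK⟩ := Metric.mem_nhds_iff.1 hxK
  filter_upwards [Metric.ball_mem_nhds (x : Completion X) hr] with z hz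
  have hKc : IsClosed ((↑) '' K : Set (Completion X)) :=
    (hK.image (Completion.continuous_coe X)).isClosed
  have hz' : z ∈ closure ((↑) '' K : Set (Completion X)) := by
    rw [Metric.mem_closure_iff]
    intro ε hε
    obtain ⟨_, hy, y, rfl⟩ := Metric.mem_closure_iff.1 (Completion.denseRange_coe z)
      (min ε (r - dist z x)) (lt_min hε (sub_pos.2 hz)) |>.imp fun b hb => And.intro hb.2 hb.1
    refine ⟨y, mem_image_of_mem _ (hrK ?_), hy.trans_le (min_le_left _ _)⟩
    have h1 := dist_triangle_left (y : Completion X) x z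
    have h2 := hy.trans_le (min_le_right _ _)
    rw [Metric.mem_ball, ← Completion.dist_eq]
    linarith
  rw [hKc.closure_eq] at hz'
  exact image_subset_range _ _ hz'

theorem isOpenEmbedding_coe_completion : IsOpenEmbedding ((↑) : X → Completion X) :=
  ⟨Completion.coe_isometry.isEmbedding, isOpen_range_coe_completion⟩

theorem coe_notMem_surfaceFrontier (x : X) : (x : Completion X) ∉ surfaceFrontier X :=
  fun h => h (mem_range_self x)

theorem exists_coe_of_notMem_surfaceFrontier {z : Completion X} (h : z ∉ surfaceFrontier X) :
    ∃ x : X, (x : Completion X) = z := by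
  simpa [surfaceFrontier] using h

theorem exists_ball_surfaceFrontier (hX : DiscreteTopology (surfaceFrontier X))
    (z : Completion X) : ∃ r > 0, ∀ z' ∈ surfaceFrontier X, dist z' z < r → z' = z := by
  by_cases hz : z ∈ surfaceFrontier X
  · obtain ⟨r, hr, h⟩ := Metric.mem_nhds_iff.1 (nhds_discrete (surfaceFrontier X) ▸
      mem_pure.2 rfl : {⟨z, hz⟩} ∈ 𝓝 (⟨z, hz⟩ : surfaceFrontier X))
    exact ⟨r, hr, fun z' hz' hd => congrArg Subtype.val (h (a := ⟨z', hz'⟩) hd)⟩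
  · obtain ⟨r, hr, h⟩ := Metric.isOpen_iff.1 (isOpen_range_coe_completion (X := X)) z
      (not_not.1 hz)
    exact ⟨r, hr, fun z' hz' hd => (hz' (h hd)).elim⟩

variable [TranslationSurface X]

theorem devExt_coe (hD : IsDevelopingMap D) (x : X) : devExt D x = D x :=
  Completion.extension_coe hD.lipschitz.uniformContinuous x

theorem lipschitz_devExt (hD : IsDevelopingMap D) : LipschitzWith 1 (devExt D) :=
  hD.lipschitz.completion_extension

theorem continuous_devExt (hD : IsDevelopingMap D) : Continuous (devExt D) :=
  (lipschitz_devExt hD).continuous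

theorem dist_devExt_le (hD : IsDevelopingMap D) (z z' : Completion X) :
    dist (devExt D z) (devExt D z') ≤ dist z z' := by
  simpa using (lipschitz_devExt hD).dist_le_mul z z'

namespace IsSheet

variable {U : Set X} {A : Set Plane} [Nonempty X]

/-- `D` never increases distances, and the planar segment between the images lifts inside `U`, which
bounds the distance from the other side. -/
theorem dist_map (hD : IsDevelopingMap D) (h : IsSheet D U A) {x y : X} (hx : x ∈ U)
    (hy : y ∈ U) : dist (D x) (D y) = dist x y := by
  obtain ⟨γ, hγ⟩ := h.exists_path hD hx hy
  refine le_antisymm ?_ ?_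
  · simpa using hD.lipschitz.dist_le_mul x y
  · have := hD.edist_le_of_segment γ (fun t => (hγ t).2)
    rw [← ofReal_norm, edist_dist, ENNReal.ofReal_le_ofReal_iff (norm_nonneg _)] at this
    rwa [dist_comm (D x), dist_eq_norm]

theorem dist_devExt (hD : IsDevelopingMap D) (h : IsSheet D U A) {z z' : Completion X}
    (hz : z ∈ closure ((↑) '' U)) (hz' : z' ∈ closure ((↑) '' U)) :
    dist (devExt D z) (devExt D z') = dist z z' := by
  have key : ∀ y ∈ U, ∀ z ∈ closure ((↑) '' U : Set (Completion X)),
      dist (devExt D y) (devExt D z) = dist (y : Completion X) z := fun y hy => by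
    refine closure_minimal (s := (↑) '' U) ?_ (isClosed_eq
      (continuous_const.dist (continuous_devExt hD)) (continuous_const.dist continuous_id))
    rintro _ ⟨x, hx, rfl⟩
    rw [mem_ofPred_eq, devExt_coe hD, devExt_coe hD, id, Completion.dist_eq]
    exact h.dist_map hD hy hx
  refine closure_minimal (s := (↑) '' U)
    (t := {z : Completion X | dist (devExt D z) (devExt D z') = dist z z'}) ?_ (isClosed_eq
      ((continuous_devExt hD).dist continuous_const) (continuous_id.dist continuous_const)) hz
  rintro _ ⟨x, hx, rfl⟩
  exact key x hx z' hz'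

/-- The closure of `U` in the completion is complete and `devExt D` is isometric on it, so its image
is closed. -/
theorem image_closure (hD : IsDevelopingMap D) (h : IsSheet D U A) :
    devExt D '' closure ((↑) '' U) = closure A := by
  have hA : devExt D '' ((↑) '' U) = A := by
    rw [image_image, ← h.bijOn.image_eq]
    simp only [devExt_coe hD]
  apply subset_antisymm
  · exact (image_closure_subset_closure_image (continuous_devExt hD)).trans (closure_mono hA.le)
  · refine closure_minimal ?_ ?_
    · rw [← hA]; exact image_mono subset_closure
    · rw [image_eq_range]
      have hi : Isometry fun z : closure ((↑) '' U : Set (Completion X)) => devExt D z :=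
        Isometry.of_dist_eq fun z z' => h.dist_devExt hD z.2 z'.2
      have : CompleteSpace (closure ((↑) '' U : Set (Completion X))) :=
        isClosed_closure.completeSpace_coe
      exact hi.isClosedEmbedding.isClosed_range

end IsSheet

instance [Nonempty X] : Nonempty (Completion X) := ⟨(Classical.arbitrary X : X)⟩

/-- The inverse of the extended developing map on the closure of a sheet. -/
def sheetExt [Nonempty X] (D : X → Plane) (U : Set X) : Plane → Completion X :=
  Function.invFunOn (devExt D) (closure ((↑) '' U))

namespace IsSheet

variable {U : Set X} {A : Set Plane} [Nonempty X]

theorem ext_mem (hD : IsDevelopingMap D) (h : IsSheet D U A) {a : Plane} (ha : a ∈ closure A) :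
    sheetExt D U a ∈ closure ((↑) '' U : Set (Completion X)) := by
  rw [← h.image_closure hD] at ha
  exact Function.invFunOn_mem ha

theorem map_ext (hD : IsDevelopingMap D) (h : IsSheet D U A) {a : Plane} (ha : a ∈ closure A) :
    devExt D (sheetExt D U a) = a := by
  rw [← h.image_closure hD] at ha
  exact Function.invFunOn_eq ha

theorem map_mem_closure (hD : IsDevelopingMap D) (h : IsSheet D U A) {z : Completion X}
    (hz : z ∈ closure ((↑) '' U)) : devExt D z ∈ closure A := by
  rw [← h.image_closure hD]; exact mem_image_of_mem _ hz

theorem ext_map (hD : IsDevelopingMap D) (h : IsSheet D U A) {z : Completion X}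
    (hz : z ∈ closure ((↑) '' U)) : sheetExt D U (devExt D z) = z := by
  have hm := h.map_mem_closure hD hz
  rw [← dist_le_zero, ← h.dist_devExt hD (h.ext_mem hD hm) hz, h.map_ext hD hm, dist_self]

theorem dist_ext (hD : IsDevelopingMap D) (h : IsSheet D U A) {a b : Plane}
    (ha : a ∈ closure A) (hb : b ∈ closure A) :
    dist (sheetExt D U a) (sheetExt D U b) = dist a b := by
  rw [← h.dist_devExt hD (h.ext_mem hD ha) (h.ext_mem hD hb), h.map_ext hD ha, h.map_ext hD hb]

theorem continuousOn_ext (hD : IsDevelopingMap D) (h : IsSheet D U A) :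
    ContinuousOn (sheetExt D U) (closure A) :=
  LipschitzOnWith.continuousOn (K := 1) <| LipschitzOnWith.of_dist_le_mul fun a ha b hb => by
    simp [h.dist_ext hD ha hb]

theorem ext_eq_section (hD : IsDevelopingMap D) (h : IsSheet D U A) {a : Plane} (ha : a ∈ A) :
    sheetExt D U a = sheetSection D U a := by
  have := h.ext_map hD (subset_closure (mem_image_of_mem _ (h.section_mem ha)))
  rwa [devExt_coe hD, h.map_section ha] at this

theorem bdry_eq (h : IsSheet D U A) :
    bdry U = closure ((↑) '' U : Set (Completion X)) \ ((↑) '' U) :=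
  (isOpenEmbedding_coe_completion.isOpenMap U h.isOpen).frontier_eq

theorem mem_bdry_iff (hD : IsDevelopingMap D) (h : IsSheet D U A) {z : Completion X} :
    z ∈ bdry U ↔ z ∈ closure ((↑) '' U : Set (Completion X)) ∧ devExt D z ∉ A := by
  rw [h.bdry_eq, Set.mem_sdiff]
  refine and_congr_right fun hz => not_congr ⟨?_, fun ha => ?_⟩
  · rintro ⟨x, hx, rfl⟩
    rw [devExt_coe hD]; exact h.bijOn.mapsTo hx
  · rw [← h.ext_map hD hz, h.ext_eq_section hD ha]
    exact mem_image_of_mem _ (h.section_mem ha)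

theorem map_mem_frontier (hD : IsDevelopingMap D) (h : IsSheet D U A) {z : Completion X}
    (hz : z ∈ bdry U) : devExt D z ∈ frontier A := by
  obtain ⟨h1, h2⟩ := (h.mem_bdry_iff hD).1 hz
  rw [(h.isOpen_target hD).frontier_eq]
  exact ⟨h.map_mem_closure hD h1, h2⟩

theorem ext_mem_bdry (hD : IsDevelopingMap D) (h : IsSheet D U A) {a : Plane}
    (ha : a ∈ frontier A) : sheetExt D U a ∈ bdry U := by
  rw [(h.isOpen_target hD).frontier_eq] at ha
  refine (h.mem_bdry_iff hD).2 ⟨h.ext_mem hD ha.1, ?_⟩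
  rw [h.map_ext hD ha.1]; exact ha.2

theorem ext_map_of_mem_bdry (hD : IsDevelopingMap D) (h : IsSheet D U A) {z : Completion X}
    (hz : z ∈ bdry U) : sheetExt D U (devExt D z) = z :=
  h.ext_map hD ((h.mem_bdry_iff hD).1 hz).1

theorem mem_bdry_of_mem_surfaceFrontier (h : IsSheet D U A)
    {z : Completion X} (hz : z ∈ closure ((↑) '' U)) (hzX : z ∈ surfaceFrontier X) :
    z ∈ bdry U := by
  rw [h.bdry_eq]
  refine ⟨hz, ?_⟩
  rintro ⟨x, -, rfl⟩
  exact coe_notMem_surfaceFrontier x hzX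

theorem segment_mem (hD : IsDevelopingMap D) (h : IsSheet D U A) {a w : Plane} (ha : a ∈ A)
    (hw : w ∈ closure A) {t : ℝ} (ht : t ∈ Ico (0 : ℝ) 1) : a + t • (w - a) ∈ A := by
  have hA := (h.isOpen_target hD).interior_eq
  have := h.convex.add_smul_sub_mem_interior' hw (hA.symm ▸ ha) (t := 1 - t)
    ⟨by linarith [ht.2], by linarith [ht.1]⟩
  rw [hA] at this
  convert this using 1
  module

end IsSheet

end Completion

end

section

/-! ### Lifting rays, and frontier points visible from a base point. -/

section Rays

variable {X : Type*} [MetricSpace X] [ChartedSpace Plane X] {D : X → Plane}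

/-- `c` lifts, on the set `J` of times, the ray with velocity `v` that issues from `D o`. -/
structure IsRayLift (D : X → Plane) (o : X) (v : Plane) (J : Set ℝ) (c : ℝ → X) : Prop where
  continuousOn : ContinuousOn c J
  zero : c 0 = o
  map : ∀ t ∈ J, D (c t) = D o + t • v

/-- The frontier point `z` is the end of a lift of a straight segment that issues from `o`. -/
def IsVisibleFrom (D : X → Plane) (o : X) (z : Completion X) : Prop :=
  z ∈ surfaceFrontier X ∧ ∃ c : ℝ → X, IsRayLift D o (devExt D z - D o) (Ico 0 1) c ∧
    Tendsto (fun t => (c t : Completion X)) (𝓝[<] 1) (𝓝 z)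

namespace IsRayLift

variable {o : X} {v : Plane} {J : Set ℝ} {c c' : ℝ → X}

theorem mono (h : IsRayLift D o v J c) {K : Set ℝ} (hK : K ⊆ J) : IsRayLift D o v K c :=
  ⟨h.continuousOn.mono hK, h.zero, fun t ht => h.map t (hK ht)⟩

theorem eqOn (hD : IsDevelopingMap D) (hJ : IsPreconnected J) (h0 : (0 : ℝ) ∈ J)
    (h : IsRayLift D o v J c) (h' : IsRayLift D o v J c') : EqOn c c' J :=
  hD.eqOn_of_eqOn hJ h.continuousOn h'.continuousOn
    (fun t ht => by rw [h.map t ht, h'.map t ht]) h0 (by rw [h.zero, h'.zero])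

theorem comp_mul (h : IsRayLift D o v J c) {T : ℝ} {K : Set ℝ} (hK : ∀ t ∈ K, t * T ∈ J) :
    IsRayLift D o (T • v) K fun t => c (t * T) :=
  ⟨h.continuousOn.comp (by fun_prop) hK, by simp [h.zero], fun t ht => by
    rw [h.map _ (hK t ht), mul_smul]⟩

theorem extend (hD : IsDevelopingMap D) {T : ℝ} (hT : 0 ≤ T)
    (h : IsRayLift D o v (Icc 0 T) c) : ∃ δ > 0, ∃ c', IsRayLift D o v (Icc 0 (T + δ)) c' := by
  obtain ⟨e, he, rfl⟩ := hD.isLocalHomeomorph (c T)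
  have hTm : T ∈ Icc 0 T := right_mem_Icc.2 hT
  have hcont : Continuous fun t : ℝ => e o + t • v := by fun_prop
  have htgt : e o + T • v ∈ e.target := by
    rw [← h.map T hTm]; exact e.map_source he
  obtain ⟨δ, hδ, hb⟩ := Metric.isOpen_iff.1 (e.open_target.preimage hcont) T htgt
  have hsub : ∀ t ∈ Icc T (T + δ / 2), e o + t • v ∈ e.target := fun t ht =>
    hb (by rw [Metric.mem_ball, Real.dist_eq, abs_lt]; constructor <;> linarith [ht.1, ht.2])
  have heq : ∀ t ∈ Icc T (T + δ / 2),
      (if t ≤ T then c t else e.symm (e o + t • v)) = e.symm (e o + t • v) := by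
    intro t ht
    split_ifs with hle
    · obtain rfl : t = T := le_antisymm hle ht.1
      rw [← h.map t hTm, e.left_inv he]
    · rfl
  refine ⟨δ / 2, by linarith, fun t => if t ≤ T then c t else e.symm (e o + t • v), ?_, ?_, ?_⟩
  · rw [← Icc_union_Icc_eq_Icc hT (by linarith : T ≤ T + δ / 2)]
    refine ContinuousOn.union_of_isClosed ?_ ?_ isClosed_Icc isClosed_Icc
    · exact h.continuousOn.congr fun t ht => if_pos ht.2
    · exact (e.continuousOn_symm.comp hcont.continuousOn hsub).congr heq
  · rw [if_pos hT, h.zero]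
  · intro t ht
    by_cases hle : t ≤ T
    · rw [if_pos hle, h.map t ⟨ht.1, hle⟩]
    · have hm : t ∈ Icc T (T + δ / 2) := ⟨(not_le.1 hle).le, ht.2⟩
      rw [if_neg hle, e.right_inv (hsub t hm)]

theorem extend_of_tendsto (hD : IsDevelopingMap D) {T : ℝ} (hT : 0 < T)
    (h : IsRayLift D o v (Ico 0 T) c) {x : X} (hx : Tendsto c (𝓝[<] T) (𝓝 x)) :
    ∃ c', IsRayLift D o v (Icc 0 T) c' := by
  have hne : ∀ t ∈ Ico 0 T, Function.update c T x t = c t := fun t ht =>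
    Function.update_of_ne ht.2.ne _ _
  refine ⟨Function.update c T x, ?_, ?_, ?_⟩
  · rw [continuousOn_update_iff, Icc_sdiff_right, nhdsWithin_Ico_eq_nhdsLT hT]
    exact ⟨h.continuousOn, fun _ => hx⟩
  · rw [hne 0 ⟨le_rfl, hT⟩, h.zero]
  · intro t ht
    rcases ht.2.eq_or_lt with rfl | hlt
    · rw [Function.update_self]
      have h1 : Tendsto (fun s => D (c s)) (𝓝[<] t) (𝓝 (D x)) :=
        (hD.continuous.tendsto x).comp hx
      have h2 : Tendsto (fun s : ℝ => D o + s • v) (𝓝[<] t) (𝓝 (D o + t • v)) :=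
        ((by fun_prop : Continuous fun s : ℝ => D o + s • v).tendsto t).mono_left
          nhdsWithin_le_nhds
      refine tendsto_nhds_unique h1 (h2.congr' ?_)
      filter_upwards [Ico_mem_nhdsLT hT] with s hs using (h.map s hs).symm
    · rw [hne t ⟨ht.1, hlt⟩, h.map t ⟨ht.1, hlt⟩]

variable [TranslationSurface X]

theorem dist_le (hD : IsDevelopingMap D) (hJ : J.OrdConnected) (h : IsRayLift D o v J c)
    {s t : ℝ} (hs : s ∈ J) (ht : t ∈ J) : dist (c s) (c t) ≤ |t - s| * ‖v‖ := by
  have hm : ∀ r : unitInterval, s + (r : ℝ) * (t - s) ∈ J := fun r =>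
    (convex_iff_ordConnected.2 hJ).add_smul_sub_mem hs ht r.2
  let γ : Path (c s) (c t) :=
    ⟨⟨fun r => c (s + (r : ℝ) * (t - s)), h.continuousOn.comp_continuous (by fun_prop) hm⟩,
      by simp, by simp⟩
  have := hD.edist_le_of_segment γ (a := D o + s • v) (v := (t - s) • v) fun r => by
    change D (c (s + (r : ℝ) * (t - s))) = _
    rw [h.map _ (hm r)]; module
  rwa [← ofReal_norm, edist_dist, ENNReal.ofReal_le_ofReal_iff (norm_nonneg _), norm_smul,
    Real.norm_eq_abs] at this

theorem exists_tendsto (hD : IsDevelopingMap D) {T : ℝ} (hT : 0 < T)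
    (h : IsRayLift D o v (Ico 0 T) c) :
    ∃ z : Completion X, Tendsto (fun t => (c t : Completion X)) (𝓝[<] T) (𝓝 z) := by
  have hu : UniformContinuousOn (fun t => (c t : Completion X)) (Ico 0 T) := by
    refine LipschitzOnWith.uniformContinuousOn (K := ‖v‖₊) <|
      LipschitzOnWith.of_dist_le_mul fun s hs t ht => ?_
    rw [Completion.dist_eq, coe_nnnorm, mul_comm, dist_comm s t, Real.dist_eq]
    exact h.dist_le hD ordConnected_Ico hs ht
  have hc : Cauchy (Filter.map (fun t => (c t : Completion X)) (𝓝[<] T)) := by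
    refine ⟨inferInstance, ?_⟩
    have hle : 𝓝[<] T ≤ 𝓟 (Ico 0 T) := le_principal_iff.2 (Ico_mem_nhdsLT hT)
    have hT' : Cauchy (𝓝[<] T) := (cauchy_nhds (a := T)).mono nhdsWithin_le_nhds
    rw [prod_map_map_eq]
    refine Tendsto.mono_left hu ?_
    exact le_inf hT'.2 ((Filter.prod_mono hle hle).trans_eq prod_principal_principal)
  exact CompleteSpace.complete hc

theorem exists_or_isVisible (hD : IsDevelopingMap D) (o : X) (v : Plane) :
    (∃ c, IsRayLift D o v (Icc 0 1) c) ∨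
      ∃ T ∈ Ioc (0 : ℝ) 1, ∃ z, IsVisibleFrom D o z ∧ devExt D z = D o + T • v := by
  by_contra hcon
  push Not at hcon
  obtain ⟨hno, hvis⟩ := hcon
  let S : Set ℝ := {T | T ∈ Icc (0 : ℝ) 1 ∧ ∃ c, IsRayLift D o v (Icc 0 T) c}
  have h0 : (0 : ℝ) ∈ S := by
    refine ⟨⟨le_rfl, zero_le_one⟩, fun _ => o, continuousOn_const, rfl, fun t ht => ?_⟩
    rw [le_antisymm ht.2 ht.1]; simp
  have hbdd : BddAbove S := ⟨1, fun T hT => hT.1.2⟩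
  have hext : ∀ T ∈ S, T < 1 ∧ ∃ T' ∈ S, T < T' := by
    rintro T ⟨hT, c, hc⟩
    have hT1 : T < 1 := by
      refine hT.2.lt_of_ne ?_
      rintro rfl
      exact hno c hc
    obtain ⟨δ, hδ, c', hc'⟩ := hc.extend hD hT.1
    exact ⟨hT1, min 1 (T + δ), ⟨⟨le_min zero_le_one (by linarith [hT.1]), min_le_left _ _⟩, c',
      hc'.mono (Icc_subset_Icc_right (min_le_right _ _))⟩, lt_min hT1 (by linarith)⟩
  set T := sSup S with hTdef
  have hT0 : 0 < T := by
    obtain ⟨-, T', hT', hlt⟩ := hext 0 h0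
    exact hlt.trans_le (le_csSup hbdd hT')
  have hT1 : T ≤ 1 := csSup_le ⟨0, h0⟩ fun t ht => ht.1.2
  have hTS : T ∉ S := fun h => by
    obtain ⟨-, T', hT', hlt⟩ := hext T h
    exact hlt.not_ge (le_csSup hbdd hT')
  have hdown : ∀ t ∈ Ico 0 T, ∃ c, IsRayLift D o v (Icc 0 t) c := fun t ht => by
    obtain ⟨T', ⟨-, c, hc⟩, hlt⟩ := exists_lt_of_lt_csSup ⟨0, h0⟩ ht.2
    exact ⟨c, hc.mono (Icc_subset_Icc_right hlt.le)⟩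
  have : Nonempty X := ⟨o⟩
  choose! c hc using hdown
  have hceq : ∀ t ∈ Ico 0 T, ∀ s ∈ Icc 0 t, c s s = c t s := fun t ht s hs =>
    IsRayLift.eqOn hD isPreconnected_Icc ⟨le_rfl, hs.1⟩
      (hc s ⟨hs.1, hs.2.trans_lt ht.2⟩) ((hc t ht).mono (Icc_subset_Icc_right hs.2)) ⟨hs.1, le_rfl⟩
  -- The lifts `c t` on the intervals `[0, t]` agree with one another, so their diagonal is one lift
  -- on `[0, T)`.
  have hg : IsRayLift D o v (Ico 0 T) fun t => c t t := by
    refine ⟨fun t ht => ?_, (hc 0 ⟨le_rfl, hT0⟩).zero, fun t ht => (hc t ht).map t ⟨ht.1, le_rfl⟩⟩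
    obtain ⟨t', htt', ht'⟩ := exists_between ht.2
    have hm : t' ∈ Ico 0 T := ⟨ht.1.trans htt'.le, ht'⟩
    have h1 := ((hc t' hm).continuousOn.congr (hceq t' hm)) t ⟨ht.1, htt'.le⟩
    refine h1.mono_of_mem_nhdsWithin ?_
    filter_upwards [self_mem_nhdsWithin, mem_nhdsWithin_of_mem_nhds (Iio_mem_nhds htt')]
      with s hs hs' using ⟨hs.1, le_of_lt hs'⟩
  obtain ⟨z, hz⟩ := hg.exists_tendsto hD hT0
  have hdz : devExt D z = D o + T • v := by
    have h1 : Tendsto (fun t => D (c t t)) (𝓝[<] T) (𝓝 (devExt D z)) :=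
      (((continuous_devExt hD).tendsto z).comp hz).congr fun t => devExt_coe hD _
    have h2 : Tendsto (fun s : ℝ => D o + s • v) (𝓝[<] T) (𝓝 (D o + T • v)) :=
      ((by fun_prop : Continuous fun s : ℝ => D o + s • v).tendsto T).mono_left
        nhdsWithin_le_nhds
    refine tendsto_nhds_unique h1 (h2.congr' ?_)
    filter_upwards [Ico_mem_nhdsLT hT0] with s hs using (hg.map s hs).symm
  by_cases hzX : z ∈ surfaceFrontier X
  · refine hvis T ⟨hT0, hT1⟩ z ⟨hzX, fun t => c (t * T) (t * T), ?_, ?_⟩ hdz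
    · rw [hdz, add_sub_cancel_left]
      exact hg.comp_mul fun t ht =>
        ⟨mul_nonneg ht.1 hT0.le, by nlinarith [ht.2]⟩
    · refine hz.comp (tendsto_nhdsWithin_iff.2 ⟨?_, ?_⟩)
      · have : Tendsto (fun t : ℝ => t * T) (𝓝 1) (𝓝 (1 * T)) :=
          (by fun_prop : Continuous fun t : ℝ => t * T).tendsto 1
        rw [one_mul] at this
        exact this.mono_left nhdsWithin_le_nhds
      · filter_upwards [self_mem_nhdsWithin] with t ht
        have ht' : t < 1 := ht
        show t * T < T
        nlinarith
  · obtain ⟨x, rfl⟩ := exists_coe_of_notMem_surfaceFrontier hzX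
    have hx : Tendsto (fun t => c t t) (𝓝[<] T) (𝓝 x) :=
      isOpenEmbedding_coe_completion.isInducing.tendsto_nhds_iff.2 hz
    obtain ⟨c', hc'⟩ := hg.extend_of_tendsto hD hT0 hx
    exact hTS ⟨⟨hT0.le, hT1⟩, c', hc'⟩

end IsRayLift

/-- The end point of the lifted segment depends continuously on `w`, by continuity of lifts in
families. This gives a section of `D` over `B`, and a continuous section of a local homeomorphism
over an open set is an open embedding. -/
theorem exists_isSheet_of_rayLift (hD : IsDevelopingMap D) {o : X} {B : Set Plane}
    (hB : IsOpen B) (hBc : Convex ℝ B) (ho : D o ∈ B)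
    (h : ∀ w ∈ B, ∃ c, IsRayLift D o (w - D o) (Icc 0 1) c) :
    ∃ U, IsSheet D U B ∧ o ∈ U := by
  have : Nonempty X := ⟨o⟩
  choose! c hc using h
  let g : unitInterval × B → X := fun p => c p.2 p.1
  let f : C(unitInterval × B, Plane) :=
    ⟨fun p => D o + (p.1 : ℝ) • ((p.2 : Plane) - D o), by fun_prop⟩
  have hg : Continuous g := by
    refine hD.isLocalHomeomorph.continuous_lift (T2Space.isSeparatedMap D) f ?_ ?_ ?_
    · ext1 p; exact (hc p.2 p.2.2).map p.1 p.1.2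
    · simp only [g, Icc.coe_zero, fun a : B => (hc a a.2).zero]; exact continuous_const
    · intro a
      exact (hc a a.2).continuousOn.comp_continuous continuous_subtype_val fun t => t.2
  let s : B → X := fun a => g (1, a)
  have hs : Continuous s := hg.comp (by fun_prop)
  have hDs : ∀ a : B, D (s a) = a := fun a => by
    have := (hc a a.2).map 1 ⟨zero_le_one, le_rfl⟩
    simpa [s, g] using this
  have hemb : IsOpenEmbedding s := by
    refine hD.isLocalHomeomorph.isOpenEmbedding_of_comp ?_ hs
    have : D ∘ s = Subtype.val := funext hDs
    rw [this]; exact hB.isOpenEmbedding_subtypeVal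
  refine ⟨range s, ⟨hemb.isOpen_range, hBc, ?_, ?_, ?_⟩, ⟨D o, ho⟩, ?_⟩
  · rintro _ ⟨a, rfl⟩; rw [hDs]; exact a.2
  · rintro _ ⟨a, rfl⟩ _ ⟨b, rfl⟩ hab
    rw [hDs, hDs] at hab; rw [Subtype.ext hab]
  · exact fun a ha => ⟨s ⟨a, ha⟩, mem_range_self _, hDs _⟩
  · have h1 : IsRayLift D o (D o - D o) (Icc 0 1) fun _ => o :=
      ⟨continuousOn_const, rfl, fun t _ => by simp⟩
    have := (hc _ ho).eqOn hD isPreconnected_Icc ⟨le_rfl, zero_le_one⟩ h1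
      (⟨zero_le_one, le_rfl⟩ : (1 : ℝ) ∈ Icc (0 : ℝ) 1)
    simpa [s, g] using this

variable [TranslationSurface X] [Nonempty X] {U : Set X} {A : Set Plane} {o : X}
  {z : Completion X}

namespace IsSheet

theorem isVisible_of_mem_bdry (hD : IsDevelopingMap D) (h : IsSheet D U A) (ho : o ∈ U)
    (hz : z ∈ bdry U) (hzX : z ∈ surfaceFrontier X) : IsVisibleFrom D o z := by
  have hA : ∀ t ∈ Ico (0 : ℝ) 1, D o + t • (devExt D z - D o) ∈ A := fun t ht =>
    h.segment_mem hD (h.bijOn.mapsTo ho) (frontier_subset_closure (h.map_mem_frontier hD hz)) ht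
  refine ⟨hzX, fun t => sheetSection D U (D o + t • (devExt D z - D o)), ⟨?_, ?_, ?_⟩, ?_⟩
  · exact (h.continuousOn_section hD).comp (by fun_prop) hA
  · simp [h.section_map ho]
  · exact fun t ht => h.map_section (hA t ht)
  · have hw := frontier_subset_closure (h.map_mem_frontier hD hz)
    have h1 : Tendsto (fun t : ℝ => D o + t • (devExt D z - D o)) (𝓝[<] 1)
        (𝓝[closure A] (devExt D z)) := by
      refine tendsto_nhdsWithin_iff.2 ⟨?_, ?_⟩
      · have := (by fun_prop : Continuous fun t : ℝ => D o + t • (devExt D z - D o)).tendsto 1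
        simp only [one_smul, add_sub_cancel] at this
        exact this.mono_left nhdsWithin_le_nhds
      · filter_upwards [Ico_mem_nhdsLT one_pos] with t ht using subset_closure (hA t ht)
    have h2 := (h.continuousOn_ext hD _ hw).tendsto.comp h1
    rw [h.ext_map_of_mem_bdry hD hz] at h2
    refine h2.congr' ?_
    filter_upwards [Ico_mem_nhdsLT one_pos] with t ht using h.ext_eq_section hD (hA t ht)

theorem eq_section_of_rayLift (hD : IsDevelopingMap D) (h : IsSheet D U A) (ho : o ∈ U)
    {v : Plane} {c : ℝ → X} {t : ℝ} (ht : 0 ≤ t) (hc : IsRayLift D o v (Icc 0 t) c)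
    (hA : D o + t • v ∈ A) : c t = sheetSection D U (D o + t • v) := by
  have hseg : ∀ s ∈ Icc 0 t, D (c s) ∈ A := by
    intro s hs
    rw [hc.map s hs]
    rcases ht.eq_or_lt with rfl | ht0
    · rwa [le_antisymm hs.2 hs.1]
    · have := h.convex.add_smul_sub_mem (h.bijOn.mapsTo ho) hA (t := s / t)
        ⟨div_nonneg hs.1 ht, (div_le_one ht0).2 hs.2⟩
      rwa [add_sub_cancel_left, smul_smul, div_mul_cancel₀ _ ht0.ne'] at this
  have := h.eqOn_section hD isPreconnected_Icc hc.continuousOn hseg (left_mem_Icc.2 ht)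
    (by rw [hc.zero]; exact ho) t (right_mem_Icc.2 ht)
  rwa [hc.map t (right_mem_Icc.2 ht)] at this

/-- While the ray is still over `A`, its lift is the one inside `U`. What is left of the ray has
length `(1 - t) * ‖devExt D z - D o‖`. -/
theorem dist_ext_le_of_isVisible (hD : IsDevelopingMap D) (h : IsSheet D U A) (ho : o ∈ U)
    (hz : IsVisibleFrom D o z) {t : ℝ} (ht : t ∈ Ico (0 : ℝ) 1)
    (hA : D o + t • (devExt D z - D o) ∈ A) :
    dist z (sheetExt D U (D o + t • (devExt D z - D o))) ≤ (1 - t) * ‖devExt D z - D o‖ := by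
  obtain ⟨hzX, c, hc, hlim⟩ := hz
  rw [h.ext_eq_section hD hA, ← h.eq_section_of_rayLift hD ho ht.1
      (hc.mono fun s hs => ⟨hs.1, hs.2.trans_lt ht.2⟩) hA]
  have h1 : Tendsto (fun s => dist (c s : Completion X) (c t)) (𝓝[<] 1) (𝓝 (dist z (c t))) :=
    hlim.dist tendsto_const_nhds
  refine le_of_tendsto h1 ?_
  filter_upwards [Ioo_mem_nhdsLT ht.2] with s hs
  rw [Completion.dist_eq, dist_comm]
  refine (hc.dist_le hD ordConnected_Ico ht ⟨ht.1.trans hs.1.le, hs.2⟩).trans ?_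
  rw [abs_of_pos (sub_pos.2 hs.1)]
  gcongr
  exact hs.2.le

theorem eq_ext_of_isVisible (hD : IsDevelopingMap D) (h : IsSheet D U A) (ho : o ∈ U)
    (hz : IsVisibleFrom D o z) (hw : devExt D z ∈ closure A) : z = sheetExt D U (devExt D z) := by
  have hA : ∀ t ∈ Ico (0 : ℝ) 1, D o + t • (devExt D z - D o) ∈ A := fun t ht =>
    h.segment_mem hD (h.bijOn.mapsTo ho) hw ht
  rw [← dist_le_zero]
  have h1 : Tendsto (fun t : ℝ => 2 * ((1 - t) * ‖devExt D z - D o‖)) (𝓝[<] 1) (𝓝 0) := by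
    have := (by fun_prop :
      Continuous fun t : ℝ => 2 * ((1 - t) * ‖devExt D z - D o‖)).tendsto 1
    simp only [sub_self, zero_mul, mul_zero] at this
    exact this.mono_left nhdsWithin_le_nhds
  refine ge_of_tendsto h1 ?_
  filter_upwards [Ico_mem_nhdsLT one_pos] with t ht
  have h2 := h.dist_ext_le_of_isVisible hD ho hz ht (hA t ht)
  have h3 := h.dist_ext hD (subset_closure (hA t ht)) hw
  have h4 : dist (D o + t • (devExt D z - D o)) (devExt D z) = (1 - t) * ‖devExt D z - D o‖ := by
    rw [dist_comm, dist_eq_norm, ← Real.norm_of_nonneg (sub_nonneg.2 ht.2.le), ← norm_smul]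
    congr 1; module
  have := dist_triangle z (sheetExt D U (D o + t • (devExt D z - D o)))
    (sheetExt D U (devExt D z))
  linarith

/-- A visible point over a plane point near `w` shares almost all of its ray with `U`, so it is
close in the completion to the point of the closure of `U` over `w`. Discreteness of the frontier
then makes the two equal. -/
theorem exists_ball_isVisible (hX : DiscreteTopology (surfaceFrontier X))
    (hD : IsDevelopingMap D) (h : IsSheet D U A) (ho : o ∈ U) {w : Plane} (hw : w ∈ closure A) :
    ∃ ρ > 0, ∀ z, IsVisibleFrom D o z → dist (devExt D z) w < ρ → z = sheetExt D U w := by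
  obtain ⟨r, hr, hball⟩ := exists_ball_surfaceFrontier hX (sheetExt D U w)
  have hcont : Continuous fun p : ℝ × Plane => D o + p.1 • (p.2 - D o) := by fun_prop
  have hlim1 : Tendsto (fun t : ℝ => (1 - t) * ‖w - D o‖ + dist (D o + t • (w - D o)) w)
      (𝓝[<] 1) (𝓝 0) := by
    have := (by fun_prop : Continuous fun t : ℝ =>
      (1 - t) * ‖w - D o‖ + dist (D o + t • (w - D o)) w).tendsto 1
    simp only [sub_self, zero_mul, one_smul, add_sub_cancel, dist_self, add_zero] at this
    exact this.mono_left nhdsWithin_le_nhds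
  -- The time `t` is fixed close to `1` for `w` itself. Both conditions on the ray at that time are
  -- open in its end point, so they persist for `w'` near `w`.
  obtain ⟨t, ht, htr⟩ := ((eventually_mem_set.2 (Ico_mem_nhdsLT (one_pos : (0 : ℝ) < 1))).and
    (hlim1.eventually (gt_mem_nhds hr))).exists
  have hA := h.segment_mem hD (h.bijOn.mapsTo ho) hw ht
  have hev : ∀ᶠ w' in 𝓝 w, D o + t • (w' - D o) ∈ A ∧
      (1 - t) * ‖w' - D o‖ + dist (D o + t • (w' - D o)) w < r :=
    ((by fun_prop : Continuous fun w' : Plane => D o + t • (w' - D o)).tendsto w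
      |>.eventually ((h.isOpen_target hD).mem_nhds hA)).and
    ((by fun_prop : Continuous fun w' : Plane =>
      (1 - t) * ‖w' - D o‖ + dist (D o + t • (w' - D o)) w).tendsto w
      |>.eventually (gt_mem_nhds htr))
  obtain ⟨ρ, hρ, hsub⟩ := Metric.eventually_nhds_iff.1 hev
  refine ⟨ρ, hρ, fun z hz hzw => hball z hz.1 ?_⟩
  obtain ⟨h1, h2⟩ := hsub hzw
  have h3 := h.dist_ext_le_of_isVisible hD ho hz ht h1
  have h4 := h.dist_ext hD (subset_closure h1) hw
  have := dist_triangle z (sheetExt D U (D o + t • (devExt D z - D o))) (sheetExt D U w)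
  linarith

/-- Near the closure of a sheet, the only visible frontier points are those of its boundary. -/
theorem exists_isOpen_isVisible (hX : DiscreteTopology (surfaceFrontier X))
    (hD : IsDevelopingMap D) (h : IsSheet D U A) (ho : o ∈ U) :
    ∃ N, IsOpen N ∧ closure A ⊆ N ∧ ∀ z, IsVisibleFrom D o z → devExt D z ∈ N → z ∈ bdry U := by
  have := fun w : closure A => h.exists_ball_isVisible hX hD ho w.2
  choose ρ hρ hvis using this
  refine ⟨⋃ w : closure A, Metric.ball (w : Plane) (ρ w), isOpen_iUnion fun w => Metric.isOpen_ball,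
    fun w hw => mem_iUnion.2 ⟨⟨w, hw⟩, Metric.mem_ball_self (hρ _)⟩, fun z hz hzN => ?_⟩
  obtain ⟨w, hw⟩ := mem_iUnion.1 hzN
  have := hvis w z hz hw
  refine h.mem_bdry_of_mem_surfaceFrontier ?_ hz.1
  rw [this]; exact h.ext_mem hD w.2

/-- A ray from `o` into `B` could be stopped only by a visible frontier point over `B`. The
hypothesis on `N` puts such a point in `∂U`, and `hZ` says that none of those lies over `B`. -/
theorem exists_isSheet_of_subset (hD : IsDevelopingMap D) (h : IsSheet D U A) (ho : o ∈ U)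
    {N B : Set Plane} (hN : ∀ z, IsVisibleFrom D o z → devExt D z ∈ N → z ∈ bdry U)
    (hB : IsOpen B) (hBc : Convex ℝ B) (hoB : D o ∈ B) (hBN : closure B ⊆ N)
    (hZ : ∀ z ∈ bdry U ∩ surfaceFrontier X, devExt D z ∉ B) :
    ∃ V, IsSheet D V B ∧ o ∈ V ∧
      bdry V ∩ surfaceFrontier X =
        {z | z ∈ bdry U ∩ surfaceFrontier X ∧ devExt D z ∈ closure B} := by
  obtain ⟨V, hV, hoV⟩ := exists_isSheet_of_rayLift hD hB hBc hoB fun w hw => by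
    refine (IsRayLift.exists_or_isVisible hD o (w - D o)).resolve_right ?_
    rintro ⟨T, hT, z, hz, hdz⟩
    have hzB : devExt D z ∈ B := by
      rw [hdz]
      exact hBc.add_smul_sub_mem hoB hw ⟨hT.1.le, hT.2⟩
    exact hZ z ⟨hN z hz (hBN (subset_closure hzB)), hz.1⟩ hzB
  refine ⟨V, hV, hoV, Subset.antisymm ?_ ?_⟩
  · rintro z ⟨hz, hzX⟩
    have hzB := frontier_subset_closure (hV.map_mem_frontier hD hz)
    exact ⟨⟨hN z (hV.isVisible_of_mem_bdry hD hoV hz hzX) (hBN hzB), hzX⟩, hzB⟩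
  · rintro z ⟨⟨hz, hzX⟩, hzB⟩
    have h1 := hV.eq_ext_of_isVisible hD hoV (h.isVisible_of_mem_bdry hD ho hz hzX) hzB
    refine ⟨hV.mem_bdry_of_mem_surfaceFrontier ?_ hzX, hzX⟩
    rw [h1]; exact hV.ext_mem hD hzB

end IsSheet

end Rays

end

section

/-! ### Plane conics: convexity, ellipses and perturbation. -/

section Planar

/-- The affine function `c + p x₁ + q x₂` on the plane. -/
structure AffForm where
  (c p q : ℝ)

/-- A polynomial of degree at most two on the plane. -/
structure Conic where
  (a b c d e f : ℝ)

namespace AffForm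

def eval (l : AffForm) (x : Plane) : ℝ := l.c + l.p * x 0 + l.q * x 1

def lin (l : AffForm) (v : Plane) : ℝ := l.p * v 0 + l.q * v 1

/-- The affine function vanishing on the line through `x` and `y`. -/
def line (x y : Plane) : AffForm :=
  ⟨(y 1 - x 1) * x 0 - (y 0 - x 0) * x 1, -(y 1 - x 1), y 0 - x 0⟩

def mul (l m : AffForm) : Conic :=
  ⟨l.p * m.p, l.p * m.q + l.q * m.p, l.q * m.q, l.c * m.p + l.p * m.c, l.c * m.q + l.q * m.c,
    l.c * m.c⟩

@[fun_prop]
theorem continuous_eval (l : AffForm) : Continuous l.eval := by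
  unfold eval; fun_prop

theorem eval_add_smul (l : AffForm) (x v : Plane) (r : ℝ) :
    l.eval (x + r • v) = l.eval x + r * l.lin v := by
  simp [eval, lin]; ring

theorem eval_add (l : AffForm) (x v : Plane) : l.eval (x + v) = l.eval x + l.lin v := by
  simp [eval, lin]; ring

theorem lin_sub (l : AffForm) (x y : Plane) : l.lin (x - y) = l.eval x - l.eval y := by
  simp [eval, lin]; ring

theorem lin_smul (l : AffForm) (r : ℝ) (v : Plane) : l.lin (r • v) = r * l.lin v := by
  simp [lin]; ring

theorem line_left (x y : Plane) : (line x y).eval x = 0 := by simp [line, eval]; ring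

theorem line_right (x y : Plane) : (line x y).eval y = 0 := by simp [line, eval]; ring

end AffForm

namespace Conic

def eval (F : Conic) (x : Plane) : ℝ :=
  F.a * x 0 ^ 2 + F.b * (x 0 * x 1) + F.c * x 1 ^ 2 + F.d * x 0 + F.e * x 1 + F.f

def lead (F : Conic) (v : Plane) : ℝ := F.a * v 0 ^ 2 + F.b * (v 0 * v 1) + F.c * v 1 ^ 2

def grad (F : Conic) (x v : Plane) : ℝ :=
  (2 * F.a * x 0 + F.b * x 1 + F.d) * v 0 + (F.b * x 0 + 2 * F.c * x 1 + F.e) * v 1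

/-- The conic `F + ε G`. -/
def perturb (F : Conic) (ε : ℝ) (G : Conic) : Conic :=
  ⟨F.a + ε * G.a, F.b + ε * G.b, F.c + ε * G.c, F.d + ε * G.d, F.e + ε * G.e, F.f + ε * G.f⟩

/-- The quadratic part of the conic is positive definite. -/
def IsElliptic (F : Conic) : Prop := 0 < F.a ∧ F.b ^ 2 < 4 * F.a * F.c

@[fun_prop]
theorem continuous_eval (F : Conic) : Continuous F.eval := by unfold eval; fun_prop

@[fun_prop]
theorem continuous_lead (F : Conic) : Continuous F.lead := by unfold lead; fun_prop

@[fun_prop]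
theorem continuous_grad (F : Conic) (x : Plane) : Continuous (F.grad x) := by
  unfold grad; fun_prop

theorem eval_add_smul (F : Conic) (x v : Plane) (r : ℝ) :
    F.eval (x + r • v) = F.eval x + r * F.grad x v + r ^ 2 * F.lead v := by
  simp [eval, grad, lead]; ring

theorem eval_perturb (F G : Conic) (ε : ℝ) (x : Plane) :
    (F.perturb ε G).eval x = F.eval x + ε * G.eval x := by
  simp [eval, perturb]; ring

theorem lead_perturb (F G : Conic) (ε : ℝ) (x : Plane) :
    (F.perturb ε G).lead x = F.lead x + ε * G.lead x := by
  simp [lead, perturb]; ring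

theorem eval_mul (l m : AffForm) (x : Plane) : (l.mul m).eval x = l.eval x * m.eval x := by
  simp [eval, AffForm.mul, AffForm.eval]; ring

theorem lead_mul (l m : AffForm) (v : Plane) : (l.mul m).lead v = l.lin v * m.lin v := by
  simp [lead, AffForm.mul, AffForm.lin]; ring

theorem exists_eq_quadraticForm (q : QuadraticForm ℝ (Fin 3 → ℝ)) :
    ∃ F : Conic, planarSubconic q = {x | F.eval x < 0} := by
  refine ⟨⟨q ![1, 0, 0], QuadraticMap.polar q ![1, 0, 0] ![0, 1, 0], q ![0, 1, 0],
    QuadraticMap.polar q ![1, 0, 0] ![0, 0, 1], QuadraticMap.polar q ![0, 1, 0] ![0, 0, 1],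
    q ![0, 0, 1]⟩, ?_⟩
  ext x
  have hx : (![x 0, x 1, 1] : Fin 3 → ℝ) =
      x 0 • ![1, 0, 0] + x 1 • ![0, 1, 0] + ![0, 0, 1] := by
    ext i; fin_cases i <;> simp
  have key : q ![x 0, x 1, 1] = Conic.eval ⟨q ![1, 0, 0],
      QuadraticMap.polar q ![1, 0, 0] ![0, 1, 0], q ![0, 1, 0],
      QuadraticMap.polar q ![1, 0, 0] ![0, 0, 1], QuadraticMap.polar q ![0, 1, 0] ![0, 0, 1],
      q ![0, 0, 1]⟩ x := by
    rw [hx, QuadraticMap.map_add q, QuadraticMap.map_add q, QuadraticMap.map_smul,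
      QuadraticMap.map_smul, QuadraticMap.polar_add_left, QuadraticMap.polar_smul_left,
      QuadraticMap.polar_smul_left, QuadraticMap.polar_smul_left,
      QuadraticMap.polar_smul_right]
    simp only [smul_eq_mul, eval]
    ring
  change q ![x 0, x 1, 1] < 0 ↔ _
  rw [key]; rfl

theorem exists_quadraticForm_eq (F : Conic) :
    ∃ q : QuadraticForm ℝ (Fin 3 → ℝ), planarSubconic q = {x | F.eval x < 0} := by
  let L : Fin 3 → Fin 3 → QuadraticForm ℝ (Fin 3 → ℝ) := fun i j =>
    QuadraticMap.linMulLin (LinearMap.proj i) (LinearMap.proj j)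
  refine ⟨F.a • L 0 0 + F.b • L 0 1 + F.c • L 1 1 + F.d • L 0 2 + F.e • L 1 2 + F.f • L 2 2, ?_⟩
  ext x
  change (F.a • L 0 0 + F.b • L 0 1 + F.c • L 1 1 + F.d • L 0 2 + F.e • L 1 2 + F.f • L 2 2)
    ![x 0, x 1, 1] < 0 ↔ F.eval x < 0
  simp [L, eval, pow_two]

/-- The defect from affine interpolation is `t * (1 - t)` times the quadratic part. Convexity, and
the sign of a conic along its own chords, are read off from this identity. -/
theorem eval_lineMap (F : Conic) (x y : Plane) (t : ℝ) :
    F.eval (x + t • (y - x)) =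
      (1 - t) * F.eval x + t * F.eval y - t * (1 - t) * F.lead (y - x) := by
  simp [eval, lead]; ring

theorem convex_lt (F : Conic) (h : ∀ v, 0 ≤ F.lead v) : Convex ℝ {x | F.eval x < 0} := by
  intro x hx y hy a b ha hb hab
  have hx' : F.eval x < 0 := hx
  have hy' : F.eval y < 0 := hy
  obtain rfl : a = 1 - b := eq_sub_of_add_eq hab
  have : (1 - b) • x + b • y = x + b • (y - x) := by module
  rw [this]
  change F.eval _ < 0
  rw [eval_lineMap]
  have := mul_nonneg (mul_nonneg hb ha) (h (y - x))
  rcases hb.eq_or_lt with rfl | hb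
  · simpa using hx'
  · nlinarith

theorem isOpen_lt (F : Conic) : IsOpen {x | F.eval x < 0} :=
  _root_.isOpen_lt F.continuous_eval continuous_const

theorem closure_lt (F : Conic) (h : ∀ v, 0 ≤ F.lead v) {o : Plane} (ho : F.eval o < 0) :
    closure {x | F.eval x < 0} = {x | F.eval x ≤ 0} := by
  refine Subset.antisymm (closure_minimal (fun x (hx : F.eval x < 0) => hx.le)
    (isClosed_le F.continuous_eval continuous_const)) fun x (hx : F.eval x ≤ 0) => ?_
  have hlim : Tendsto (fun t : ℝ => o + t • (x - o)) (𝓝[<] 1) (𝓝 x) := by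
    have := (by fun_prop : Continuous fun t : ℝ => o + t • (x - o)).tendsto 1
    simp only [one_smul, add_sub_cancel] at this
    exact this.mono_left nhdsWithin_le_nhds
  refine mem_closure_of_tendsto hlim ?_
  filter_upwards [Ico_mem_nhdsLT one_pos] with t ht
  rw [eval_lineMap]
  have := mul_nonneg (mul_nonneg ht.1 (sub_nonneg.2 ht.2.le)) (h (x - o))
  nlinarith [ht.1, ht.2]

theorem frontier_lt (F : Conic) (h : ∀ v, 0 ≤ F.lead v) {o : Plane} (ho : F.eval o < 0) :
    frontier {x | F.eval x < 0} = {x | F.eval x = 0} := by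
  rw [F.isOpen_lt.frontier_eq, F.closure_lt h ho]
  ext x
  change F.eval x ≤ 0 ∧ ¬ F.eval x < 0 ↔ F.eval x = 0
  rw [not_lt]; exact le_antisymm_iff.symm

namespace IsElliptic

variable {F : Conic}

theorem lead_bound (h : F.IsElliptic) : ∃ m > 0, ∀ v, m * ‖v‖ ^ 2 ≤ F.lead v := by
  obtain ⟨ha, hd⟩ := h
  have hc : 0 < F.c := by nlinarith [sq_nonneg F.b]
  -- Determinant over trace of the symmetric matrix `M` of the form. By Cayley–Hamilton, trace times
  -- the form minus determinant times `‖v‖ ^ 2` is `‖M v‖ ^ 2`, the sum of two squares used below.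
  refine ⟨(F.a * F.c - F.b ^ 2 / 4) / (F.a + F.c), by apply div_pos <;> linarith, fun v => ?_⟩
  rw [EuclideanSpace.real_norm_sq_eq, Fin.sum_univ_two, div_mul_eq_mul_div,
    div_le_iff₀ (by linarith), lead]
  nlinarith [sq_nonneg (F.a * v 0 + F.b / 2 * v 1), sq_nonneg (F.b / 2 * v 0 + F.c * v 1)]

theorem lead_pos (h : F.IsElliptic) {v : Plane} (hv : v ≠ 0) : 0 < F.lead v := by
  obtain ⟨m, hm, hb⟩ := h.lead_bound
  have := hb v
  have := norm_pos_iff.2 hv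
  exact (by positivity : (0 : ℝ) < m * ‖v‖ ^ 2).trans_le (hb v)

theorem lead_nonneg (h : F.IsElliptic) (v : Plane) : 0 ≤ F.lead v := by
  obtain ⟨m, hm, hb⟩ := h.lead_bound
  exact (by positivity : (0 : ℝ) ≤ m * ‖v‖ ^ 2).trans (hb v)

theorem of_lead_pos (h : ∀ v : Plane, v ≠ 0 → 0 < F.lead v) : F.IsElliptic := by
  have h1 := h !₂[1, 0] (fun h => by simpa using congrArg (fun v : Plane => v 0) h)
  have ha : 0 < F.a := by simpa [lead] using h1
  -- At this vector the form takes the value `a * (4 a c - b ^ 2)`.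
  have h2 := h !₂[-F.b, 2 * F.a] (fun h => by
    have := congrArg (fun v : Plane => v 1) h
    simp at this
    exact ha.ne' this)
  simp only [lead, Matrix.cons_val_zero, Matrix.cons_val_one] at h2
  refine ⟨ha, ?_⟩
  have h3 : 0 < F.a * (4 * F.a * F.c - F.b ^ 2) := by nlinarith
  have := (mul_pos_iff_of_pos_left ha).1 h3
  linarith

/-- For small `ε`, the region `F + ε G ≤ 0` stays in a bounded set. -/
theorem exists_bound_perturb (h : F.IsElliptic) (G : Conic) :
    ∃ R, ∃ ε₀ > 0, ∀ ε, 0 ≤ ε → ε ≤ ε₀ → ∀ x, (F.perturb ε G).eval x ≤ 0 → ‖x‖ ≤ R := by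
  obtain ⟨m, hm, hb⟩ := h.lead_bound
  obtain ⟨C₁, hC₁⟩ : ∃ C, C = |F.d| + |F.e| + |F.f| := ⟨_, rfl⟩
  obtain ⟨C₂, hC₂⟩ : ∃ C, C = |G.a| + |G.b| + |G.c| + |G.d| + |G.e| + |G.f| + 1 := ⟨_, rfl⟩
  have hC₂0 : 0 < C₂ := by rw [hC₂]; positivity
  have hC₁0 : 0 ≤ C₁ := by rw [hC₁]; positivity
  -- For `r ≥ 1`, the lower-order terms of `F` are at least `-C₁ r` and `G` is at least `-C₂ r ^ 2`.
  -- With this bound on `ε` the perturbation costs at most a quarter of `m r ^ 2`, and the radius is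
  -- too large for the remaining `3 / 4 * m * r ≤ C₁`.
  refine ⟨1 + (4 * C₁ + m) / m + 4, m / (4 * C₂), by positivity, fun ε hε hε' x hx => ?_⟩
  have hx0 : |x 0| ≤ ‖x‖ := PiLp.norm_apply_le x 0
  have hx1 : |x 1| ≤ ‖x‖ := PiLp.norm_apply_le x 1
  have h9 := hb x
  have hr0 := norm_nonneg x
  generalize ‖x‖ = r at *
  by_contra! hlt
  have hq : 0 ≤ (4 * C₁ + m) / m := by positivity
  have hr1 : 1 ≤ r := by linarith
  have hrq : 4 * C₁ + m ≤ (r - 5) * m := by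
    rw [← div_le_iff₀ hm]; linarith
  rw [eval_perturb] at hx
  have hlin : -(C₁ * r) ≤ F.d * x 0 + F.e * x 1 + F.f := by
    have h1 : |F.d * x 0| ≤ |F.d| * r := by rw [abs_mul]; gcongr
    have h2 : |F.e * x 1| ≤ |F.e| * r := by rw [abs_mul]; gcongr
    have h3 : |F.f| ≤ |F.f| * r := le_mul_of_one_le_right (abs_nonneg _) hr1
    have h4 : C₁ * r = |F.d| * r + |F.e| * r + |F.f| * r := by rw [hC₁]; ring
    linarith [neg_abs_le (F.d * x 0), neg_abs_le (F.e * x 1), neg_abs_le F.f]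
  have hG : -(C₂ * r ^ 2) ≤ G.eval x := by
    have hr2 : r ≤ r ^ 2 := by nlinarith
    have hr3 : 1 ≤ r ^ 2 := by nlinarith
    have h1 : |G.a * x 0 ^ 2| ≤ |G.a| * r ^ 2 := by
      rw [abs_mul, abs_pow]; gcongr
    have h2 : |G.b * (x 0 * x 1)| ≤ |G.b| * r ^ 2 := by
      rw [abs_mul, abs_mul, pow_two]; gcongr
    have h3 : |G.c * x 1 ^ 2| ≤ |G.c| * r ^ 2 := by
      rw [abs_mul, abs_pow]; gcongr
    have h4 : |G.d * x 0| ≤ |G.d| * r ^ 2 := by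
      rw [abs_mul]; gcongr; linarith
    have h5 : |G.e * x 1| ≤ |G.e| * r ^ 2 := by
      rw [abs_mul]; gcongr; linarith
    have h6 : |G.f| ≤ |G.f| * r ^ 2 := le_mul_of_one_le_right (abs_nonneg _) hr3
    have h7 : C₂ * r ^ 2 = |G.a| * r ^ 2 + |G.b| * r ^ 2 + |G.c| * r ^ 2 + |G.d| * r ^ 2 +
      |G.e| * r ^ 2 + |G.f| * r ^ 2 + r ^ 2 := by rw [hC₂]; ring
    rw [eval]
    linarith [neg_abs_le (G.a * x 0 ^ 2), neg_abs_le (G.b * (x 0 * x 1)),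
      neg_abs_le (G.c * x 1 ^ 2), neg_abs_le (G.d * x 0), neg_abs_le (G.e * x 1), neg_abs_le G.f]
  have hF : F.eval x = F.lead x + (F.d * x 0 + F.e * x 1 + F.f) := by rw [eval, lead]; ring
  have hεC : ε * (C₂ * r ^ 2) ≤ m / 4 * r ^ 2 := by
    rw [le_div_iff₀ (by positivity)] at hε'
    nlinarith [sq_nonneg r]
  have h8 : -(m / 4 * r ^ 2) ≤ ε * G.eval x := by
    nlinarith [mul_le_mul_of_nonneg_left hG hε]
  have h10 : 3 / 4 * m * r ^ 2 ≤ C₁ * r := by linarith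
  have h11 : 3 / 4 * m * r ≤ C₁ := by
    by_contra! hcon
    nlinarith
  nlinarith

/-- The point where the ray from `o` with direction `v` leaves the ellipse. -/
def radial (F : Conic) (o v : Plane) : Plane :=
  o + ((-F.grad o v + √(F.grad o v ^ 2 - 4 * F.lead v * F.eval o)) / (2 * F.lead v)) • v

theorem continuousOn_radial (h : F.IsElliptic) (o : Plane) :
    ContinuousOn (radial F o) {0}ᶜ := by
  unfold radial
  have h1 : Continuous fun v => -F.grad o v + √(F.grad o v ^ 2 - 4 * F.lead v * F.eval o) := by
    fun_prop
  have h2 : Continuous fun v => 2 * F.lead v := by fun_prop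
  refine continuousOn_const.add (ContinuousOn.smul (h1.continuousOn.div h2.continuousOn
    fun v hv => ?_) continuousOn_id)
  have := h.lead_pos hv
  positivity

theorem radial_spec (h : F.IsElliptic) {o v : Plane} (ho : F.eval o < 0) (hv : v ≠ 0) :
    F.eval (radial F o v) = 0 ∧ ∃ ρ : ℝ, 0 < ρ ∧ radial F o v = o + ρ • v := by
  have hl := h.lead_pos hv
  have hdisc : 0 < F.grad o v ^ 2 - 4 * F.lead v * F.eval o := by
    nlinarith [sq_nonneg (F.grad o v), mul_pos hl (neg_pos.2 ho)]
  have hs := Real.sq_sqrt hdisc.le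
  constructor
  · rw [radial, eval_add_smul]
    set S := √(F.grad o v ^ 2 - 4 * F.lead v * F.eval o)
    field_simp
    nlinarith
  · refine ⟨_, div_pos ?_ (by positivity), rfl⟩
    have : |F.grad o v| < √(F.grad o v ^ 2 - 4 * F.lead v * F.eval o) := by
      refine Real.lt_sqrt_of_sq_lt ?_
      rw [sq_abs]
      nlinarith [mul_pos hl (neg_pos.2 ho)]
    linarith [le_abs_self (F.grad o v)]

theorem radial_eq (h : F.IsElliptic) {o w : Plane} (ho : F.eval o < 0) (hw : F.eval w = 0) :
    w ≠ o ∧ radial F o (w - o) = w := by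
  have hne : w ≠ o := by rintro rfl; linarith
  refine ⟨hne, ?_⟩
  have hl := h.lead_pos (sub_ne_zero.2 hne)
  have h1 := F.eval_add_smul o (w - o) 1
  rw [one_smul, add_sub_cancel, hw] at h1
  -- Since `1` is a root of the quadratic along this ray, its discriminant is a perfect square.
  have h2 : F.grad o (w - o) ^ 2 - 4 * F.lead (w - o) * F.eval o =
      (F.lead (w - o) - F.eval o) ^ 2 := by
    have : F.grad o (w - o) = -F.eval o - F.lead (w - o) := by linarith
    rw [this]; ring
  rw [radial, h2, Real.sqrt_sq (by linarith)]
  have : (-F.grad o (w - o) + (F.lead (w - o) - F.eval o)) / (2 * F.lead (w - o)) = 1 := by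
    rw [div_eq_one_iff_eq (by positivity)]; linarith
  rw [this, one_smul, add_sub_cancel]

theorem isPreconnected_zero (h : F.IsElliptic) {o : Plane} (ho : F.eval o < 0) :
    IsPreconnected {x | F.eval x = 0} := by
  have hr : 1 < Module.rank ℝ Plane := by
    rw [← Module.finrank_eq_rank, finrank_euclideanSpace_fin]; norm_num
  have h1 := ((isConnected_compl_singleton_of_one_lt_rank hr (0 : Plane)).isPreconnected).image _
    (h.continuousOn_radial o)
  convert h1
  ext w
  constructor
  · intro hw
    obtain ⟨hne, heq⟩ := h.radial_eq ho hw
    exact ⟨w - o, sub_ne_zero.2 hne, heq⟩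
  · rintro ⟨v, hv, rfl⟩
    exact (h.radial_spec ho hv).1

/-- Seen from an interior point `o` of the chord, the open arc on one side is the radial image of a
half-plane of directions. -/
theorem isPreconnected_zero_inter (h : F.IsElliptic) {o : Plane} (ho : F.eval o < 0)
    {l : AffForm} (hl : l.eval o = 0) : IsPreconnected {x | F.eval x = 0 ∧ 0 < l.eval x} := by
  have hc : Convex ℝ {v : Plane | 0 < l.lin v} := by
    intro x hx y hy a b ha hb hab
    change 0 < l.lin (a • x + b • y)
    have h1 : l.lin (a • x + b • y) = a * l.lin x + b * l.lin y := by
      simp [AffForm.lin]; ring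
    have hx' : 0 < l.lin x := hx
    have hy' : 0 < l.lin y := hy
    rw [h1]
    rcases ha.eq_or_lt with rfl | ha
    · obtain rfl : b = 1 := by linarith
      simpa using hy'
    · nlinarith [mul_pos ha hx', mul_nonneg hb hy'.le]
  have hne : ∀ v, 0 < l.lin v → v ≠ 0 := by
    rintro v hv rfl
    simp [AffForm.lin] at hv
  have h1 := hc.isPreconnected.image _ ((h.continuousOn_radial o).mono fun v hv => hne v hv)
  convert h1
  ext w
  constructor
  · rintro ⟨hw, hlw⟩
    obtain ⟨-, heq⟩ := h.radial_eq ho hw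
    refine ⟨w - o, ?_, heq⟩
    change 0 < l.lin (w - o)
    rwa [AffForm.lin_sub, hl, sub_zero]
  · rintro ⟨v, hv, rfl⟩
    obtain ⟨h2, ρ, hρ, h3⟩ := h.radial_spec ho (hne v hv)
    refine ⟨h2, ?_⟩
    rw [h3, AffForm.eval_add_smul, hl, zero_add]
    exact mul_pos hρ hv

end IsElliptic

/-- If the regions `F + ε G ≤ 0` outside `F < 0` stay bounded, they shrink to `F ≤ 0`. -/
theorem exists_perturb_subset {F G : Conic} {N : Set Plane} (hN : IsOpen N)
    (hFN : {x | F.eval x ≤ 0} ⊆ N) {R ε₀ : ℝ} (hε₀ : 0 < ε₀)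
    (hR : ∀ ε, 0 < ε → ε ≤ ε₀ → ∀ x, 0 ≤ F.eval x → (F.perturb ε G).eval x ≤ 0 → ‖x‖ ≤ R) :
    ∃ ε₁ > 0, ε₁ ≤ ε₀ ∧ ∀ ε, 0 < ε → ε ≤ ε₁ → {x | (F.perturb ε G).eval x ≤ 0} ⊆ N := by
  have hK : IsCompact (Metric.closedBall (0 : Plane) R \ N) :=
    (isCompact_closedBall (0 : Plane) R).diff hN
  rcases (Metric.closedBall (0 : Plane) R \ N).eq_empty_or_nonempty with hemp | hne
  · refine ⟨ε₀, hε₀, le_rfl, fun ε hε hε' x hx => ?_⟩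
    by_contra hxN
    have h0 : 0 ≤ F.eval x := by
      by_contra! hcon
      exact hxN (hFN hcon.le)
    have : x ∈ Metric.closedBall (0 : Plane) R \ N :=
      ⟨mem_closedBall_zero_iff.2 (hR ε hε hε' x h0 hx), hxN⟩
    rw [hemp] at this
    exact this
  -- On the compact set of bounded points outside `N`, `F` has a positive minimum and `G` is
  -- bounded, so a small multiple of `G` cannot make the sum nonpositive.
  · obtain ⟨y, hy, hmin⟩ := hK.exists_isMinOn hne F.continuous_eval.continuousOn
    obtain ⟨C, hC⟩ := hK.exists_bound_of_continuousOn G.continuous_eval.continuousOn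
    have hy0 : 0 < F.eval y := by
      by_contra! hcon
      exact hy.2 (hFN hcon)
    have hC0 : 0 ≤ C := (norm_nonneg _).trans (hC y hy)
    refine ⟨min ε₀ (F.eval y / (2 * (C + 1))), by positivity, min_le_left _ _,
      fun ε hε hε' x hx => ?_⟩
    by_contra hxN
    have h0 : 0 ≤ F.eval x := by
      by_contra! hcon
      exact hxN (hFN hcon.le)
    have hxK : x ∈ Metric.closedBall (0 : Plane) R \ N :=
      ⟨mem_closedBall_zero_iff.2 (hR ε hε (hε'.trans (min_le_left _ _)) x h0 hx), hxN⟩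
    have h1 : F.eval y ≤ F.eval x := hmin hxK
    have h2 : |G.eval x| ≤ C := hC x hxK
    have h3 : ε * (2 * (C + 1)) ≤ F.eval y := by
      rw [← le_div_iff₀ (by positivity)]; exact hε'.trans (min_le_right _ _)
    have h4 : (F.perturb ε G).eval x ≤ 0 := hx
    rw [eval_perturb] at h4
    have h5 : -C ≤ G.eval x := (neg_le_neg h2).trans (neg_abs_le _)
    nlinarith [mul_le_mul_of_nonneg_left h5 hε.le]

end Conic

end Planar

end

section

/-! ### Pencils of conics in barycentric coordinates. -/

section Barycentric

/-- The barycentric coordinate of `w` at the vertex `p₁` of the triangle `p₁ p₂ p₃`. -/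
def bary (p₁ p₂ p₃ w : Plane) : ℝ :=
  (AffForm.line p₂ p₃).eval w / (AffForm.line p₂ p₃).eval p₁

theorem AffForm.line_rotate (p₁ p₂ p₃ : Plane) :
    (AffForm.line p₂ p₃).eval p₁ = (AffForm.line p₁ p₂).eval p₃ := by
  simp [AffForm.line, AffForm.eval]; ring

theorem AffForm.line_swap (p₁ p₂ w : Plane) :
    (AffForm.line p₂ p₁).eval w = -(AffForm.line p₁ p₂).eval w := by
  simp [AffForm.line, AffForm.eval]; ring

theorem bary_swap (p₁ p₂ p₃ w : Plane) : bary p₁ p₃ p₂ w = bary p₁ p₂ p₃ w := by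
  rw [bary, AffForm.line_swap p₂ p₃, AffForm.line_swap p₂ p₃, neg_div_neg_eq, bary]

theorem bary_left (p₁ p₂ p₃ : Plane) : bary p₁ p₂ p₃ p₂ = 0 := by
  rw [bary, AffForm.line_left, zero_div]

theorem bary_right (p₁ p₂ p₃ : Plane) : bary p₁ p₂ p₃ p₃ = 0 := by
  rw [bary, AffForm.line_right, zero_div]

theorem continuous_bary (p₁ p₂ p₃ : Plane) : Continuous (bary p₁ p₂ p₃) := by
  unfold bary; fun_prop

variable {p₁ p₂ p₃ : Plane}

theorem bary_self (h : (AffForm.line p₂ p₃).eval p₁ ≠ 0) : bary p₁ p₂ p₃ p₁ = 1 := div_self h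

theorem bary_sum (h : (AffForm.line p₂ p₃).eval p₁ ≠ 0) (w : Plane) :
    bary p₁ p₂ p₃ w + bary p₂ p₃ p₁ w + bary p₃ p₁ p₂ w = 1 := by
  rw [bary, bary, bary, AffForm.line_rotate p₃ p₁ p₂, AffForm.line_rotate p₂ p₃ p₁,
    ← add_div, ← add_div, div_eq_one_iff_eq h]
  simp [AffForm.line, AffForm.eval]; ring

/-- A conic through the vertices has only mixed terms in barycentric coordinates. The coefficient of
each is, up to sign, the quadratic part evaluated on the corresponding side. -/
theorem eval_eq_bary (F : Conic) (h : (AffForm.line p₂ p₃).eval p₁ ≠ 0) (h₁ : F.eval p₁ = 0)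
    (h₂ : F.eval p₂ = 0) (h₃ : F.eval p₃ = 0) (w : Plane) :
    F.eval w = -(F.lead (p₂ - p₃) * (bary p₂ p₃ p₁ w * bary p₃ p₁ p₂ w) +
      F.lead (p₃ - p₁) * (bary p₁ p₂ p₃ w * bary p₃ p₁ p₂ w) +
      F.lead (p₁ - p₂) * (bary p₁ p₂ p₃ w * bary p₂ p₃ p₁ w)) := by
  rw [bary, bary, bary, AffForm.line_rotate p₃ p₁ p₂, AffForm.line_rotate p₂ p₃ p₁]
  have key : (AffForm.line p₂ p₃).eval p₁ ^ 2 * F.eval w =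
      (AffForm.line p₂ p₃).eval p₁ * ((AffForm.line p₂ p₃).eval w * F.eval p₁ +
        (AffForm.line p₃ p₁).eval w * F.eval p₂ + (AffForm.line p₁ p₂).eval w * F.eval p₃) -
      (F.lead (p₂ - p₃) * ((AffForm.line p₃ p₁).eval w * (AffForm.line p₁ p₂).eval w) +
      F.lead (p₃ - p₁) * ((AffForm.line p₂ p₃).eval w * (AffForm.line p₁ p₂).eval w) +
      F.lead (p₁ - p₂) * ((AffForm.line p₂ p₃).eval w * (AffForm.line p₃ p₁).eval w)) := by
    simp only [AffForm.line, AffForm.eval, Conic.eval, Conic.lead, PiLp.sub_apply]; ring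
  rw [h₁, h₂, h₃] at key
  field_simp
  linarith

/-- A line meets an ellipse in at most two points: by `eval_lineMap`, the only zeros on the line
through two of them are at `r = 0` and `r = 1`. -/
theorem line_ne_zero_of_isElliptic {F : Conic} (hF : F.IsElliptic) (h₁ : F.eval p₁ = 0)
    (h₂ : F.eval p₂ = 0) (h₃ : F.eval p₃ = 0) (h₁₂ : p₁ ≠ p₂) (h₁₃ : p₁ ≠ p₃) (h₂₃ : p₂ ≠ p₃) :
    (AffForm.line p₂ p₃).eval p₁ ≠ 0 := by
  intro h
  have hl : ∀ v : Plane, v ≠ 0 → (v 0 ≠ 0 ∨ v 1 ≠ 0) := by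
    intro v hv
    by_contra! hc
    exact hv (by ext i; fin_cases i <;> simp [hc.1, hc.2])
  have hcol : ∃ r : ℝ, p₁ = p₂ + r • (p₃ - p₂) := by
    have h' : (p₂ 0 - p₁ 0) * (p₃ 1 - p₂ 1) = (p₂ 1 - p₁ 1) * (p₃ 0 - p₂ 0) := by
      simp only [AffForm.line, AffForm.eval] at h
      linarith
    rcases hl _ (sub_ne_zero.2 h₂₃.symm) with h0 | h0 <;> simp only [PiLp.sub_apply] at h0
    · refine ⟨(p₁ 0 - p₂ 0) / (p₃ 0 - p₂ 0), ?_⟩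
      ext i; fin_cases i <;> simp <;> field_simp <;> linarith
    · refine ⟨(p₁ 1 - p₂ 1) / (p₃ 1 - p₂ 1), ?_⟩
      ext i; fin_cases i <;> simp <;> field_simp <;> linarith
  obtain ⟨r, rfl⟩ := hcol
  rw [F.eval_lineMap, h₂, h₃] at h₁
  have hpos := hF.lead_pos (sub_ne_zero.2 h₂₃.symm)
  have : r * (1 - r) = 0 := by
    have h4 : (r * (1 - r)) * F.lead (p₃ - p₂) = 0 := by linarith
    exact (mul_eq_zero.1 h4).resolve_right hpos.ne'
  rcases mul_eq_zero.1 this with h5 | h5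
  · rw [h5] at h₁₂; simp at h₁₂
  · rw [← sub_eq_zero.1 h5] at h₁₃; simp at h₁₃

theorem Conic.lead_swap (F : Conic) (x y : Plane) : F.lead (x - y) = F.lead (y - x) := by
  simp [Conic.lead]; ring

/-- Cauchy–Schwarz for the polar form on two sides of the triangle. The deficit is `4 a c - b ^ 2`
times the square of twice the area. -/
theorem Conic.IsElliptic.lead_cauchy {F : Conic} (hF : F.IsElliptic) (p₁ p₂ p₃ : Plane) :
    (F.lead (p₃ - p₁) - F.lead (p₂ - p₃) - F.lead (p₁ - p₂)) ^ 2 ≤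
      4 * F.lead (p₂ - p₃) * F.lead (p₁ - p₂) := by
  have h : 4 * F.lead (p₂ - p₃) * F.lead (p₁ - p₂) -
      (F.lead (p₃ - p₁) - F.lead (p₂ - p₃) - F.lead (p₁ - p₂)) ^ 2 =
      (4 * F.a * F.c - F.b ^ 2) * (AffForm.line p₂ p₃).eval p₁ ^ 2 := by
    simp only [AffForm.line, AffForm.eval, Conic.lead, PiLp.sub_apply]; ring
  have := mul_nonneg (sub_nonneg.2 hF.2.le) (sq_nonneg ((AffForm.line p₂ p₃).eval p₁))
  linarith

/-- Two barycentric coordinates cannot both be nonpositive on a strictly convex curve through the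
vertices, unless both vanish. -/
theorem false_of_wedge {A B C u s t : ℝ} (hA : 0 < A) (hC : 0 < C)
    (hcs : (B - A - C) ^ 2 ≤ 4 * A * C) (hsum : u + s + t = 1)
    (h : A * (s * t) + B * (u * t) + C * (u * s) = 0) (hu : u < 0) (ht : t ≤ 0) : False := by
  obtain rfl : s = 1 - u - t := by linarith
  -- After eliminating `s`, the relation says that `A t + C u` equals this form. The form is
  -- nonnegative by `hcs`, while `A t + C u` is negative.
  have h1 : 0 ≤ A * t ^ 2 + C * u ^ 2 - (B - A - C) * (u * t) := by
    have h2 : 0 ≤ 4 * A * (A * t ^ 2 + C * u ^ 2 - (B - A - C) * (u * t)) := by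
      have : 4 * A * (A * t ^ 2 + C * u ^ 2 - (B - A - C) * (u * t)) =
        (2 * A * t - (B - A - C) * u) ^ 2 + (4 * A * C - (B - A - C) ^ 2) * u ^ 2 := by ring
      rw [this]
      have := mul_nonneg (sub_nonneg.2 hcs) (sq_nonneg u)
      positivity
    exact nonneg_of_mul_nonneg_right h2 (by linarith)
  nlinarith [mul_pos hC (neg_pos.2 hu), mul_nonneg hA.le (neg_nonneg.2 ht)]

theorem bary_pos_of_neg {F : Conic} (hF : F.IsElliptic) (h₁ : F.eval p₁ = 0)
    (h₂ : F.eval p₂ = 0) (h₃ : F.eval p₃ = 0) (h₁₂ : p₁ ≠ p₂) (h₁₃ : p₁ ≠ p₃) (h₂₃ : p₂ ≠ p₃)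
    {w : Plane} (hw : F.eval w = 0) (hu : bary p₁ p₂ p₃ w < 0) :
    0 < bary p₂ p₃ p₁ w ∧ 0 < bary p₃ p₁ p₂ w := by
  have hne := line_ne_zero_of_isElliptic hF h₁ h₂ h₃ h₁₂ h₁₃ h₂₃
  have hsum := bary_sum hne w
  have hev := eval_eq_bary F hne h₁ h₂ h₃ w
  rw [hw] at hev
  have hA := hF.lead_pos (sub_ne_zero.2 h₂₃)
  have hB := hF.lead_pos (sub_ne_zero.2 h₁₃.symm)
  have hC := hF.lead_pos (sub_ne_zero.2 h₁₂)
  constructor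
  · by_contra! hs
    refine false_of_wedge (A := F.lead (p₂ - p₃)) (B := F.lead (p₁ - p₂))
      (C := F.lead (p₃ - p₁)) (u := bary p₁ p₂ p₃ w) (s := bary p₃ p₁ p₂ w)
      (t := bary p₂ p₃ p₁ w) hA hB ?_ (by linarith) (by linarith) hu hs
    have := hF.lead_cauchy p₁ p₃ p₂
    rwa [F.lead_swap p₂ p₁, F.lead_swap p₃ p₂, F.lead_swap p₁ p₃] at this
  · by_contra! ht
    exact false_of_wedge (A := F.lead (p₂ - p₃)) (B := F.lead (p₃ - p₁))
      (C := F.lead (p₁ - p₂)) (u := bary p₁ p₂ p₃ w) (s := bary p₂ p₃ p₁ w)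
      (t := bary p₃ p₁ p₂ w) hA hC (hF.lead_cauchy p₁ p₂ p₃) hsum (by linarith) hu ht

/-- The member of the pencil in which the coefficient of side `p₂ p₃` cancels contains the line `p₂
p₃`. The ratio hypotheses fix the sign of the other factor beyond that line, and there `G` cannot be
positive on the ellipse. -/
theorem bary_nonneg_of_ratio {F G : Conic} (hF : F.IsElliptic) (h₁ : F.eval p₁ = 0)
    (h₂ : F.eval p₂ = 0) (h₃ : F.eval p₃ = 0) (g₁ : G.eval p₁ = 0)
    (g₂ : G.eval p₂ = 0) (g₃ : G.eval p₃ = 0) (h₁₂ : p₁ ≠ p₂) (h₁₃ : p₁ ≠ p₃) (h₂₃ : p₂ ≠ p₃)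
    (hB : F.lead (p₂ - p₃) * G.lead (p₃ - p₁) ≤ G.lead (p₂ - p₃) * F.lead (p₃ - p₁))
    (hC : F.lead (p₂ - p₃) * G.lead (p₁ - p₂) ≤ G.lead (p₂ - p₃) * F.lead (p₁ - p₂))
    {w : Plane} (hw : F.eval w = 0) (hGw : 0 < G.eval w) : 0 ≤ bary p₁ p₂ p₃ w := by
  have hne := line_ne_zero_of_isElliptic hF h₁ h₂ h₃ h₁₂ h₁₃ h₂₃
  by_contra! hu
  obtain ⟨hs, ht⟩ := bary_pos_of_neg hF h₁ h₂ h₃ h₁₂ h₁₃ h₂₃ hw hu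
  have hev := eval_eq_bary F hne h₁ h₂ h₃ w
  have gev := eval_eq_bary G hne g₁ g₂ g₃ w
  have hA := hF.lead_pos (sub_ne_zero.2 h₂₃)
  rw [hw] at hev
  generalize bary p₁ p₂ p₃ w = u at *
  generalize bary p₂ p₃ p₁ w = s at *
  generalize bary p₃ p₁ p₂ w = t at *
  generalize F.lead (p₂ - p₃) = A at *
  generalize F.lead (p₃ - p₁) = B at *
  generalize F.lead (p₁ - p₂) = C at *
  generalize G.lead (p₂ - p₃) = A' at *
  generalize G.lead (p₃ - p₁) = B' at *
  generalize G.lead (p₁ - p₂) = C' at *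
  -- The relation `F = 0` removes the `s * t` term of `G`, and `u` factors out.
  have key : A * G.eval w = u * ((A' * B - A * B') * t + (A' * C - A * C') * s) := by
    rw [gev]; linear_combination -A' * hev
  have h5 : 0 ≤ (A' * B - A * B') * t + (A' * C - A * C') * s :=
    add_nonneg (mul_nonneg (by linarith) ht.le) (mul_nonneg (by linarith) hs.le)
  nlinarith [mul_pos hA hGw, mul_nonneg (neg_nonneg.2 hu.le) h5]

end Barycentric

/-! ### Chords with all relevant points of the ellipse on one side. -/

namespace Conic

/-- The points `w` of `F = 0` that lie in `G > 0` or in `P` are on one side of the line `x y`. -/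
def OneSided (F G : Conic) (P : Set Plane) (x y : Plane) : Prop :=
  ∃ κ : ℝ, κ ≠ 0 ∧ ∀ w, F.eval w = 0 → (0 < G.eval w ∨ w ∈ P) →
    0 ≤ κ * (AffForm.line x y).eval w

theorem OneSided.of_bary {F G : Conic} {P : Set Plane} {x y p : Plane}
    (hne : (AffForm.line x y).eval p ≠ 0)
    (h : ∀ w, F.eval w = 0 → (0 < G.eval w ∨ w ∈ P) → 0 ≤ bary p x y w) : F.OneSided G P x y :=
  ⟨_, inv_ne_zero hne, fun w hw hG => by
    have := h w hw hG
    rwa [bary, div_eq_inv_mul] at this⟩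

variable {F G : Conic}

theorem oneSided_of_ratio {p₁ p₂ p₃ : Plane} (hF : F.IsElliptic) (h₁ : F.eval p₁ = 0)
    (h₂ : F.eval p₂ = 0) (h₃ : F.eval p₃ = 0) (g₁ : G.eval p₁ = 0)
    (g₂ : G.eval p₂ = 0) (g₃ : G.eval p₃ = 0) (h₁₂ : p₁ ≠ p₂) (h₁₃ : p₁ ≠ p₃) (h₂₃ : p₂ ≠ p₃)
    (hB : F.lead (p₂ - p₃) * G.lead (p₃ - p₁) ≤ G.lead (p₂ - p₃) * F.lead (p₃ - p₁))
    (hC : F.lead (p₂ - p₃) * G.lead (p₁ - p₂) ≤ G.lead (p₂ - p₃) * F.lead (p₁ - p₂)) :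
    F.OneSided G {p₁, p₂, p₃} p₂ p₃ := by
  have hne := line_ne_zero_of_isElliptic hF h₁ h₂ h₃ h₁₂ h₁₃ h₂₃
  refine OneSided.of_bary hne fun w hw hG => ?_
  rcases hG with hG | rfl | rfl | rfl
  · exact bary_nonneg_of_ratio hF h₁ h₂ h₃ g₁ g₂ g₃ h₁₂ h₁₃ h₂₃ hB hC hw hG
  · rw [bary_self hne]; exact zero_le_one
  · rw [bary_left]
  · rw [bary_right]

/-- The right chord is the side of the triangle on which the ratio of the quadratic parts of `G` and
`F` is largest. -/
theorem exists_oneSided_three {P : Set Plane} (hF : F.IsElliptic)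
    (hFP : ∀ p ∈ P, F.eval p = 0) (hGP : ∀ p ∈ P, G.eval p = 0) (hP : P.encard = 3) :
    ∃ x ∈ P, ∃ y ∈ P, x ≠ y ∧ F.OneSided G P x y := by
  obtain ⟨p₁, p₂, p₃, h₁₂, h₁₃, h₂₃, rfl⟩ := encard_eq_three.1 hP
  have h₁ := hFP p₁ (by simp)
  have h₂ := hFP p₂ (by simp)
  have h₃ := hFP p₃ (by simp)
  have g₁ := hGP p₁ (by simp)
  have g₂ := hGP p₂ (by simp)
  have g₃ := hGP p₃ (by simp)
  have hA := hF.lead_pos (sub_ne_zero.2 h₂₃)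
  have hB := hF.lead_pos (sub_ne_zero.2 h₁₃.symm)
  have hC := hF.lead_pos (sub_ne_zero.2 h₁₂)
  have e₁ : ({p₁, p₂, p₃} : Set Plane) = {p₂, p₃, p₁} := by
    ext; simp only [mem_insert_iff, mem_singleton_iff]; tauto
  have e₂ : ({p₁, p₂, p₃} : Set Plane) = {p₃, p₁, p₂} := by
    ext; simp only [mem_insert_iff, mem_singleton_iff]; tauto
  have hr : ∀ {a b a' b' : ℝ}, 0 < a → 0 < b → b' / b ≤ a' / a → a * b' ≤ a' * b := by
    intro a b a' b' ha hb h
    rw [div_le_div_iff₀ hb ha] at h; linarith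
  rcases le_total (G.lead (p₃ - p₁) / F.lead (p₃ - p₁)) (G.lead (p₂ - p₃) / F.lead (p₂ - p₃))
    with hab | hab
  · rcases le_total (G.lead (p₁ - p₂) / F.lead (p₁ - p₂)) (G.lead (p₂ - p₃) / F.lead (p₂ - p₃))
      with hac | hac
    · exact ⟨p₂, by simp, p₃, by simp, h₂₃, oneSided_of_ratio hF h₁ h₂ h₃ g₁ g₂ g₃ h₁₂ h₁₃ h₂₃
        (hr hA hB hab) (hr hA hC hac)⟩
    · exact ⟨p₁, by simp, p₂, by simp, h₁₂, e₂ ▸ oneSided_of_ratio hF h₃ h₁ h₂ g₃ g₁ g₂ h₁₃.symm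
        h₂₃.symm h₁₂ (hr hC hA hac) (hr hC hB (hab.trans hac))⟩
  · rcases le_total (G.lead (p₁ - p₂) / F.lead (p₁ - p₂)) (G.lead (p₃ - p₁) / F.lead (p₃ - p₁))
      with hbc | hbc
    · exact ⟨p₃, by simp, p₁, by simp, h₁₃.symm, e₁ ▸ oneSided_of_ratio hF h₂ h₃ h₁ g₂ g₃ g₁ h₂₃
        h₁₂.symm h₁₃.symm (hr hB hC hbc) (hr hB hA hab)⟩
    · exact ⟨p₁, by simp, p₂, by simp, h₁₂, e₂ ▸ oneSided_of_ratio hF h₃ h₁ h₂ g₃ g₁ g₂ h₁₃.symm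
        h₂₃.symm h₁₂ (hr hC hA (hab.trans hbc)) (hr hC hB hbc)⟩

/-- Here `p₄` lies beyond the side `p₂ p₃`, so `p₁ p₃` and `p₂ p₄` are opposite sides of the convex
quadrilateral. On the ellipse, `G` is a multiple of the product of these two lines, and `hle`
decides the sign of the multiple; the opposite inequality leads to the other pair of opposite sides.
-/
theorem oneSided_of_bary_neg_of_le {p₁ p₂ p₃ p₄ : Plane} (hF : F.IsElliptic)
    (h₁ : F.eval p₁ = 0) (h₂ : F.eval p₂ = 0) (h₃ : F.eval p₃ = 0) (h₄ : F.eval p₄ = 0)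
    (g₁ : G.eval p₁ = 0) (g₂ : G.eval p₂ = 0) (g₃ : G.eval p₃ = 0) (g₄ : G.eval p₄ = 0)
    (h₁₂ : p₁ ≠ p₂) (h₁₃ : p₁ ≠ p₃) (h₂₃ : p₂ ≠ p₃) (hu : bary p₁ p₂ p₃ p₄ < 0)
    (hle : G.lead (p₁ - p₂) * F.lead (p₃ - p₁) ≤ F.lead (p₁ - p₂) * G.lead (p₃ - p₁)) :
    F.OneSided G {p₁, p₂, p₃, p₄} p₁ p₃ ∧ F.OneSided G {p₁, p₂, p₃, p₄} p₂ p₄ := by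
  have hne := line_ne_zero_of_isElliptic hF h₁ h₂ h₃ h₁₂ h₁₃ h₂₃
  obtain ⟨hs, ht⟩ := bary_pos_of_neg hF h₁ h₂ h₃ h₁₂ h₁₃ h₂₃ h₄ hu
  have hB := hF.lead_pos (sub_ne_zero.2 h₁₃.symm)
  have key : ∀ w, F.eval w = 0 → 0 < G.eval w → 0 < bary p₂ p₃ p₁ w ∧
      0 < bary p₃ p₁ p₂ p₄ * bary p₁ p₂ p₃ w - bary p₁ p₂ p₃ p₄ * bary p₃ p₁ p₂ w := by
    intro w hw hGw
    have hev := eval_eq_bary F hne h₁ h₂ h₃ w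
    have gev := eval_eq_bary G hne g₁ g₂ g₃ w
    have hev₄ := eval_eq_bary F hne h₁ h₂ h₃ p₄
    have gev₄ := eval_eq_bary G hne g₁ g₂ g₃ p₄
    have hwedge : bary p₂ p₃ p₁ w < 0 → 0 < bary p₃ p₁ p₂ w ∧ 0 < bary p₁ p₂ p₃ w :=
      bary_pos_of_neg hF h₂ h₃ h₁ h₂₃ h₁₂.symm h₁₃.symm hw
    rw [hw] at hev
    rw [h₄] at hev₄
    rw [g₄] at gev₄
    generalize G.eval w = g at *
    generalize bary p₁ p₂ p₃ w = u at *
    generalize bary p₂ p₃ p₁ w = s at *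
    generalize bary p₃ p₁ p₂ w = t at *
    generalize bary p₁ p₂ p₃ p₄ = u₄ at *
    generalize bary p₂ p₃ p₁ p₄ = s₄ at *
    generalize bary p₃ p₁ p₂ p₄ = t₄ at *
    generalize F.lead (p₂ - p₃) = A at *
    generalize F.lead (p₃ - p₁) = B at *
    generalize F.lead (p₁ - p₂) = C at *
    generalize G.lead (p₂ - p₃) = A' at *
    generalize G.lead (p₃ - p₁) = B' at *
    generalize G.lead (p₁ - p₂) = C' at *
    have e1 : B * g = -(s * ((A' * B - A * B') * t + (C' * B - C * B') * u)) := by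
      rw [gev]; linear_combination -B' * hev
    -- Evaluating the factorization at `p₄`, which is not on the line `p₁ p₃`, identifies the second
    -- factor with the line `p₂ p₄`.
    have e2 : s₄ * ((A' * B - A * B') * t₄ + (C' * B - C * B') * u₄) = 0 := by
      linear_combination B * gev₄ - B' * hev₄
    have e3 := (mul_eq_zero.1 e2).resolve_left hs.ne'
    have e4 : t₄ * (B * g) = (C * B' - C' * B) * (s * (t₄ * u - u₄ * t)) := by
      rw [e1]; linear_combination (-(s * t)) * e3
    have e5 : 0 < (C * B' - C' * B) * (s * (t₄ * u - u₄ * t)) :=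
      e4 ▸ mul_pos ht (mul_pos hB hGw)
    have e6 : 0 < s * (t₄ * u - u₄ * t) := by
      by_contra! hcon
      nlinarith [mul_nonneg (sub_nonneg.2 hle) (neg_nonneg.2 hcon)]
    -- The product of the two lines is positive. Both cannot be negative: beyond `p₁ p₃` the other
    -- two coordinates are positive, and then so is the second factor.
    have hs0 : 0 < s := by
      by_contra! hcon
      rcases hcon.eq_or_lt with h0 | hneg
      · rw [h0, zero_mul] at e6; exact e6.false
      · obtain ⟨h5, h6⟩ := hwedge hneg
        nlinarith [mul_pos ht h6, mul_pos (neg_pos.2 hu) h5]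
    exact ⟨hs0, (mul_pos_iff_of_pos_left hs0).1 e6⟩
  constructor
  · have hne' : (AffForm.line p₁ p₃).eval p₂ ≠ 0 := by
      rwa [AffForm.line_swap, AffForm.line_rotate p₂ p₃ p₁, neg_ne_zero]
    refine OneSided.of_bary hne' fun w hw hG => ?_
    rw [bary_swap]
    rcases hG with hG | rfl | rfl | rfl | rfl
    · exact (key w hw hG).1.le
    · rw [bary_right]
    · rw [bary_swap, bary_self hne']; exact zero_le_one
    · rw [bary_left]
    · exact hs.le
  · obtain ⟨κ, hκ, hκm⟩ : ∃ κ : ℝ, κ ≠ 0 ∧ ∀ w, bary p₃ p₁ p₂ p₄ * bary p₁ p₂ p₃ w -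
        bary p₁ p₂ p₃ p₄ * bary p₃ p₁ p₂ w = κ * (AffForm.line p₂ p₄).eval w := by
      refine ⟨((AffForm.line p₂ p₃).eval p₁)⁻¹, inv_ne_zero hne, fun w => ?_⟩
      simp only [bary]
      rw [AffForm.line_rotate p₃ p₁ p₂, AffForm.line_rotate p₂ p₃ p₁]
      field_simp
      simp only [AffForm.line, AffForm.eval]
      ring
    refine ⟨κ, hκ, fun w hw hG => ?_⟩
    rw [← hκm]
    rcases hG with hG | rfl | rfl | rfl | rfl
    · exact (key w hw hG).2.le
    · rw [bary_self hne, bary_left]; linarith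
    · rw [bary_left, bary_right]; linarith
    · have hne3 : (AffForm.line p₁ p₂).eval w ≠ 0 := by rwa [← AffForm.line_rotate]
      rw [bary_right, bary_self hne3]; linarith
    · linarith

theorem oneSided_of_bary_neg {p₁ p₂ p₃ p₄ : Plane} (hF : F.IsElliptic)
    (h₁ : F.eval p₁ = 0) (h₂ : F.eval p₂ = 0) (h₃ : F.eval p₃ = 0) (h₄ : F.eval p₄ = 0)
    (g₁ : G.eval p₁ = 0) (g₂ : G.eval p₂ = 0) (g₃ : G.eval p₃ = 0) (g₄ : G.eval p₄ = 0)
    (h₁₂ : p₁ ≠ p₂) (h₁₃ : p₁ ≠ p₃) (h₂₃ : p₂ ≠ p₃) (h₂₄ : p₂ ≠ p₄) (h₃₄ : p₃ ≠ p₄)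
    (hu : bary p₁ p₂ p₃ p₄ < 0) :
    ∃ x₁ y₁ x₂ y₂, ({p₁, p₂, p₃, p₄} : Set Plane) = {x₁, y₁, x₂, y₂} ∧ x₁ ≠ y₁ ∧ x₂ ≠ y₂ ∧
      F.OneSided G {p₁, p₂, p₃, p₄} x₁ y₁ ∧ F.OneSided G {p₁, p₂, p₃, p₄} x₂ y₂ := by
  rcases le_total (G.lead (p₁ - p₂) * F.lead (p₃ - p₁)) (F.lead (p₁ - p₂) * G.lead (p₃ - p₁))
    with hle | hle
  · obtain ⟨ha, hb⟩ := oneSided_of_bary_neg_of_le hF h₁ h₂ h₃ h₄ g₁ g₂ g₃ g₄ h₁₂ h₁₃ h₂₃ hu hle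
    refine ⟨p₁, p₃, p₂, p₄, ?_, h₁₃, h₂₄, ha, hb⟩
    ext; simp only [mem_insert_iff, mem_singleton_iff]; tauto
  · have e : ({p₁, p₂, p₃, p₄} : Set Plane) = {p₁, p₃, p₂, p₄} := by
      ext; simp only [mem_insert_iff, mem_singleton_iff]; tauto
    obtain ⟨ha, hb⟩ := oneSided_of_bary_neg_of_le hF h₁ h₃ h₂ h₄ g₁ g₃ g₂ g₄ h₁₃ h₁₂ h₂₃.symm
      (by rwa [bary_swap]) (by
        rw [F.lead_swap p₂ p₁, F.lead_swap p₁ p₃, G.lead_swap p₂ p₁, G.lead_swap p₁ p₃]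
        linarith)
    exact ⟨p₁, p₂, p₃, p₄, rfl, h₁₂, h₃₄, e ▸ ha, e ▸ hb⟩

/-- Four points of an ellipse are in convex position: if `p₄` had no negative coordinate it would
lie in the triangle of the others, where `F < 0`. So `p₄` lies beyond one of the three sides. -/
theorem exists_oneSided_four {P : Set Plane} (hF : F.IsElliptic)
    (hFP : ∀ p ∈ P, F.eval p = 0) (hGP : ∀ p ∈ P, G.eval p = 0) (hP : P.encard = 4) :
    ∃ x₁ y₁ x₂ y₂, P = {x₁, y₁, x₂, y₂} ∧ x₁ ≠ y₁ ∧ x₂ ≠ y₂ ∧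
      F.OneSided G P x₁ y₁ ∧ F.OneSided G P x₂ y₂ := by
  obtain ⟨p₁, p₂, p₃, p₄, h₁₂, h₁₃, h₁₄, h₂₃, h₂₄, h₃₄, rfl⟩ := encard_eq_four.1 hP
  have h₁ := hFP p₁ (by simp)
  have h₂ := hFP p₂ (by simp)
  have h₃ := hFP p₃ (by simp)
  have h₄ := hFP p₄ (by simp)
  have g₁ := hGP p₁ (by simp)
  have g₂ := hGP p₂ (by simp)
  have g₃ := hGP p₃ (by simp)
  have g₄ := hGP p₄ (by simp)
  have hne := line_ne_zero_of_isElliptic hF h₁ h₂ h₃ h₁₂ h₁₃ h₂₃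
  by_cases hu : bary p₁ p₂ p₃ p₄ < 0
  · exact oneSided_of_bary_neg hF h₁ h₂ h₃ h₄ g₁ g₂ g₃ g₄ h₁₂ h₁₃ h₂₃ h₂₄ h₃₄ hu
  by_cases hs : bary p₂ p₃ p₁ p₄ < 0
  · have e : ({p₁, p₂, p₃, p₄} : Set Plane) = {p₂, p₃, p₁, p₄} := by
      ext; simp only [mem_insert_iff, mem_singleton_iff]; tauto
    rw [e]
    exact oneSided_of_bary_neg hF h₂ h₃ h₁ h₄ g₂ g₃ g₁ g₄ h₂₃ h₁₂.symm h₁₃.symm h₃₄ h₁₄ hs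
  by_cases ht : bary p₃ p₁ p₂ p₄ < 0
  · have e : ({p₁, p₂, p₃, p₄} : Set Plane) = {p₃, p₁, p₂, p₄} := by
      ext; simp only [mem_insert_iff, mem_singleton_iff]; tauto
    rw [e]
    exact oneSided_of_bary_neg hF h₃ h₁ h₂ h₄ g₃ g₁ g₂ g₄ h₁₃.symm h₂₃.symm h₁₂ h₁₄ h₂₄ ht
  exfalso
  push Not at hu hs ht
  have k₁ := line_ne_zero_of_isElliptic hF h₄ h₂ h₃ h₂₄.symm h₃₄.symm h₂₃
  have k₂ := line_ne_zero_of_isElliptic hF h₄ h₃ h₁ h₃₄.symm h₁₄.symm h₁₃.symm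
  have hne2 : (AffForm.line p₃ p₁).eval p₂ ≠ 0 := by
    rwa [AffForm.line_rotate p₂ p₃ p₁]
  have hu' : 0 < bary p₁ p₂ p₃ p₄ := hu.lt_of_ne' (div_ne_zero k₁ hne)
  have hs' : 0 < bary p₂ p₃ p₁ p₄ := hs.lt_of_ne' (div_ne_zero k₂ hne2)
  have hev := eval_eq_bary F hne h₁ h₂ h₃ p₄
  rw [h₄] at hev
  have hA := hF.lead_pos (sub_ne_zero.2 h₂₃)
  have hB := hF.lead_pos (sub_ne_zero.2 h₁₃.symm)
  have hC := hF.lead_pos (sub_ne_zero.2 h₁₂)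
  have := mul_pos hC (mul_pos hu' hs')
  have := mul_nonneg hB.le (mul_nonneg hu ht)
  have := mul_nonneg hA.le (mul_nonneg hs ht)
  linarith

end Conic

end

section

/-! ### Overlap forced by simple connectedness. -/

section Overlap

variable {X : Type*} [MetricSpace X] [ChartedSpace Plane X] {D : X → Plane}
  [TranslationSurface X] [Nonempty X] {V : Set X} {F : Conic}

namespace IsSheet

theorem isPreconnected {A : Set Plane} (hD : IsDevelopingMap D) (h : IsSheet D V A) :
    IsPreconnected V := by
  have h1 := h.convex.isPreconnected.image _ (h.continuousOn_section hD)
  convert h1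
  ext x
  constructor
  · exact fun hx => ⟨D x, h.bijOn.mapsTo hx, h.section_map hx⟩
  · rintro ⟨a, ha, rfl⟩; exact h.section_mem ha

theorem map_mem_frontier_of_mem_closure {A : Set Plane} (hD : IsDevelopingMap D)
    (h : IsSheet D V A) {x : X} (hx : x ∈ closure V) (hxV : x ∉ V) :
    (x : Completion X) ∈ bdry V ∧ D x ∈ frontier A := by
  have h1 : (x : Completion X) ∈ bdry V := by
    rw [h.bdry_eq]
    refine ⟨image_closure_subset_closure_image (Completion.continuous_coe X)
      (mem_image_of_mem _ hx), ?_⟩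
    rintro ⟨y, hy, hyx⟩
    exact hxV (Completion.coe_injective X hyx ▸ hy)
  refine ⟨h1, ?_⟩
  rw [← devExt_coe hD]; exact h.map_mem_frontier hD h1

/-- A continuous function `l` on the plane, whose zeros on the boundary of an elliptic sheet are
frontier points, gives a continuous function on the surface that measures the side of `l = 0`. -/
theorem exists_side [SimplyConnectedSpace X] (hD : IsDevelopingMap D)
    (h : IsSheet D V {x | F.eval x < 0}) (hF : F.IsElliptic) (hV : V.Nonempty) {l : Plane → ℝ}
    (hl : Continuous l)
    (hlz : ∀ w, F.eval w = 0 → l w = 0 → ∃ z ∈ bdry V ∩ surfaceFrontier X, devExt D z = w) :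
    ∃ ψ : X → ℝ, Continuous ψ ∧ (∀ x ∉ V, ∃ n : ℤ, ψ x = n) ∧
      ∀ x ∈ V, ψ x = 1 / 2 + l (D x) / (2 * (|l (D x)| + |F.eval (D x)|)) := by
  classical
  obtain ⟨x₀, hx₀⟩ := hV
  have hFx₀ : F.eval (D x₀) < 0 := h.bijOn.mapsTo hx₀
  let φ : Plane → ℝ := fun w => 1 / 2 + l w / (2 * (|l w| + |F.eval w|))
  have hφ : ∀ w, (F.eval w = 0 → l w ≠ 0) → ContinuousAt φ w := by
    intro w hw
    refine continuousAt_const.add (hl.continuousAt.div (by fun_prop) ?_)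
    have : 0 < |l w| + |F.eval w| := by
      by_cases h0 : F.eval w = 0
      · have := abs_pos.2 (hw h0); positivity
      · have := abs_pos.2 h0; positivity
    positivity
  let g : X → Circle := fun x => Circle.exp (2 * Real.pi * φ (D x))
  have hg : ∀ x, (F.eval (D x) = 0 → l (D x) ≠ 0) → ContinuousAt g x := fun x hx =>
    Circle.exp.continuous.continuousAt.comp
      (continuousAt_const.mul ((hφ _ hx).comp hD.continuous.continuousAt))
  let θ : X → Circle := fun x => if x ∈ V then g x else 1
  have hθ : Continuous θ := by
    rw [continuous_iff_continuousAt]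
    intro x
    by_cases hxV : x ∈ V
    · have hFx : F.eval (D x) < 0 := h.bijOn.mapsTo hxV
      refine (hg x fun h0 => absurd h0 hFx.ne).congr ?_
      filter_upwards [h.isOpen.mem_nhds hxV] with y hy using (if_pos hy).symm
    by_cases hxc : x ∈ closure V
    · obtain ⟨hb, hfr⟩ := h.map_mem_frontier_of_mem_closure hD hxc hxV
      rw [F.frontier_lt hF.lead_nonneg hFx₀] at hfr
      have hF0 : F.eval (D x) = 0 := hfr
      have hl0 : l (D x) ≠ 0 := by
        intro h0
        obtain ⟨z, hz, hzx⟩ := hlz _ hF0 h0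
        have : z = x := by
          rw [← h.ext_map_of_mem_bdry hD hz.1, hzx, ← devExt_coe hD,
            h.ext_map_of_mem_bdry hD hb]
        exact coe_notMem_surfaceFrontier x (this ▸ hz.2)
      have hgx : g x = 1 := by
        have hφx : φ (D x) = 1 ∨ φ (D x) = 0 := by
          simp only [φ, hF0, abs_zero, add_zero]
          rcases lt_or_gt_of_ne hl0 with hneg | hpos
          · right; rw [abs_of_neg hneg]; field_simp; norm_num
          · left; rw [abs_of_pos hpos]; field_simp; norm_num
        simp only [g]
        rcases hφx with h1 | h1 <;> rw [h1] <;> simp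
      have hcont := (hg x fun _ => hl0).tendsto
      rw [hgx] at hcont
      have hθx : θ x = 1 := if_neg hxV
      rw [ContinuousAt, hθx]
      exact hcont.if' tendsto_const_nhds
    · refine continuousAt_const.congr (f := fun _ => (1 : Circle)) ?_
      filter_upwards [isClosed_closure.isOpen_compl.mem_nhds hxc] with y hy
      exact (if_neg fun hyV => hy (subset_closure hyV)).symm
  have : LocallyPathConnectedSpace X := ChartedSpace.locallyPathConnectedSpace Plane X
  -- Simple connectedness enters here: the circle-valued function has a real-valued lift. Outside
  -- `V` the lift is an integer multiple of `2π`.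
  obtain ⟨Ψ, ⟨hΨ₀, hΨ⟩, -⟩ := Circle.isCoveringMap_exp.existsUnique_continuousMap_lifts
    (⟨θ, hθ⟩ : C(X, Circle)) x₀ (2 * Real.pi * φ (D x₀)) (if_pos hx₀).symm
  have hΨ' : ∀ x, Circle.exp (Ψ x) = θ x := fun x => congrFun hΨ x
  have hpi := Real.pi_pos
  refine ⟨fun x => Ψ x / (2 * Real.pi), by fun_prop, fun x hx => ?_, fun x hx => ?_⟩
  · have h1 : Circle.exp (Ψ x) = Circle.exp 0 := by
      rw [hΨ', Circle.exp_zero]; exact if_neg hx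
    obtain ⟨m, hm⟩ := Circle.exp_eq_exp.1 h1
    refine ⟨m, ?_⟩
    change Ψ x / (2 * Real.pi) = m
    rw [hm]; field_simp; ring
  · have heq := Circle.isCoveringMap_exp.isSeparatedMap.eqOn_of_comp_eqOn
      Circle.isCoveringMap_exp.isLocalHomeomorph.isLocallyInjective (h.isPreconnected hD)
      Ψ.continuous.continuousOn (g₂ := fun x => 2 * Real.pi * φ (D x))
      (fun y hy => (continuousAt_const.mul ((hφ _ fun h0 => absurd h0
        (show F.eval (D y) < 0 from h.bijOn.mapsTo hy).ne).comp
          hD.continuous.continuousAt)).continuousWithinAt)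
      (fun y hy => (hΨ' y).trans (if_pos hy)) hx₀ hΨ₀ hx
    change Ψ x / (2 * Real.pi) = φ (D x)
    rw [heq]
    field_simp

/-- Near `z`, a short path from `V` to `U` stays over `l > 0`. Along it `ψ` never equals `1 / 2`:
inside `V` by the sign of `l`, and outside because `ψ` is an integer there. Connectedness spreads
the inequality over `U`. -/
theorem _root_.side_gt_of_mem_closure (hD : IsDevelopingMap D)
    {l : Plane → ℝ} (hl : Continuous l) {ψ : X → ℝ} (hψ : Continuous ψ)
    (hψn : ∀ x ∉ V, ∃ n : ℤ, ψ x = n) (hψV : ∀ x ∈ V, 1 / 2 < ψ x ↔ 0 < l (D x))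
    {U : Set X} (hU : IsPreconnected U) (hUV : Disjoint U V) {z : Completion X}
    (hzU : z ∈ closure ((↑) '' U)) (hzV : z ∈ closure ((↑) '' V)) (hlz : 0 < l (devExt D z)) :
    ∀ x ∈ U, 1 / 2 < ψ x := by
  have hint : ∀ x ∉ V, ψ x ≠ 1 / 2 := by
    intro x hx h0
    obtain ⟨n, hn⟩ := hψn x hx
    rw [hn] at h0
    have h2 : (2 * n : ℝ) = 1 := by rw [h0]; norm_num
    have h3 : 2 * n = 1 := by exact_mod_cast h2
    omega
  obtain ⟨δ, hδ, hball⟩ := Metric.isOpen_iff.1 (isOpen_lt continuous_const hl) (devExt D z) hlz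
  obtain ⟨_, ⟨u, hu, rfl⟩, hzu⟩ := Metric.mem_closure_iff.1 hzU (δ / 4) (by positivity)
  obtain ⟨_, ⟨v, hv, rfl⟩, hzv⟩ := Metric.mem_closure_iff.1 hzV (δ / 4) (by positivity)
  have hvu : edist v u < ENNReal.ofReal (δ / 2) := by
    rw [edist_dist, ENNReal.ofReal_lt_ofReal_iff (by positivity), ← Completion.dist_eq]
    have := dist_triangle_left (v : Completion X) u z
    linarith
  obtain ⟨γ, hγ⟩ := hD.exists_path hvu
  have hγl : ∀ t, 0 < l (D (γ t)) := by
    intro t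
    refine hball ?_
    have h1 := hγ t
    rw [edist_dist, ENNReal.ofReal_lt_ofReal_iff (by positivity)] at h1
    have h2 := dist_devExt_le hD z v
    rw [devExt_coe hD] at h2
    have h3 := dist_triangle_left (D (γ t)) (devExt D z) (D v)
    rw [dist_comm (D v) (devExt D z)] at h3
    rw [Metric.mem_ball]
    linarith
  have hne : ∀ t, ψ (γ t) ≠ 1 / 2 := by
    intro t
    by_cases ht : γ t ∈ V
    · exact ((hψV _ ht).2 (hγl t)).ne'
    · exact hint _ ht
  have hu1 : 1 / 2 < ψ u := by
    by_contra! hcon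
    obtain ⟨t, ht⟩ := mem_range_of_exists_le_of_exists_ge (f := fun t => ψ (γ t)) (c := 1 / 2)
      (hψ.comp γ.continuous) ⟨1, by simpa using hcon⟩
      ⟨0, by simpa using ((hψV v hv).2 (by simpa using hγl 0)).le⟩
    exact hne t ht
  intro x hx
  by_contra! hcon
  obtain ⟨y, hy, hy0⟩ := hU.intermediate_value hx hu hψ.continuousOn ⟨hcon, hu1.le⟩
  exact hint y (disjoint_left.1 hUV hy) hy0

end IsSheet

theorem half_lt_side_iff {a b : ℝ} (hb : b ≠ 0) : 1 / 2 < 1 / 2 + a / (2 * (|a| + |b|)) ↔ 0 < a := by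
  have : 0 < 2 * (|a| + |b|) := by have := abs_pos.2 hb; positivity
  rw [lt_add_iff_pos_right, div_pos_iff_of_pos_right this]

theorem eq_or_eq_of_bary_eq_zero {p₁ p₂ p₃ w : Plane} (hF : F.IsElliptic) (h₁ : F.eval p₁ = 0)
    (h₂ : F.eval p₂ = 0) (h₃ : F.eval p₃ = 0) (h₁₂ : p₁ ≠ p₂) (h₁₃ : p₁ ≠ p₃) (h₂₃ : p₂ ≠ p₃)
    (hw : F.eval w = 0) (h : bary p₁ p₂ p₃ w = 0) : w = p₂ ∨ w = p₃ := by
  by_contra! hcon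
  exact line_ne_zero_of_isElliptic hF hw h₂ h₃ hcon.1 hcon.2 h₂₃
    ((div_eq_zero_iff.1 h).resolve_right (line_ne_zero_of_isElliptic hF h₁ h₂ h₃ h₁₂ h₁₃ h₂₃))

/-- On a simply connected surface, a connected set that accumulates at three frontier points of
the boundary of an elliptic sheet meets the sheet. -/
theorem IsSheet.inter_nonempty [SimplyConnectedSpace X] (hD : IsDevelopingMap D)
    (h : IsSheet D V {x | F.eval x < 0}) (hF : F.IsElliptic) {U : Set X}
    (hU : IsPreconnected U) {z₁ z₂ z₃ : Completion X} (h₁₂ : z₁ ≠ z₂) (h₁₃ : z₁ ≠ z₃)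
    (h₂₃ : z₂ ≠ z₃) (hz₁ : z₁ ∈ bdry V ∩ surfaceFrontier X)
    (hz₂ : z₂ ∈ bdry V ∩ surfaceFrontier X) (hz₃ : z₃ ∈ bdry V ∩ surfaceFrontier X)
    (hU₁ : z₁ ∈ closure ((↑) '' U)) (hU₂ : z₂ ∈ closure ((↑) '' U))
    (hU₃ : z₃ ∈ closure ((↑) '' U)) : (U ∩ V).Nonempty := by
  by_contra hemp
  have hUV : Disjoint U V := disjoint_iff_inter_eq_empty.2 (not_nonempty_iff_eq_empty.1 hemp)
  have hcl : ∀ {z}, z ∈ bdry V ∩ surfaceFrontier X → z ∈ closure ((↑) '' V : Set (Completion X)) :=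
    fun hz => ((h.mem_bdry_iff hD).1 hz.1).1
  obtain ⟨v₀, hv₀⟩ : V.Nonempty := by
    have := hcl hz₁
    by_contra hc
    rw [not_nonempty_iff_eq_empty.1 hc, image_empty, closure_empty] at this
    exact this
  have hFv₀ : F.eval (D v₀) < 0 := h.bijOn.mapsTo hv₀
  have hinj : ∀ {z z'}, z ∈ bdry V → z' ∈ bdry V → devExt D z = devExt D z' → z = z' := by
    intro z z' hz hz' heq
    rw [← h.ext_map_of_mem_bdry hD hz, heq, h.ext_map_of_mem_bdry hD hz']
  have hzero : ∀ {z}, z ∈ bdry V → F.eval (devExt D z) = 0 := by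
    intro z hz
    have := h.map_mem_frontier hD hz
    rwa [F.frontier_lt hF.lead_nonneg hFv₀] at this
  set p₁ := devExt D z₁ with hp₁
  set p₂ := devExt D z₂ with hp₂
  set p₃ := devExt D z₃ with hp₃
  have q₁₂ : p₁ ≠ p₂ := fun he => h₁₂ (hinj hz₁.1 hz₂.1 he)
  have q₁₃ : p₁ ≠ p₃ := fun he => h₁₃ (hinj hz₁.1 hz₃.1 he)
  have q₂₃ : p₂ ≠ p₃ := fun he => h₂₃ (hinj hz₂.1 hz₃.1 he)
  have e₁ : F.eval p₁ = 0 := hzero hz₁.1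
  have e₂ : F.eval p₂ = 0 := hzero hz₂.1
  have e₃ : F.eval p₃ = 0 := hzero hz₃.1
  have n₁ := line_ne_zero_of_isElliptic hF e₁ e₂ e₃ q₁₂ q₁₃ q₂₃
  have n₂ := line_ne_zero_of_isElliptic hF e₂ e₃ e₁ q₂₃ q₁₂.symm q₁₃.symm
  have n₃ := line_ne_zero_of_isElliptic hF e₃ e₁ e₂ q₁₃.symm q₂₃.symm q₁₂
  have side : ∀ {q₁ q₂ q₃ : Plane} {z z' z'' : Completion X}, F.eval q₁ = 0 → F.eval q₂ = 0 →
      F.eval q₃ = 0 → q₁ ≠ q₂ → q₁ ≠ q₃ → q₂ ≠ q₃ → z ∈ bdry V ∩ surfaceFrontier X →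
      devExt D z = q₂ → z' ∈ bdry V ∩ surfaceFrontier X → devExt D z' = q₃ →
      z'' ∈ closure ((↑) '' U) → z'' ∈ bdry V ∩ surfaceFrontier X → devExt D z'' = q₁ →
      (AffForm.line q₂ q₃).eval q₁ ≠ 0 →
      ∃ ψ : X → ℝ, Continuous ψ ∧ (∀ x ∉ V, ∃ n : ℤ, ψ x = n) ∧
        (∀ x ∈ V, 1 / 2 < ψ x ↔ 0 < bary q₁ q₂ q₃ (D x)) ∧ ∀ x ∈ U, 1 / 2 < ψ x := by
    intro q₁ q₂ q₃ z z' z'' f₁ f₂ f₃ r₁₂ r₁₃ r₂₃ hz hzq hz' hzq' hzU hz'' hzq'' hn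
    obtain ⟨ψ, hψ, hψn, hψV⟩ := h.exists_side hD hF ⟨v₀, hv₀⟩ (continuous_bary q₁ q₂ q₃) (by
      intro w hw hw0
      rcases eq_or_eq_of_bary_eq_zero hF f₁ f₂ f₃ r₁₂ r₁₃ r₂₃ hw hw0 with rfl | rfl
      exacts [⟨z, hz, hzq⟩, ⟨z', hz', hzq'⟩])
    have hiff : ∀ x ∈ V, 1 / 2 < ψ x ↔ 0 < bary q₁ q₂ q₃ (D x) := fun x hx => by
      have hFx : F.eval (D x) < 0 := h.bijOn.mapsTo hx
      rw [hψV x hx, half_lt_side_iff hFx.ne]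
    refine ⟨ψ, hψ, hψn, hiff, side_gt_of_mem_closure hD (continuous_bary q₁ q₂ q₃) hψ hψn hiff
      hU hUV hzU (hcl hz'') ?_⟩
    rw [hzq'', bary_self hn]; exact one_pos
  obtain ⟨ψ₁, c₁, i₁, s₁, u₁⟩ :=
    side e₁ e₂ e₃ q₁₂ q₁₃ q₂₃ hz₂ rfl hz₃ rfl hU₁ hz₁ rfl n₁
  obtain ⟨ψ₂, c₂, i₂, s₂, u₂⟩ :=
    side e₂ e₃ e₁ q₂₃ q₁₂.symm q₁₃.symm hz₃ rfl hz₁ rfl hU₂ hz₂ rfl n₂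
  obtain ⟨ψ₃, c₃, i₃, s₃, u₃⟩ :=
    side e₃ e₁ e₂ q₁₃.symm q₂₃.symm q₁₂ hz₁ rfl hz₂ rfl hU₃ hz₃ rfl n₃
  -- The open triangle in `V` with the three frontier points as vertices. Its closure in `X` stays
  -- in `V`, because the triangle touches the ellipse only at the vertices, and these are not in
  -- `X`.
  let T : Set X := {x | x ∈ V ∧ 0 < bary p₁ p₂ p₃ (D x) ∧ 0 < bary p₂ p₃ p₁ (D x) ∧
    0 < bary p₃ p₁ p₂ (D x)}
  have hTV : closure T ⊆ V := by
    intro x hx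
    by_contra hxV
    obtain ⟨hb, hfr⟩ := h.map_mem_frontier_of_mem_closure hD (closure_mono (fun y hy => hy.1) hx) hxV
    rw [F.frontier_lt hF.lead_nonneg hFv₀] at hfr
    have hF0 : F.eval (D x) = 0 := hfr
    have hge : ∀ {q₁ q₂ q₃}, (∀ y ∈ T, 0 < bary q₁ q₂ q₃ (D y)) → 0 ≤ bary q₁ q₂ q₃ (D x) := by
      intro q₁ q₂ q₃ hq
      exact closure_minimal (s := T) (t := {y | 0 ≤ bary q₁ q₂ q₃ (D y)})
        (fun y hy => (hq y hy).le)
        (isClosed_le continuous_const ((continuous_bary q₁ q₂ q₃).comp hD.continuous)) hx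
    have g₁ := hge (q₁ := p₁) (q₂ := p₂) (q₃ := p₃) fun y hy => hy.2.1
    have g₂ := hge (q₁ := p₂) (q₂ := p₃) (q₃ := p₁) fun y hy => hy.2.2.1
    have g₃ := hge (q₁ := p₃) (q₂ := p₁) (q₃ := p₂) fun y hy => hy.2.2.2
    have hnot : ∀ z, z ∈ bdry V ∩ surfaceFrontier X → D x ≠ devExt D z := by
      intro z hz heq
      rw [← devExt_coe hD] at heq
      exact coe_notMem_surfaceFrontier x (hinj hb hz.1 heq ▸ hz.2)
    have k₁ : bary p₁ p₂ p₃ (D x) ≠ 0 := fun h0 =>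
      (eq_or_eq_of_bary_eq_zero hF e₁ e₂ e₃ q₁₂ q₁₃ q₂₃ hF0 h0).elim (hnot _ hz₂) (hnot _ hz₃)
    have k₂ : bary p₂ p₃ p₁ (D x) ≠ 0 := fun h0 =>
      (eq_or_eq_of_bary_eq_zero hF e₂ e₃ e₁ q₂₃ q₁₂.symm q₁₃.symm hF0 h0).elim
        (hnot _ hz₃) (hnot _ hz₁)
    have hev := eval_eq_bary F n₁ e₁ e₂ e₃ (D x)
    rw [hF0] at hev
    have hA := hF.lead_pos (sub_ne_zero.2 q₂₃)
    have hB := hF.lead_pos (sub_ne_zero.2 q₁₃.symm)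
    have hC := hF.lead_pos (sub_ne_zero.2 q₁₂)
    have := mul_pos hC (mul_pos (g₁.lt_of_ne' k₁) (g₂.lt_of_ne' k₂))
    have := mul_nonneg hB.le (mul_nonneg g₁ g₃)
    have := mul_nonneg hA.le (mul_nonneg g₂ g₃)
    linarith
  -- Inside `V` the three inequalities cut out exactly `T`, so `G` avoids `V`. It contains `U` and
  -- is open and closed, which contradicts the connectedness of `X`.
  let G : Set X := {x | x ∉ T ∧ 1 / 2 < ψ₁ x ∧ 1 / 2 < ψ₂ x ∧ 1 / 2 < ψ₃ x}
  have hGV : ∀ x ∈ G, x ∉ V := fun x hx hxV =>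
    hx.1 ⟨hxV, (s₁ x hxV).1 hx.2.1, (s₂ x hxV).1 hx.2.2.1, (s₃ x hxV).1 hx.2.2.2⟩
  have hGo : IsOpen G := by
    have : G = (closure T)ᶜ ∩ ({x | 1 / 2 < ψ₁ x} ∩ ({x | 1 / 2 < ψ₂ x} ∩ {x | 1 / 2 < ψ₃ x})) := by
      ext x
      exact ⟨fun hx => ⟨fun hc => hGV x hx (hTV hc), hx.2⟩,
        fun hx => ⟨fun hc => hx.1 (subset_closure hc), hx.2⟩⟩
    rw [this]
    exact isClosed_closure.isOpen_compl.inter ((isOpen_lt continuous_const c₁).inter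
      ((isOpen_lt continuous_const c₂).inter (isOpen_lt continuous_const c₃)))
  have hGc : IsClosed G := by
    refine isClosed_of_closure_subset fun x hx => ?_
    have hxV : x ∉ V := fun hxV => by
      obtain ⟨y, hyV, hyG⟩ := mem_closure_iff.1 hx V h.isOpen hxV
      exact hGV y hyG hyV
    have key : ∀ {ψ : X → ℝ}, Continuous ψ → (∀ x ∉ V, ∃ n : ℤ, ψ x = n) →
        (∀ y ∈ G, 1 / 2 < ψ y) → 1 / 2 < ψ x := by
      intro ψ hψ hn hG
      have hle : 1 / 2 ≤ ψ x := closure_minimal (s := G) (t := {y | 1 / 2 ≤ ψ y})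
        (fun y hy => (hG y hy).le) (isClosed_le continuous_const hψ) hx
      refine hle.lt_of_ne fun h0 => ?_
      obtain ⟨n, hn⟩ := hn x hxV
      rw [hn] at h0
      have h2 : (2 * n : ℝ) = 1 := by rw [← h0]; norm_num
      have h3 : 2 * n = 1 := by exact_mod_cast h2
      omega
    exact ⟨fun hT => hxV hT.1, key c₁ i₁ fun y hy => hy.2.1, key c₂ i₂ fun y hy => hy.2.2.1,
      key c₃ i₃ fun y hy => hy.2.2.2⟩
  obtain ⟨u, hu⟩ : U.Nonempty := by
    by_contra hc
    rw [not_nonempty_iff_eq_empty.1 hc, image_empty, closure_empty] at hU₁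
    exact hU₁
  have huG : u ∈ G := ⟨fun hT => disjoint_left.1 hUV hu hT.1, u₁ u hu, u₂ u hu, u₃ u hu⟩
  have huniv := IsClopen.eq_univ ⟨hGc, hGo⟩ ⟨u, huG⟩
  exact hGV v₀ (huniv ▸ mem_univ v₀) hv₀

end Overlap

end

section

/-! ### Projection to the precompact surface. -/

section LocalTranslation

variable {Y : Type*} [MetricSpace Y] [ChartedSpace Plane Y]

/-- In every chart, `φ` is locally a translation near the points of `C`. -/
def IsLocalTranslation (φ : Plane → Y) (C : Set Plane) : Prop :=
  ∀ w ∈ C, ∀ e ∈ atlas Plane Y, φ w ∈ e.source → ∃ v : Plane, ∀ᶠ w' in 𝓝 w, e (φ w') = w' + v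

/-- `Y` need not have a developing map, so uniqueness is proved in charts: maps that agree at a
point have the same translation vector there, and hence agree nearby. -/
theorem IsLocalTranslation.eqOn {φ₁ φ₂ : Plane → Y} {C : Set Plane} (hC : IsOpen C)
    (hCp : IsPreconnected C) (h₁ : IsLocalTranslation φ₁ C) (h₂ : IsLocalTranslation φ₂ C)
    (c₁ : ContinuousOn φ₁ C) (c₂ : ContinuousOn φ₂ C) {a : Plane} (ha : a ∈ C)
    (haa : φ₁ a = φ₂ a) : EqOn φ₁ φ₂ C := by
  have hsub : C ⊆ {w | w ∈ C ∧ φ₁ w = φ₂ w} := by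
    refine hCp.subset_of_closure_inter_subset ?_ ⟨a, ha, ha, haa⟩ ?_
    · rw [isOpen_iff_mem_nhds]
      rintro w ⟨hw, heq⟩
      set e := chartAt Plane (φ₁ w)
      have he : φ₁ w ∈ e.source := mem_chart_source Plane _
      obtain ⟨v₁, hv₁⟩ := h₁ w hw e (chart_mem_atlas Plane _) he
      obtain ⟨v₂, hv₂⟩ := h₂ w hw e (chart_mem_atlas Plane _) (heq ▸ he)
      have hv : v₁ = v₂ := by
        have := hv₁.self_of_nhds
        rw [heq, hv₂.self_of_nhds] at this
        exact (add_left_cancel this).symm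
      filter_upwards [hv₁, hv₂, hC.mem_nhds hw,
        (c₁.continuousAt (hC.mem_nhds hw)).eventually (e.open_source.mem_nhds he),
        (c₂.continuousAt (hC.mem_nhds hw)).eventually (e.open_source.mem_nhds (heq ▸ he))]
        with w' g₁ g₂ hw' k₁ k₂
      exact ⟨hw', e.injOn k₁ k₂ (by rw [g₁, g₂, hv])⟩
    · rintro w ⟨hwc, hw⟩
      refine ⟨hw, tendsto_nhds_unique_of_frequently_eq (c₁.continuousAt (hC.mem_nhds hw))
        (c₂.continuousAt (hC.mem_nhds hw)) ?_⟩
      exact (mem_closure_iff_frequently.1 hwc).mono fun x hx => hx.2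
  exact fun w hw => (hsub hw).2

end LocalTranslation

section Covering

variable {X Y : Type*} [MetricSpace X] [ChartedSpace Plane X] [TranslationSurface X] [Nonempty X]
  [MetricSpace Y] [ChartedSpace Plane Y] {p : X → Y} {D : X → Plane} {U : Set X} {A : Set Plane}

theorem IsTranslationMap.isDevelopmentAlong (hp : IsTranslationMap p) {x x' : X} {y y' : Y}
    {γ : Path x x'} {γ' : Path y y'} (h : ∀ t, γ' t = p (γ t)) {δ : unitInterval → Plane}
    (hδ : IsDevelopmentAlong γ' δ) : IsDevelopmentAlong γ δ := by
  intro t e he ht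
  obtain ⟨v, hv⟩ := hδ t _ (chart_mem_atlas Plane (γ' t)) (mem_chart_source Plane _)
  obtain ⟨v', hv'⟩ := hp.2 e he _ (chart_mem_atlas Plane (γ' t)) (γ t) ht
    (h t ▸ mem_chart_source Plane (γ' t))
  refine ⟨v' + v, ?_⟩
  filter_upwards [hv, γ.continuous.continuousAt.eventually hv'] with s hs hs'
  rw [hs, h s, hs', add_assoc]

theorem IsSheet.isLocalTranslation (hD : IsDevelopingMap D) (h : IsSheet D U A)
    (hp : IsTranslationMap p) : IsLocalTranslation (fun w => p (sheetSection D U w)) A := by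
  intro w hw e he hwe
  obtain ⟨v, hv⟩ := hp.2 _ (chart_mem_atlas Plane (sheetSection D U w)) e he _
    (mem_chart_source Plane _) hwe
  obtain ⟨v', hv'⟩ := hD _ (chart_mem_atlas Plane (sheetSection D U w)) _
    (mem_chart_source Plane _)
  have hA := (h.isOpen_target hD).mem_nhds hw
  have hc := (h.continuousOn_section hD).continuousAt hA
  refine ⟨v - v', ?_⟩
  filter_upwards [hc.eventually hv, hc.eventually hv', hA] with w' h1 h2 h3
  rw [h.map_section h3] at h2
  rw [h1, eq_sub_of_add_eq h2.symm]
  abel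

variable [TranslationSurface Y]

/-- A path of length less than `R` in `Y` lifts to `X`. Its development stays in the ball, so the
lift stays in the sheet. -/
theorem IsSheet.exists_mem_ball_of_edist_lt (hD : IsDevelopingMap D) (h : IsSheet D U A)
    (hp : IsCoveringMap p) (hpt : IsTranslationMap p) {a : Plane} {R : ℝ}
    (hR : Metric.ball a R ⊆ A) {y : Y}
    (ha : a ∈ A) (hy : edist (p (sheetSection D U a)) y < ENNReal.ofReal R) :
    ∃ b ∈ Metric.ball a R, p (sheetSection D U b) = y := by
  obtain ⟨γ, δ, hδ, hlt⟩ := exists_path_of_edist_lt hy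
  set Γ := hp.liftPath γ (sheetSection D U a) γ.source with hΓ
  have hΓp : ∀ t, p (Γ t) = γ t := fun t => congrFun (hp.liftPath_lifts γ _ γ.source) t
  have hΓ0 : Γ 0 = sheetSection D U a := hp.liftPath_zero γ _ γ.source
  let Γ' : Path (sheetSection D U a) (Γ 1) := ⟨Γ, hΓ0, rfl⟩
  obtain ⟨c, hc⟩ := hD.exists_eq_of_isDevelopmentAlong
    (hpt.isDevelopmentAlong (γ := Γ') (fun t => (hΓp t).symm) hδ)
  have hball : ∀ t, D (Γ t) ∈ Metric.ball a R := by
    intro t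
    have h1 := hlt t 0
    rw [hc, hc, edist_add_right] at h1
    change edist (D (Γ t)) (D (Γ 0)) < _ at h1
    rw [hΓ0, h.map_section ha] at h1
    rw [edist_dist] at h1
    exact (ENNReal.ofReal_lt_ofReal_iff_of_nonneg dist_nonneg).1 h1
  have hsec := h.eqOn_section hD isPreconnected_univ Γ.continuous.continuousOn
    (fun t _ => hR (hball t)) (mem_univ 0) (by rw [hΓ0]; exact h.section_mem ha) 1 (mem_univ 1)
  refine ⟨D (Γ 1), hball 1, ?_⟩
  rw [← hsec, hΓp, γ.target]

theorem surfaceFrontier_eq_empty_of_isCompact {Y : Type*} [MetricSpace Y]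
    (h : IsCompact (univ : Set Y)) : surfaceFrontier Y = ∅ := by
  have h1 : IsClosed (range ((↑) : Y → Completion Y)) := by
    rw [← image_univ]
    exact (h.image (Completion.continuous_coe Y)).isClosed
  have h2 : closure (range ((↑) : Y → Completion Y)) = univ :=
    Completion.denseRange_coe.closure_range
  rw [h1.closure_eq] at h2
  rw [surfaceFrontier, h2, compl_univ]

/-- A precompact surface with nonempty frontier does not develop arbitrarily large discs. -/
theorem exists_radius_not_ball_subset (hp : IsCoveringMap p) (hpt : IsTranslationMap p)
    (hY : TotallyBounded (univ : Set Y)) (hYne : (surfaceFrontier Y).Nonempty)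
    (hD : IsDevelopingMap D) :
    ∃ R > 0, ∀ U A, IsSheet D U A → ∀ a, ¬ Metric.ball a R ⊆ A := by
  obtain ⟨C, hC⟩ := Metric.isBounded_iff.1 hY.isBounded
  have hC' : ∀ y y' : Y, dist y y' ≤ |C| := fun y y' =>
    (hC (mem_univ y) (mem_univ y')).trans (le_abs_self C)
  -- A larger ball leaves room for the closed ball of radius `|C| + 1` inside `A`. The image of that
  -- compact ball would be all of `Y`, making `Y` compact and its frontier empty.
  refine ⟨|C| + 2, by positivity, fun U A h a hball => ?_⟩
  have ha : a ∈ A := hball (Metric.mem_ball_self (by positivity))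
  have hsub : Metric.closedBall a (|C| + 1) ⊆ A :=
    (Metric.closedBall_subset_ball (by linarith)).trans hball
  have hcomp : IsCompact ((fun w => p (sheetSection D U w)) '' Metric.closedBall a (|C| + 1)) :=
    (isCompact_closedBall a _).image_of_continuousOn
      (hp.continuous.comp_continuousOn ((h.continuousOn_section hD).mono hsub))
  have huniv : (fun w => p (sheetSection D U w)) '' Metric.closedBall a (|C| + 1) = univ := by
    refine eq_univ_of_forall fun y => ?_
    obtain ⟨b, hb, hby⟩ := h.exists_mem_ball_of_edist_lt hD hp hpt (R := |C| + 1)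
      ((Metric.ball_subset_closedBall).trans hsub) (y := y) ha (by
        rw [edist_dist, ENNReal.ofReal_lt_ofReal_iff (by positivity)]
        linarith [hC' (p (sheetSection D U a)) y])
    exact ⟨b, Metric.ball_subset_closedBall hb, hby⟩
  rw [huniv] at hcomp
  rw [surfaceFrontier_eq_empty_of_isCompact hcomp] at hYne
  exact hYne.ne_empty rfl

/-- The projection of a segment ending at a frontier point cannot converge in `Y`: its covering lift
would end at a point of `X`, which would have to be `z`. -/
theorem IsSheet.false_of_extension (hD : IsDevelopingMap D) (h : IsSheet D U A)
    (hp : IsCoveringMap p) {z : Completion X} (hz : z ∈ bdry U ∩ surfaceFrontier X) {a : Plane}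
    (ha : a ∈ A) (β : C(unitInterval, Y))
    (hβ : ∀ t : unitInterval, t < 1 →
      β t = p (sheetSection D U (a + (t : ℝ) • (devExt D z - a)))) : False := by
  have hw := frontier_subset_closure (h.map_mem_frontier hD hz.1)
  have hA : ∀ t : unitInterval, t < 1 → a + (t : ℝ) • (devExt D z - a) ∈ A := fun t ht =>
    h.segment_mem hD ha hw ⟨t.2.1, ht⟩
  have h0 : β 0 = p (sheetSection D U a) := by
    rw [hβ 0 zero_lt_one]; simp
  set B := hp.liftPath β _ h0 with hB
  have hBp : ∀ t, p (B t) = β t := fun t => congrFun (hp.liftPath_lifts β _ h0) t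
  have hB0 : B 0 = sheetSection D U a := hp.liftPath_zero β _ h0
  have heq : EqOn B (fun t : unitInterval => sheetSection D U (a + (t : ℝ) • (devExt D z - a)))
      (Iio 1) := by
    refine hp.isSeparatedMap.eqOn_of_comp_eqOn hp.isLocalHomeomorph.isLocallyInjective
      isPreconnected_Iio B.continuous.continuousOn ?_ (fun t ht => ?_) (a := 0)
      (mem_Iio.2 zero_lt_one) (by rw [hB0]; simp)
    · exact (h.continuousOn_section hD).comp (by fun_prop) hA
    · exact (hBp t).trans (hβ t ht)
  have h1 : Tendsto (fun t => ((B t : X) : Completion X)) (𝓝[<] 1) (𝓝 (B 1 : X)) :=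
    (((Completion.continuous_coe X).comp B.continuous).tendsto 1).mono_left nhdsWithin_le_nhds
  have h2 : Tendsto (fun t : unitInterval => sheetExt D U (a + (t : ℝ) • (devExt D z - a)))
      (𝓝[<] 1) (𝓝 z) := by
    have h3 : Tendsto (fun t : unitInterval => a + (t : ℝ) • (devExt D z - a)) (𝓝[<] 1)
        (𝓝[closure A] (devExt D z)) := by
      refine tendsto_nhdsWithin_iff.2 ⟨?_, ?_⟩
      · have := (by fun_prop :
          Continuous fun t : unitInterval => a + (t : ℝ) • (devExt D z - a)).tendsto 1
        simp only [Icc.coe_one, one_smul, add_sub_cancel] at this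
        exact this.mono_left nhdsWithin_le_nhds
      · filter_upwards [self_mem_nhdsWithin] with t ht using subset_closure (hA t ht)
    have h4 := (h.continuousOn_ext hD _ hw).tendsto.comp h3
    rwa [h.ext_map_of_mem_bdry hD hz.1] at h4
  have hne : (𝓝[<] (1 : unitInterval)).NeBot := by
    refine mem_closure_iff_nhdsWithin_neBot.1 ?_
    rw [closure_Iio' ⟨0, zero_lt_one⟩]
    exact mem_Iic.2 le_rfl
  have h5 : z = ((B 1 : X) : Completion X) := by
    refine tendsto_nhds_unique h2 (h1.congr' ?_)
    filter_upwards [self_mem_nhdsWithin] with t ht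
    rw [heq ht, h.ext_eq_section hD (hA t ht)]
  exact coe_notMem_surfaceFrontier _ (h5 ▸ hz.2)

/-- If the translated end point were in `X`, the translated segment would project to a continuous
extension of the projection of the segment ending at `z`. -/
theorem IsSheet.ext_add_mem_surfaceFrontier (hD : IsDevelopingMap D) (h : IsSheet D U A)
    (hp : IsCoveringMap p) {v : Plane}
    (hv : ∀ w ∈ A, w + v ∈ A → p (sheetSection D U w) = p (sheetSection D U (w + v)))
    {a : Plane} (ha : a ∈ A) (hav : a + v ∈ A) {z : Completion X}
    (hz : z ∈ bdry U ∩ surfaceFrontier X) (hzv : devExt D z + v ∈ closure A) :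
    sheetExt D U (devExt D z + v) ∈ surfaceFrontier X := by
  by_contra hcon
  have hw := frontier_subset_closure (h.map_mem_frontier hD hz.1)
  have hseg : ∀ t : ℝ, a + t • (devExt D z - a) + v =
      (a + v) + t • ((devExt D z + v) - (a + v)) := fun t => by module
  have hA : ∀ t : unitInterval, t < 1 → a + (t : ℝ) • (devExt D z - a) + v ∈ A := fun t ht => by
    rw [hseg]; exact h.segment_mem hD hav hzv ⟨t.2.1, ht⟩
  have hA' : ∀ t : unitInterval, a + (t : ℝ) • (devExt D z - a) + v ∈ closure A := fun t => by
    rcases eq_or_lt_of_le t.2.2 with h1 | h1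
    · rw [h1]; simpa using hzv
    · exact subset_closure (hA t h1)
  have hex : ∀ t : unitInterval, ∃ x : X,
      (x : Completion X) = sheetExt D U (a + (t : ℝ) • (devExt D z - a) + v) := fun t => by
    rcases eq_or_lt_of_le t.2.2 with h1 | h1
    · rw [h1]
      obtain ⟨x, hx⟩ := exists_coe_of_notMem_surfaceFrontier hcon
      exact ⟨x, by simpa using hx⟩
    · exact ⟨_, (h.ext_eq_section hD (hA t h1)).symm⟩
  choose g hg using hex
  have hgc : Continuous g := by
    rw [isOpenEmbedding_coe_completion.isInducing.continuous_iff]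
    refine ((h.continuousOn_ext hD).comp_continuous (by fun_prop) hA').congr fun t => (hg t).symm
  refine h.false_of_extension hD hp hz ha ⟨fun t => p (g t), hp.continuous.comp hgc⟩ fun t ht => ?_
  have h1 : g t = sheetSection D U (a + (t : ℝ) • (devExt D z - a) + v) := by
    refine Completion.coe_injective X ?_
    rw [hg, h.ext_eq_section hD (hA t ht)]
  rw [hv _ (h.segment_mem hD ha hw ⟨t.2.1, ht⟩) (hA t ht), ← h1]
  rfl

end Covering

/-! ### Strips and periodicity of their frontier points. -/

section Strip

/-- The conic `S² - 1`, which is negative on the strip `-1 < S < 1`. -/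
def Conic.strip (S : AffForm) : Conic := (S.mul S).perturb (-1) ⟨0, 0, 0, 0, 0, 1⟩

theorem Conic.eval_strip (S : AffForm) (w : Plane) : (Conic.strip S).eval w = S.eval w ^ 2 - 1 := by
  rw [Conic.strip, Conic.eval_perturb, Conic.eval_mul]
  simp [Conic.eval]; ring

theorem Conic.lead_strip (S : AffForm) (v : Plane) : (Conic.strip S).lead v = S.lin v ^ 2 := by
  rw [Conic.strip, Conic.lead_perturb, Conic.lead_mul]
  simp [Conic.lead]; ring

theorem Conic.lead_strip_nonneg (S : AffForm) (v : Plane) : 0 ≤ (Conic.strip S).lead v := by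
  rw [Conic.lead_strip]; positivity

/-- `S` and `T` are affine coordinates on the plane. -/
def AffForm.IsCoord (S T : AffForm) : Prop := S.p * T.q - S.q * T.p ≠ 0

namespace AffForm

variable {S T : AffForm}

/-- The point with affine coordinates `s` and `t`. -/
def point (S T : AffForm) (s t : ℝ) : Plane :=
  !₂[(S.p * T.q - S.q * T.p)⁻¹ * ((s - S.c) * T.q - S.q * (t - T.c)),
    (S.p * T.q - S.q * T.p)⁻¹ * (S.p * (t - T.c) - (s - S.c) * T.p)]

theorem IsCoord.eval_point_left (h : IsCoord S T) (s t : ℝ) : S.eval (point S T s t) = s := by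
  simp only [point, eval, PiLp.toLp_apply, Matrix.cons_val_zero, Matrix.cons_val_one]
  linear_combination (s - S.c) * inv_mul_cancel₀ h

theorem IsCoord.eval_point_right (h : IsCoord S T) (s t : ℝ) : T.eval (point S T s t) = t := by
  simp only [point, eval, PiLp.toLp_apply, Matrix.cons_val_zero, Matrix.cons_val_one]
  linear_combination (t - T.c) * inv_mul_cancel₀ h

theorem IsCoord.exists_eval (h : IsCoord S T) (s t : ℝ) :
    ∃ w : Plane, S.eval w = s ∧ T.eval w = t :=
  ⟨point S T s t, h.eval_point_left s t, h.eval_point_right s t⟩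

theorem IsCoord.eq_zero (h : IsCoord S T) {v : Plane} (hs : S.lin v = 0) (ht : T.lin v = 0) :
    v = 0 := by
  have h' : S.p * T.q - S.q * T.p ≠ 0 := h
  have h0 : (S.p * T.q - S.q * T.p) * v 0 = 0 := by
    simp only [lin] at hs ht; linear_combination T.q * hs - S.q * ht
  have h1 : (S.p * T.q - S.q * T.p) * v 1 = 0 := by
    simp only [lin] at hs ht; linear_combination S.p * ht - T.p * hs
  ext i; fin_cases i
  · simpa using (mul_eq_zero.1 h0).resolve_left h'
  · simpa using (mul_eq_zero.1 h1).resolve_left h'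

theorem IsCoord.eq (h : IsCoord S T) {w w' : Plane} (hs : S.eval w = S.eval w')
    (ht : T.eval w = T.eval w') : w = w' := by
  refine sub_eq_zero.1 (h.eq_zero ?_ ?_)
  · rw [lin_sub, hs, sub_self]
  · rw [lin_sub, ht, sub_self]

theorem abs_lin_le (S : AffForm) (v : Plane) : |S.lin v| ≤ (|S.p| + |S.q|) * ‖v‖ := by
  have h0 : |v 0| ≤ ‖v‖ := PiLp.norm_apply_le v 0
  have h1 : |v 1| ≤ ‖v‖ := PiLp.norm_apply_le v 1
  calc |S.lin v| ≤ |S.p * v 0| + |S.q * v 1| := abs_add_le _ _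
    _ = |S.p| * |v 0| + |S.q| * |v 1| := by rw [abs_mul, abs_mul]
    _ ≤ |S.p| * ‖v‖ + |S.q| * ‖v‖ := by gcongr
    _ = _ := by ring

end AffForm

variable {X Y : Type*} [MetricSpace X] [ChartedSpace Plane X] [TranslationSurface X] [Nonempty X]
  [MetricSpace Y] [ChartedSpace Plane Y] [TranslationSurface Y] {p : X → Y} {D : X → Plane}
  {U : Set X} {S T : AffForm}

theorem IsSheet.mem_bdry_strip (hD : IsDevelopingMap D)
    (h : IsSheet D U {w | (Conic.strip S).eval w < 0}) (hU : U.Nonempty) {z : Completion X}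
    (hz : z ∈ bdry U) : S.eval (devExt D z) = 1 ∨ S.eval (devExt D z) = -1 := by
  obtain ⟨x, hx⟩ := hU
  have h1 := h.map_mem_frontier hD hz
  rw [Conic.frontier_lt _ (Conic.lead_strip_nonneg S) (h.bijOn.mapsTo hx)] at h1
  have h2 : (Conic.strip S).eval (devExt D z) = 0 := h1
  rw [Conic.eval_strip, sub_eq_zero] at h2
  exact sq_eq_one_iff.1 h2

/-- The frontier points on the boundary of a strip are invariant under a translation. -/
theorem IsSheet.exists_period (hD : IsDevelopingMap D)
    (h : IsSheet D U {w | (Conic.strip S).eval w < 0}) (hST : S.IsCoord T)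
    (hp : IsCoveringMap p) (hpt : IsTranslationMap p) (hY : TotallyBounded (univ : Set Y))
    (h₁ : ∃ z ∈ bdry U ∩ surfaceFrontier X, S.eval (devExt D z) = 1)
    (h₂ : ∃ z ∈ bdry U ∩ surfaceFrontier X, S.eval (devExt D z) = -1) :
    ∃ v : Plane, S.lin v = 0 ∧ 0 < T.lin v ∧ ∀ z ∈ bdry U ∩ surfaceFrontier X,
      (∃ z' ∈ bdry U ∩ surfaceFrontier X, devExt D z' = devExt D z + v) ∧
      ∃ z' ∈ bdry U ∩ surfaceFrontier X, devExt D z' = devExt D z - v := by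
  set A : Set Plane := {w | (Conic.strip S).eval w < 0} with hAdef
  have hmem : ∀ w, w ∈ A ↔ S.eval w ^ 2 < 1 := fun w => by
    change (Conic.strip S).eval w < 0 ↔ _
    rw [Conic.eval_strip, sub_neg]
  have hAo : IsOpen A := Conic.isOpen_lt _
  choose c hcS hcT using fun n : ℕ => hST.exists_eval 0 (n : ℝ)
  have hcA : ∀ n, c n ∈ A := fun n => by rw [hmem, hcS]; norm_num
  have hcl : closure A = {w | (Conic.strip S).eval w ≤ 0} :=
    Conic.closure_lt _ (Conic.lead_strip_nonneg S) (hcA 0)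
  -- The `δ`-balls about the points `c n` of the midline lie in the strip, and in them `T` is within
  -- `1 / 2` of `n`.
  obtain ⟨δ, hδ, hδS, hδT⟩ : ∃ δ : ℝ, 0 < δ ∧ (|S.p| + |S.q|) * δ ≤ 1 ∧
      (|T.p| + |T.q|) * δ ≤ 1 / 2 := by
    refine ⟨1 / (2 * (|S.p| + |S.q| + |T.p| + |T.q| + 1)), by positivity, ?_, ?_⟩ <;>
    · rw [mul_one_div, div_le_iff₀ (by positivity)]
      linarith [abs_nonneg S.p, abs_nonneg S.q, abs_nonneg T.p, abs_nonneg T.q]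
  have hball : ∀ n, ∀ w ∈ Metric.ball (c n) δ, |S.eval w| < 1 ∧ |T.eval w - n| < 1 / 2 := by
    intro n w hw
    rw [Metric.mem_ball, dist_eq_norm] at hw
    have e1 := S.abs_lin_le (w - c n)
    have e2 := T.abs_lin_le (w - c n)
    rw [AffForm.lin_sub, hcS, sub_zero] at e1
    rw [AffForm.lin_sub, hcT] at e2
    have hlt : ∀ {k e ε : ℝ}, 0 ≤ k → 0 < ε → e ≤ k * ‖w - c n‖ → k * δ ≤ ε → e < ε := by
      intro k e ε hk hε h1 h2
      rcases hk.eq_or_lt with rfl | hk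
      · linarith
      · nlinarith
    exact ⟨hlt (by positivity) one_pos e1 hδS, hlt (by positivity) (by norm_num) e2 hδT⟩
  -- Pigeonhole on a finite `δ / 2`-net of `Y`.
  obtain ⟨n, m, hnm, hclose⟩ : ∃ n m : ℕ, n < m ∧
      dist (p (sheetSection D U (c n))) (p (sheetSection D U (c m))) < δ := by
    obtain ⟨t, ht, hcov⟩ := Metric.totallyBounded_iff.1 hY (δ / 2) (by positivity)
    have hex : ∀ k : ℕ, ∃ y : t, dist (p (sheetSection D U (c k))) y < δ / 2 := fun k => by
      obtain ⟨y, hy, hky⟩ := mem_iUnion₂.1 (hcov (mem_univ (p (sheetSection D U (c k)))))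
      exact ⟨⟨y, hy⟩, hky⟩
    choose f hf using hex
    have : Finite t := ht
    obtain ⟨k, l, hkl, hfkl⟩ := Finite.exists_ne_map_eq_of_infinite f
    have hd : dist (p (sheetSection D U (c k))) (p (sheetSection D U (c l))) < δ := by
      have := dist_triangle_right (p (sheetSection D U (c k))) (p (sheetSection D U (c l))) (f k)
      have h3 := hf k
      have h4 := hf l
      rw [← hfkl] at h4
      linarith
    rcases lt_or_gt_of_ne hkl with hlt | hlt
    · exact ⟨k, l, hlt, hd⟩
    · exact ⟨l, k, hlt, by rwa [dist_comm]⟩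
  have hballA : Metric.ball (c n) δ ⊆ A := fun w hw => by
    rw [hmem, sq_lt_one_iff_abs_lt_one]; exact (hball n w hw).1
  obtain ⟨b, hb, hbeq⟩ := h.exists_mem_ball_of_edist_lt hD hp hpt hballA
    (y := p (sheetSection D U (c m))) (hcA n) (by
      rw [edist_dist, ENNReal.ofReal_lt_ofReal_iff hδ]; exact hclose)
  obtain ⟨hbS, hbT⟩ := hball n b hb
  have hbA := hballA hb
  set v := c m - b with hv
  have hbv : b + v = c m := by rw [hv]; abel
  have hvS : S.lin v = -S.eval b := by rw [hv, AffForm.lin_sub, hcS, zero_sub]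
  have hvT : 0 < T.lin v := by
    rw [hv, AffForm.lin_sub, hcT]
    have : (n : ℝ) + 1 ≤ m := by exact_mod_cast hnm
    linarith [(abs_lt.1 hbT).2]
  have hCo : IsOpen (A ∩ {w | w + v ∈ A}) := hAo.inter (hAo.preimage (by fun_prop))
  have hCc : Convex ℝ (A ∩ {w | w + v ∈ A}) :=
    h.convex.inter (h.convex.translate_preimage_left v)
  have hT₁ := h.isLocalTranslation hD hpt
  -- Both maps are local translations and agree at `b`, so the projection of the strip is invariant
  -- under `v` wherever both sides are defined.
  have heq : EqOn (fun w => p (sheetSection D U w)) (fun w => p (sheetSection D U (w + v)))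
      (A ∩ {w | w + v ∈ A}) := by
    refine IsLocalTranslation.eqOn hCo hCc.isPreconnected (fun w hw => hT₁ w hw.1) ?_ ?_ ?_
      (a := b) ⟨hbA, show b + v ∈ A by rw [hbv]; exact hcA m⟩ ?_
    · intro w hw e he hwe
      obtain ⟨u, hu⟩ := hT₁ (w + v) hw.2 e he hwe
      refine ⟨v + u, ?_⟩
      have : Tendsto (fun w' : Plane => w' + v) (𝓝 w) (𝓝 (w + v)) :=
        (by fun_prop : Continuous fun w' : Plane => w' + v).tendsto w
      filter_upwards [this.eventually hu] with w' hw'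
      rw [hw', add_assoc]
    · exact hp.continuous.comp_continuousOn ((h.continuousOn_section hD).mono inter_subset_left)
    · exact hp.continuous.comp_continuousOn
        ((h.continuousOn_section hD).comp (by fun_prop) fun w hw => hw.2)
    · rw [hbeq, hbv]
  have hplus : ∀ w ∈ A, w + v ∈ A → p (sheetSection D U w) = p (sheetSection D U (w + v)) :=
    fun w hw hwv => heq ⟨hw, hwv⟩
  have hno : ∀ z ∈ bdry U ∩ surfaceFrontier X, devExt D z + v ∉ A := by
    intro z hz hzv
    have := h.ext_add_mem_surfaceFrontier hD hp hplus hbA (hbv ▸ hcA m) hz (subset_closure hzv)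
    rw [h.ext_eq_section hD hzv] at this
    exact coe_notMem_surfaceFrontier _ this
  -- A transverse component of `v` would push a frontier point of one of the two lines into the
  -- strip. A frontier point on each line is needed to exclude both signs.
  have hS0 : S.lin v = 0 := by
    rw [abs_lt] at hbS
    rcases lt_trichotomy (S.lin v) 0 with hneg | h0 | hpos
    · obtain ⟨z, hz, hzS⟩ := h₁
      refine (hno z hz ?_).elim
      rw [hmem, AffForm.eval_add, hzS]
      nlinarith
    · exact h0
    · obtain ⟨z, hz, hzS⟩ := h₂
      refine (hno z hz ?_).elim
      rw [hmem, AffForm.eval_add, hzS]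
      nlinarith
  have hfr : ∀ z ∈ bdry U, ∀ u : Plane, S.lin u = 0 → devExt D z + u ∈ frontier A := by
    intro z hz u hu
    have h1 := h.map_mem_frontier hD hz
    rw [Conic.frontier_lt _ (Conic.lead_strip_nonneg S) (hcA 0)] at h1 ⊢
    change (Conic.strip S).eval _ = 0
    have h2 : (Conic.strip S).eval (devExt D z) = 0 := h1
    rwa [Conic.eval_strip, AffForm.eval_add, hu, add_zero, ← Conic.eval_strip]
  refine ⟨v, hS0, hvT, fun z hz => ⟨⟨sheetExt D U (devExt D z + v), ⟨?_, ?_⟩, ?_⟩,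
    ⟨sheetExt D U (devExt D z + -v), ⟨?_, ?_⟩, ?_⟩⟩⟩
  · exact h.ext_mem_bdry hD (hfr z hz.1 v hS0)
  · exact h.ext_add_mem_surfaceFrontier hD hp hplus hbA (hbv ▸ hcA m) hz
      (frontier_subset_closure (hfr z hz.1 v hS0))
  · exact h.map_ext hD (frontier_subset_closure (hfr z hz.1 v hS0))
  · exact h.ext_mem_bdry hD (hfr z hz.1 (-v) (by simp only [AffForm.lin] at hS0 ⊢; simp; linarith))
  · refine h.ext_add_mem_surfaceFrontier hD hp (fun w hw hwv => ?_) (hcA m) (a := c m) ?_ hz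
      (frontier_subset_closure (hfr z hz.1 (-v) (by
        simp only [AffForm.lin] at hS0 ⊢; simp; linarith)))
    · have := hplus (w + -v) hwv (by simpa using hw)
      rw [this]; simp
    · rw [← hbv]; simpa using hbA
  · rw [sub_eq_add_neg]
    exact h.map_ext hD (frontier_subset_closure (hfr z hz.1 (-v) (by
      simp only [AffForm.lin] at hS0 ⊢; simp; linarith)))

theorem IsSheet.exists_gt_of_strip (hD : IsDevelopingMap D)
    (h : IsSheet D U {w | (Conic.strip S).eval w < 0}) (hST : S.IsCoord T)
    (hp : IsCoveringMap p) (hpt : IsTranslationMap p) (hY : TotallyBounded (univ : Set Y))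
    (h₁ : ∃ z ∈ bdry U ∩ surfaceFrontier X, S.eval (devExt D z) = 1)
    (h₂ : ∃ z ∈ bdry U ∩ surfaceFrontier X, S.eval (devExt D z) = -1)
    {z : Completion X} (hz : z ∈ bdry U ∩ surfaceFrontier X) (M : ℝ) :
    (∃ z' ∈ bdry U ∩ surfaceFrontier X,
      S.eval (devExt D z') = S.eval (devExt D z) ∧ M < T.eval (devExt D z')) ∧
    ∃ z' ∈ bdry U ∩ surfaceFrontier X,
      S.eval (devExt D z') = S.eval (devExt D z) ∧ T.eval (devExt D z') < M := by
  obtain ⟨v, hvS, hvT, hper⟩ := h.exists_period hD hST hp hpt hY h₁ h₂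
  have key : ∀ k : ℕ, (∃ z' ∈ bdry U ∩ surfaceFrontier X, S.eval (devExt D z') =
      S.eval (devExt D z) ∧ T.eval (devExt D z') = T.eval (devExt D z) + k * T.lin v) ∧
      ∃ z' ∈ bdry U ∩ surfaceFrontier X, S.eval (devExt D z') =
      S.eval (devExt D z) ∧ T.eval (devExt D z') = T.eval (devExt D z) - k * T.lin v := by
    intro k
    induction k with
    | zero => exact ⟨⟨z, hz, rfl, by simp⟩, ⟨z, hz, rfl, by simp⟩⟩
    | succ k ih =>
      obtain ⟨⟨z₁, hz₁, hS₁, hT₁⟩, ⟨z₂, hz₂, hS₂, hT₂⟩⟩ := ih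
      obtain ⟨z₃, hz₃, he₃⟩ := (hper z₁ hz₁).1
      obtain ⟨z₄, hz₄, he₄⟩ := (hper z₂ hz₂).2
      refine ⟨⟨z₃, hz₃, ?_, ?_⟩, ⟨z₄, hz₄, ?_, ?_⟩⟩
      · rw [he₃, AffForm.eval_add, hvS, add_zero, hS₁]
      · rw [he₃, AffForm.eval_add, hT₁]; push_cast; ring
      · have := AffForm.lin_sub S (devExt D z₂) (devExt D z₂ - v)
        rw [sub_sub_cancel, hvS] at this
        rw [he₄]; linarith
      · have := AffForm.lin_sub T (devExt D z₂) (devExt D z₂ - v)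
        rw [sub_sub_cancel] at this
        rw [he₄]; push_cast; linarith
  constructor
  · obtain ⟨k, hk⟩ := exists_nat_gt ((M - T.eval (devExt D z)) / T.lin v)
    rw [div_lt_iff₀ hvT] at hk
    obtain ⟨z', hz', hS', hT'⟩ := (key k).1
    exact ⟨z', hz', hS', by linarith⟩
  · obtain ⟨k, hk⟩ := exists_nat_gt ((T.eval (devExt D z) - M) / T.lin v)
    rw [div_lt_iff₀ hvT] at hk
    obtain ⟨z', hz', hS', hT'⟩ := (key k).2
    exact ⟨z', hz', hS', by linarith⟩

end Strip

end

section

/-! ### Conics without large discs. -/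

section Classification

namespace Conic

/-- If the restriction of `F` to the lines of direction `v` tends to `-∞` uniformly, then `F` is
negative on arbitrarily large discs. -/
theorem exists_ball_subset {F : Conic} {v : Plane} (R : ℝ)
    (h : F.lead v < 0 ∨ F.lead v = 0 ∧ ∃ g ≠ 0, ∀ w, F.grad w v = g) :
    ∃ a, Metric.ball a R ⊆ {w | F.eval w < 0} := by
  have hK := isCompact_closedBall (0 : Plane) R
  obtain ⟨C₁, hC₁⟩ := hK.exists_bound_of_continuousOn F.continuous_eval.continuousOn
  have key : ∀ t : ℝ, (∀ u ∈ Metric.closedBall (0 : Plane) R,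
      C₁ + t * F.grad u v + t ^ 2 * F.lead v < 0) →
      ∃ a, Metric.ball a R ⊆ {w | F.eval w < 0} := by
    refine fun t ht => ⟨t • v, fun w hw => ?_⟩
    have hu : w - t • v ∈ Metric.closedBall (0 : Plane) R := by
      rw [mem_closedBall_zero_iff, ← dist_eq_norm]; exact (Metric.mem_ball.1 hw).le
    have h1 := F.eval_add_smul (w - t • v) v t
    rw [sub_add_cancel] at h1
    have h2 := (le_abs_self _).trans (hC₁ _ hu)
    change F.eval w < 0
    linarith [ht _ hu]
  rcases h with h | ⟨h, g, hg, hgrad⟩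
  · have hc : Continuous fun u => F.grad u v := by unfold grad; fun_prop
    obtain ⟨C₂, hC₂⟩ := hK.exists_bound_of_continuousOn hc.continuousOn
    have hlim : Tendsto (fun t : ℝ => t * (C₂ + t * F.lead v) + C₁) atTop atBot := by
      refine tendsto_atBot_add_const_right _ _ (Tendsto.atTop_mul_atBot₀ tendsto_id ?_)
      exact tendsto_atBot_add_const_left _ _ (tendsto_id.atTop_mul_const_of_neg h)
    obtain ⟨t, ht, ht0⟩ := ((hlim.eventually_lt_atBot 0).and (eventually_ge_atTop 0)).exists
    refine key t fun u hu => ?_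
    have h3 := mul_le_mul_of_nonneg_left ((le_abs_self _).trans (hC₂ u hu)) ht0
    nlinarith
  · refine key (-(|C₁| + 1) / g) fun u hu => ?_
    rw [h, hgrad, div_mul_cancel₀ _ hg]
    linarith [le_abs_self C₁]

theorem lead_smul_add (F : Conic) (r s : ℝ) (v w : Plane) :
    F.lead (r • v + s • w) = r ^ 2 * F.lead v +
      r * s * ((2 * F.a * v 0 + F.b * v 1) * w 0 + (F.b * v 0 + 2 * F.c * v 1) * w 1) +
      s ^ 2 * F.lead w := by
  simp [lead]; ring

theorem polar_eq_zero {F : Conic} (hF : ∀ v, 0 ≤ F.lead v) {v : Plane} (hv : F.lead v = 0)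
    (w : Plane) :
    (2 * F.a * v 0 + F.b * v 1) * w 0 + (F.b * v 0 + 2 * F.c * v 1) * w 1 = 0 := by
  by_contra hne
  set g := (2 * F.a * v 0 + F.b * v 1) * w 0 + (F.b * v 0 + 2 * F.c * v 1) * w 1 with hg
  -- Along `r • v + w` the form is affine in `r` with slope `g`; this `r` makes its value `-1`.
  have h1 := hF ((-(F.lead w + 1) / g) • v + (1 : ℝ) • w)
  rw [lead_smul_add, hv, ← hg] at h1
  have h2 : -(F.lead w + 1) / g * 1 * g = -(F.lead w + 1) := by field_simp
  linarith

theorem grad_eq_of_lead_eq_zero {F : Conic} (hF : ∀ v, 0 ≤ F.lead v) {v : Plane}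
    (hv : F.lead v = 0) (w : Plane) : F.grad w v = F.grad 0 v := by
  have := polar_eq_zero hF hv w
  simp only [grad, PiLp.zero_apply]
  linear_combination this

theorem eval_eq_of_kernel {F : Conic} (hF : ∀ v, 0 ≤ F.lead v) {v : Plane}
    (hv : F.lead v = 0) (hg : F.grad 0 v = 0) (w : Plane) (t : ℝ) :
    F.eval (w + t • v) = F.eval w := by
  rw [eval_add_smul, hv, grad_eq_of_lead_eq_zero hF hv, hg]; ring

/-- A conic which is negative somewhere, but not on large discs, bounds an ellipse or a strip. -/
theorem isElliptic_or_strip (F : Conic) {o : Plane} (ho : F.eval o < 0) {R : ℝ}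
    (hR : ∀ a, ¬ Metric.ball a R ⊆ {w | F.eval w < 0}) :
    F.IsElliptic ∨ ∃ S T : AffForm, S.IsCoord T ∧
      {w | F.eval w < 0} = {w | (Conic.strip S).eval w < 0} := by
  by_contra! hcon
  obtain ⟨hell, hstrip⟩ := hcon
  have hF : ∀ v, 0 ≤ F.lead v := fun v => by
    by_contra! hv
    obtain ⟨a, ha⟩ := F.exists_ball_subset R (Or.inl hv)
    exact hR a ha
  have hgrad : ∀ v, F.lead v = 0 → F.grad 0 v = 0 := fun v hv => by
    by_contra hg
    obtain ⟨a, ha⟩ := F.exists_ball_subset R (Or.inr ⟨hv, _, hg, grad_eq_of_lead_eq_zero hF hv⟩)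
    exact hR a ha
  -- The form is semidefinite but not definite. The gradient also vanishes along its null direction
  -- `v`, so `F` depends only on the coordinate along the normal `n`.
  obtain ⟨v, hv0, hv⟩ : ∃ v : Plane, v ≠ 0 ∧ F.lead v = 0 := by
    by_contra! h
    exact hell (IsElliptic.of_lead_pos fun v hv => (hF v).lt_of_ne' (h v hv))
  have hN : 0 < v 0 ^ 2 + v 1 ^ 2 := by
    rcases eq_or_ne (v 0) 0 with h0 | h0
    · have h1 : v 1 ≠ 0 := fun h1 => hv0 (by ext i; fin_cases i <;> simp [h0, h1])
      positivity
    · positivity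
  set N := v 0 ^ 2 + v 1 ^ 2 with hNdef
  set n : Plane := !₂[-v 1, v 0] with hn
  have hn0 : n 0 = -v 1 := rfl
  have hn1 : n 1 = v 0 := rfl
  have hdec : ∀ w : Plane, w = ((-v 1 * w 0 + v 0 * w 1) / N) • n +
      ((v 0 * w 0 + v 1 * w 1) / N) • v := by
    intro w
    ext i; fin_cases i
    · simp [hn0]; field_simp; rw [hNdef]; ring
    · simp [hn1]; field_simp; rw [hNdef]; ring
  have hFw : ∀ w, F.eval w = F.f + (-v 1 * w 0 + v 0 * w 1) / N * F.grad 0 n +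
      ((-v 1 * w 0 + v 0 * w 1) / N) ^ 2 * F.lead n := by
    intro w
    conv_lhs => rw [hdec w]
    rw [eval_eq_of_kernel hF hv (hgrad v hv), ← zero_add (_ • n), eval_add_smul]
    simp [eval]
  rcases (hF n).eq_or_lt with hl | hl
  · rw [← hl, hgrad n hl.symm] at hFw
    refine hR 0 fun w _ => ?_
    change F.eval w < 0
    rw [hFw]
    rw [hFw] at ho
    linarith
  · set L := F.lead n
    set g := F.grad 0 n
    -- Completing the square. The factor `√(L / δ)` then normalizes the strip to `-1 < S < 1`.
    have hsq : ∀ w, F.eval w =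
        L * ((-v 1 * w 0 + v 0 * w 1) / N + g / (2 * L)) ^ 2 - (g ^ 2 / (4 * L) - F.f) := by
      intro w; rw [hFw]; field_simp; ring
    set δ := g ^ 2 / (4 * L) - F.f
    have hδ : 0 < δ := by
      rw [hsq] at ho
      nlinarith [mul_nonneg hl.le (sq_nonneg ((-v 1 * o 0 + v 0 * o 1) / N + g / (2 * L)))]
    have hk : 0 < √(L / δ) := Real.sqrt_pos.2 (by positivity)
    have hk2 : √(L / δ) ^ 2 = L / δ := Real.sq_sqrt (by positivity)
    set k := √(L / δ)
    refine hstrip ⟨k * (g / (2 * L)), k * (-v 1 / N), k * (v 0 / N)⟩ ⟨0, v 0, v 1⟩ ?_ ?_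
    · have : k * (-v 1 / N) * v 1 - k * (v 0 / N) * v 0 = -k * (N / N) := by rw [hNdef]; ring
      rw [AffForm.IsCoord, this, div_self hN.ne']
      linarith
    · ext w
      change F.eval w < 0 ↔ (Conic.strip _).eval w < 0
      have : F.eval w = δ * (Conic.strip ⟨k * (g / (2 * L)), k * (-v 1 / N), k * (v 0 / N)⟩).eval w := by
        rw [hsq, eval_strip]
        simp only [AffForm.eval]
        have h3 : (k * (g / (2 * L)) + k * (-v 1 / N) * w 0 + k * (v 0 / N) * w 1) ^ 2 =
          k ^ 2 * ((-v 1 * w 0 + v 0 * w 1) / N + g / (2 * L)) ^ 2 := by ring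
        rw [h3, hk2]
        field_simp
      rw [this, mul_neg_iff]
      constructor
      · rintro (h | h)
        · exact h.2
        · linarith [h.1]
      · exact fun h => Or.inl ⟨hδ, h⟩

end Conic

end Classification

/-! ### Perturbations with bounded excess. -/

section Admissible

namespace Conic

/-- The conics `F + ε G`, for small positive `ε`, are elliptic and their interiors are bounded
outside the interior of `F`. -/
def IsAdmissible (F G : Conic) : Prop :=
  ∃ R, ∃ ε₀ > 0, ∀ ε, 0 < ε → ε ≤ ε₀ → (F.perturb ε G).IsElliptic ∧
    ∀ x, 0 ≤ F.eval x → (F.perturb ε G).eval x ≤ 0 → ‖x‖ ≤ R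

theorem IsElliptic.isAdmissible {F : Conic} (hF : F.IsElliptic) (G : Conic) :
    F.IsAdmissible G := by
  obtain ⟨R, ε₀, hε₀, hR⟩ := hF.exists_bound_perturb G
  have h1 : ∀ᶠ ε in 𝓝 (0 : ℝ), 0 < (F.perturb ε G).a := by
    have : Continuous fun ε => (F.perturb ε G).a := by unfold perturb; fun_prop
    refine this.continuousAt.eventually_const_lt ?_
    simpa [perturb] using hF.1
  have h2 : ∀ᶠ ε in 𝓝 (0 : ℝ), (F.perturb ε G).b ^ 2 <
      4 * (F.perturb ε G).a * (F.perturb ε G).c := by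
    have h3 : Continuous fun ε => (F.perturb ε G).b ^ 2 := by unfold perturb; fun_prop
    have h4 : Continuous fun ε => 4 * (F.perturb ε G).a * (F.perturb ε G).c := by
      unfold perturb; fun_prop
    refine h3.continuousAt.eventually_lt h4.continuousAt ?_
    simpa [perturb] using hF.2
  obtain ⟨r, hr, hball⟩ := Metric.eventually_nhds_iff.1 (h1.and h2)
  refine ⟨R, min ε₀ (r / 2), by positivity, fun ε hε hε' => ⟨?_, fun x _ hx => ?_⟩⟩
  · refine hball ?_
    rw [Real.dist_eq, sub_zero, abs_of_pos hε]
    linarith [hε'.trans (min_le_right _ _)]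
  · exact hR ε hε.le (hε'.trans (min_le_left _ _)) x hx

end Conic

/-- The affine function `T - (α + β S)`. -/
def AffForm.graph (S T : AffForm) (α β : ℝ) : AffForm :=
  ⟨T.c - α - β * S.c, T.p - β * S.p, T.q - β * S.q⟩

theorem AffForm.eval_graph (S T : AffForm) (α β : ℝ) (w : Plane) :
    (AffForm.graph S T α β).eval w = T.eval w - (α + β * S.eval w) := by
  simp only [graph, eval]; ring

theorem AffForm.lin_graph (S T : AffForm) (α β : ℝ) (v : Plane) :
    (AffForm.graph S T α β).lin v = T.lin v - β * S.lin v := by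
  simp only [graph, lin]; ring

theorem AffForm.IsCoord.exists_norm_le {S T : AffForm} (h : S.IsCoord T) (a b : ℝ) :
    ∃ R, ∀ w, |S.eval w| ≤ a → |T.eval w| ≤ b → ‖w‖ ≤ R := by
  have hc : Continuous fun x : ℝ × ℝ => point S T x.1 x.2 := by
    unfold point; fun_prop
  have hK : IsCompact (Icc (-a) a ×ˢ Icc (-b) b) := isCompact_Icc.prod isCompact_Icc
  obtain ⟨R, hR⟩ := hK.exists_bound_of_continuousOn hc.continuousOn
  refine ⟨R, fun w hS hT => ?_⟩
  have := hR (S.eval w, T.eval w) ⟨abs_le.1 hS, abs_le.1 hT⟩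
  rwa [h.eq (h.eval_point_left _ _) (h.eval_point_right _ _)] at this

theorem Conic.isAdmissible_strip {S T : AffForm} (h : S.IsCoord T) (α₁ β₁ α₂ β₂ : ℝ) :
    (Conic.strip S).IsAdmissible
      ((AffForm.graph S T α₁ β₁).mul (AffForm.graph S T α₂ β₂)) := by
  -- With means and half-differences of the coefficients, the product of the two lines becomes `(T -
  -- A' - B' S) ^ 2 - (A + B S) ^ 2`.
  obtain ⟨A, A', rfl, rfl⟩ : ∃ A A', α₁ = A' - A ∧ α₂ = A' + A :=
    ⟨(α₂ - α₁) / 2, (α₂ + α₁) / 2, by ring, by ring⟩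
  obtain ⟨B, B', rfl, rfl⟩ : ∃ B B', β₁ = B' - B ∧ β₂ = B' + B :=
    ⟨(β₂ - β₁) / 2, (β₂ + β₁) / 2, by ring, by ring⟩
  obtain ⟨R, hR⟩ := h.exists_norm_le 2 (|A| + 2 * |B| + |A'| + 2 * |B'|)
  -- This bound gives `ε B ^ 2 < 1`, hence ellipticity. Outside the strip it gives `ε (A + B S) ^ 2
  -- ≤ S ^ 2 / 2`, which bounds `S` and then `T`.
  refine ⟨R, 1 / (4 * (A ^ 2 + B ^ 2 + 1)), by positivity, fun ε hε hε' => ?_⟩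
  rw [le_div_iff₀ (by positivity)] at hε'
  refine ⟨IsElliptic.of_lead_pos fun v hv => ?_, fun x h0 hx => ?_⟩
  · rw [lead_perturb, lead_strip, lead_mul, AffForm.lin_graph, AffForm.lin_graph]
    have h1 : S.lin v ^ 2 + ε * ((T.lin v - (B' - B) * S.lin v) * (T.lin v - (B' + B) * S.lin v)) =
      (1 - ε * B ^ 2) * S.lin v ^ 2 + ε * (T.lin v - B' * S.lin v) ^ 2 := by ring
    have h2 : 0 < 1 - ε * B ^ 2 := by nlinarith [mul_nonneg hε.le (sq_nonneg A)]
    rw [h1]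
    by_cases hs : S.lin v = 0
    · have ht : T.lin v ≠ 0 := fun ht => hv (h.eq_zero hs ht)
      rw [hs]
      have : 0 < ε * (T.lin v - B' * 0) ^ 2 := by rw [mul_zero, sub_zero]; positivity
      linarith
    · positivity
  · rw [eval_strip] at h0
    rw [eval_perturb, eval_strip, eval_mul, AffForm.eval_graph, AffForm.eval_graph] at hx
    set s := S.eval x
    set t := T.eval x
    have h1 : s ^ 2 - 1 + ε * ((t - A' - B' * s) ^ 2 - (A + B * s) ^ 2) ≤ 0 := by
      convert hx using 2; ring
    have h2 : (t - A' - B' * s) ^ 2 ≤ (A + B * s) ^ 2 := by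
      by_contra! hcon
      nlinarith [mul_pos hε (sub_pos.2 hcon)]
    have h3 : (A + B * s) ^ 2 ≤ 2 * (A ^ 2 + B ^ 2) * s ^ 2 := by
      nlinarith [sq_nonneg (A - B * s), mul_nonneg (sq_nonneg A) h0]
    have h4 : ε * (A + B * s) ^ 2 ≤ s ^ 2 / 2 := by
      have := mul_le_mul_of_nonneg_left h3 hε.le
      nlinarith [mul_nonneg hε.le (sq_nonneg s)]
    have h5 : s ^ 2 ≤ 2 ^ 2 := by nlinarith [mul_nonneg hε.le (sq_nonneg (t - A' - B' * s))]
    have h6 : |s| ≤ 2 := abs_le_of_sq_le_sq h5 (by norm_num)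
    refine hR x h6 ?_
    have h7 := sq_le_sq.1 h2
    have h8 : |A + B * s| ≤ |A| + 2 * |B| := by
      refine (abs_add_le _ _).trans ?_
      rw [abs_mul]; nlinarith [abs_nonneg B]
    have h9 : |A' + B' * s| ≤ |A'| + 2 * |B'| := by
      refine (abs_add_le _ _).trans ?_
      rw [abs_mul]; nlinarith [abs_nonneg B']
    have h10 := abs_add_le (t - A' - B' * s) (A' + B' * s)
    have h11 : t - A' - B' * s + (A' + B' * s) = t := by ring
    rw [h11] at h10
    linarith

end Admissible

end

section

/-! ### Subconics cut out by perturbed conics. -/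

section Subconic

variable {X : Type*} [MetricSpace X] [ChartedSpace Plane X] [TranslationSurface X] [Nonempty X]
  {D : X → Plane} {U V : Set X} {A B : Set Plane} {F G : Conic} {S T : AffForm}
  {x y : Completion X} {Z Z' : Set (Completion X)}

namespace IsSheet

theorem injOn_devExt (hD : IsDevelopingMap D) (h : IsSheet D U A) : InjOn (devExt D) (bdry U) :=
  fun z hz z' hz' heq => by
    rw [← h.ext_map_of_mem_bdry hD hz, heq, h.ext_map_of_mem_bdry hD hz']

theorem eval_eq_zero (hD : IsDevelopingMap D) (h : IsSheet D U {w | F.eval w < 0})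
    (hF : ∀ v, 0 ≤ F.lead v) (hU : U.Nonempty) {z : Completion X} (hz : z ∈ bdry U) :
    F.eval (devExt D z) = 0 := by
  obtain ⟨o, ho⟩ := hU
  have := h.map_mem_frontier hD hz
  rwa [F.frontier_lt hF (h.bijOn.mapsTo ho)] at this

theorem ext_mem_bdry_of_eval (hD : IsDevelopingMap D) (h : IsSheet D U {w | F.eval w < 0})
    (hF : ∀ v, 0 ≤ F.lead v) (hU : U.Nonempty) {w : Plane} (hw : F.eval w = 0) :
    sheetExt D U w ∈ bdry U ∧ devExt D (sheetExt D U w) = w := by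
  obtain ⟨o, ho⟩ := hU
  have : w ∈ frontier {w | F.eval w < 0} := by
    rw [F.frontier_lt hF (h.bijOn.mapsTo ho)]; exact hw
  exact ⟨h.ext_mem_bdry hD this, h.map_ext hD (frontier_subset_closure this)⟩

/-- The part of the boundary over a preconnected set of boundary values is preconnected. -/
theorem image_ext_subset (hD : IsDevelopingMap D) (h : IsSheet D U {w | F.eval w < 0})
    (hF : ∀ v, 0 ≤ F.lead v) (hU : U.Nonempty) {K : Set Plane} (hK : IsPreconnected K)
    (hKF : ∀ w ∈ K, F.eval w = 0) {C : Set (Completion X)} (hC : ∀ z ∈ C, devExt D z ∉ K)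
    {z : Completion X} (hz : z ∈ bdry U) (hzK : devExt D z ∈ K) {z' : Completion X}
    (hz' : z' ∈ bdry U) (hzK' : devExt D z' ∈ K) :
    z' ∈ connectedComponentIn (bdry U \ C) z := by
  have hK' : K ⊆ closure {w | F.eval w < 0} := by
    obtain ⟨o, ho⟩ := hU
    rw [F.closure_lt hF (h.bijOn.mapsTo ho)]
    exact fun w hw => (hKF w hw).le
  have h1 : sheetExt D U '' K ⊆ bdry U \ C := by
    rintro _ ⟨w, hw, rfl⟩
    obtain ⟨h2, h3⟩ := h.ext_mem_bdry_of_eval hD hF hU (hKF w hw)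
    exact ⟨h2, fun hc => hC _ hc (h3.symm ▸ hw)⟩
  refine (hK.image _ ((h.continuousOn_ext hD).mono hK')).subset_connectedComponentIn
    ⟨_, hzK, h.ext_map_of_mem_bdry hD hz⟩ h1 ⟨_, hzK', h.ext_map_of_mem_bdry hD hz'⟩

theorem meetsEachComponent_of_isElliptic (hD : IsDevelopingMap D)
    (h : IsSheet D U {w | F.eval w < 0}) (hF : F.IsElliptic) (hU : U.Nonempty)
    (hZ : Z ⊆ bdry U) (hne : Z.Nonempty) : MeetsEachComponent Z U := by
  intro z hz
  obtain ⟨z', hz'⟩ := hne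
  refine ⟨z', hz', ?_⟩
  obtain ⟨o, ho⟩ := hU
  have := h.image_ext_subset hD hF.lead_nonneg ⟨o, ho⟩
    (hF.isPreconnected_zero (h.bijOn.mapsTo ho)) (fun w hw => hw) (C := ∅) (fun z hz => hz.elim) hz
    (h.eval_eq_zero hD hF.lead_nonneg ⟨o, ho⟩ hz) (hZ hz')
    (h.eval_eq_zero hD hF.lead_nonneg ⟨o, ho⟩ (hZ hz'))
  rwa [Set.sdiff_empty] at this

theorem mem_subconicsOf (hD : IsDevelopingMap D) (h : IsSheet D U {w | F.eval w < 0})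
    (hZ : Z = bdry U ∩ surfaceFrontier X) (hm : MeetsEachComponent Z U) : U ∈ subconicsOf Z := by
  obtain ⟨q, hq⟩ := F.exists_quadraticForm_eq
  exact ⟨⟨h.isFlatConvex hD, D, hD, q, by rw [h.bijOn.image_eq, hq]⟩, hZ, hm⟩

/-- The frontier points on the boundary of a sheet that lie on a nonnegative conic are cut out by
a nearby ellipse. -/
theorem subconicsOf_nonempty (hX : DiscreteTopology (surfaceFrontier X)) (hD : IsDevelopingMap D)
    (h : IsSheet D U {w | F.eval w < 0}) (hF : ∀ v, 0 ≤ F.lead v) (hU : U.Nonempty)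
    (hFG : F.IsAdmissible G) (hZ : Z ⊆ bdry U ∩ surfaceFrontier X) (hne : Z.Nonempty)
    (hG : ∀ z ∈ Z, G.eval (devExt D z) = 0)
    (hG' : ∀ z ∈ bdry U ∩ surfaceFrontier X, z ∉ Z → 0 < G.eval (devExt D z)) :
    (subconicsOf Z).Nonempty := by
  obtain ⟨o, ho⟩ := hU
  have hoF : F.eval (D o) < 0 := h.bijOn.mapsTo ho
  obtain ⟨N, hN, hcl, hvis⟩ := h.exists_isOpen_isVisible hX hD ho
  rw [F.closure_lt hF hoF] at hcl
  obtain ⟨R, ε₀, hε₀, hR⟩ := hFG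
  obtain ⟨ε₁, hε₁, hε₁₀, hsub⟩ := Conic.exists_perturb_subset hN hcl hε₀
    fun ε hε hε' => (hR ε hε hε').2
  -- The first bound keeps the perturbed ellipse in the neighbourhood without new visible points;
  -- the second keeps the base point inside it.
  set ε := min ε₁ (-F.eval (D o) / (2 * (|G.eval (D o)| + 1)))
  have hε : 0 < ε := lt_min hε₁ (div_pos (by linarith) (by positivity))
  have hεo : ε * (2 * (|G.eval (D o)| + 1)) ≤ -F.eval (D o) := by
    rw [← le_div_iff₀ (by positivity)]; exact min_le_right _ _
  set H := F.perturb ε G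
  have hH : H.IsElliptic := (hR ε hε ((min_le_left _ _).trans hε₁₀)).1
  have hHe : ∀ w, H.eval w = F.eval w + ε * G.eval w := F.eval_perturb G ε
  have hHo : H.eval (D o) < 0 := by
    rw [hHe]
    nlinarith [mul_le_mul_of_nonneg_left (le_abs_self (G.eval (D o))) hε.le]
  -- At the frontier points of `∂U` the conic `F` vanishes, so the sign of `G` alone decides which
  -- of them stay on the boundary and which fall outside.
  have hHz : ∀ z ∈ bdry U ∩ surfaceFrontier X, H.eval (devExt D z) = ε * G.eval (devExt D z) :=
    fun z hz => by rw [hHe, h.eval_eq_zero hD hF ⟨o, ho⟩ hz.1, zero_add]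
  have hG0 : ∀ z ∈ bdry U ∩ surfaceFrontier X, 0 ≤ G.eval (devExt D z) := fun z hz => by
    by_cases hzZ : z ∈ Z
    · exact (hG z hzZ).ge
    · exact (hG' z hz hzZ).le
  obtain ⟨V, hV, hoV, hVZ⟩ := h.exists_isSheet_of_subset hD ho hvis H.isOpen_lt
    (H.convex_lt hH.lead_nonneg) hHo (by
      rw [H.closure_lt hH.lead_nonneg hHo]; exact hsub ε hε (min_le_left _ _))
    (fun z hz => by
      change ¬ H.eval _ < 0
      rw [hHz z hz, not_lt]
      exact mul_nonneg hε.le (hG0 z hz))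
  have hZV : Z = bdry V ∩ surfaceFrontier X := by
    rw [hVZ, H.closure_lt hH.lead_nonneg hHo]
    ext z
    constructor
    · refine fun hz => ⟨hZ hz, ?_⟩
      change H.eval _ ≤ 0
      rw [hHz z (hZ hz), hG z hz, mul_zero]
    · rintro ⟨hz, hz'⟩
      by_contra hzZ
      have hz'' : H.eval _ ≤ 0 := hz'
      rw [hHz z hz] at hz''
      linarith [mul_pos hε (hG' z hz hzZ)]
  exact ⟨V, hV.mem_subconicsOf hD hZV (hV.meetsEachComponent_of_isElliptic hD hH ⟨o, hoV⟩
    (hZV ▸ inter_subset_left) hne)⟩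

/-- The boundary extensions of two overlapping sheets agree. -/
theorem ext_eq_ext (hD : IsDevelopingMap D) (h : IsSheet D U A) (h' : IsSheet D V B)
    (hUV : (U ∩ V).Nonempty) {w : Plane} (hw : w ∈ closure A) (hw' : w ∈ closure B) :
    sheetExt D U w = sheetExt D V w := by
  obtain ⟨o, hoU, hoV⟩ := hUV
  have hseg : ∀ {C : Set Plane} {W : Set X}, IsSheet D W C → o ∈ W → w ∈ closure C →
      Tendsto (fun t : ℝ => sheetExt D W (D o + t • (w - D o))) (𝓝[Ico 0 1] 1)
        (𝓝 (sheetExt D W w)) := by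
    intro C W hW hoW hwC
    refine (hW.continuousOn_ext hD w hwC).tendsto.comp (tendsto_nhdsWithin_iff.2 ⟨?_, ?_⟩)
    · have := (by fun_prop : Continuous fun t : ℝ => D o + t • (w - D o)).tendsto 1
      simp only [one_smul, add_sub_cancel] at this
      exact this.mono_left nhdsWithin_le_nhds
    · filter_upwards [self_mem_nhdsWithin] with t ht
      exact subset_closure (hW.segment_mem hD (hW.bijOn.mapsTo hoW) hwC ht)
  have hne : (𝓝[Ico (0 : ℝ) 1] 1).NeBot := by
    rw [← mem_closure_iff_nhdsWithin_neBot, closure_Ico zero_ne_one]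
    exact right_mem_Icc.2 zero_le_one
  refine tendsto_nhds_unique (hseg h hoU hw) ((hseg h' hoV hw').congr' ?_)
  filter_upwards [self_mem_nhdsWithin] with t ht
  have h1 := h.segment_mem hD (h.bijOn.mapsTo hoU) hw ht
  have h2 := h'.segment_mem hD (h'.bijOn.mapsTo hoV) hw' ht
  rw [h.ext_eq_section hD h1, h'.ext_eq_section hD h2,
    h.eq_section_of_section hD h' ⟨o, hoU, hoV⟩ ⟨h1, h2⟩]

/-- Overlapping sheets have the same boundary extension where both are defined. If `G ≤ 0` at `z`,
then `z` would lie in the closure of `V`, and hence in `∂V`, being a frontier point. -/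
theorem eval_pos_of_overlap (hD : IsDevelopingMap D) (h : IsSheet D U A)
    (h' : IsSheet D V {w | G.eval w < 0}) (hG : ∀ v, 0 ≤ G.lead v) (hUV : (U ∩ V).Nonempty)
    {z : Completion X} (hz : z ∈ bdry U ∩ surfaceFrontier X) (hzV : z ∉ bdry V) :
    0 < G.eval (devExt D z) := by
  by_contra! hle
  have hw' : devExt D z ∈ closure {w | G.eval w < 0} := by
    obtain ⟨o, -, hoV⟩ := hUV
    rw [G.closure_lt hG (h'.bijOn.mapsTo hoV)]; exact hle
  have h1 := h.ext_eq_ext hD h' hUV (frontier_subset_closure (h.map_mem_frontier hD hz.1)) hw'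
  rw [h.ext_map_of_mem_bdry hD hz.1] at h1
  exact hzV (h'.mem_bdry_of_mem_surfaceFrontier (h1 ▸ h'.ext_mem hD hw') hz.2)

end IsSheet

/-! ### Adjacency and test functions. -/

section Adjacent

namespace IsSheet

/-- A component of `∂U ∖ {x, y}` that contains a point with `g < 0` cannot reach a frontier point,
where `g ≥ 0`, without crossing `g = 0`; that happens only at `x` and `y`. -/
theorem adjacent_of_pos (hD : IsDevelopingMap D) (h : IsSheet D U A)
    (hx : x ∈ bdry U ∩ surfaceFrontier X) (hy : y ∈ bdry U ∩ surfaceFrontier X) {g : Plane → ℝ}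
    (hg : Continuous g)
    (hg0 : ∀ w ∈ frontier A, g w = 0 → w = devExt D x ∨ w = devExt D y)
    (hgZ : ∀ z ∈ bdry U ∩ surfaceFrontier X, 0 ≤ g (devExt D z))
    (hgn : ∃ w ∈ frontier A, g w < 0) : Adjacent U x y := by
  obtain ⟨w, hw, hwn⟩ := hgn
  have hwb := h.ext_mem_bdry hD hw
  have hwm := h.map_ext hD (frontier_subset_closure hw)
  have hp : sheetExt D U w ∈ bdry U \ {x, y} := by
    refine ⟨hwb, ?_⟩
    rintro (he | he)
    · have := hgZ x hx; rw [← he, hwm] at this; linarith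
    · have := hgZ y hy; rw [← he, hwm] at this; linarith
  refine ⟨hx, hy, _, hp, Set.disjoint_left.2 fun z hz hzX => ?_⟩
  have hC := connectedComponentIn_subset (bdry U \ {x, y}) (sheetExt D U w)
  have hzb := hC hz
  obtain ⟨z', hz', hz0⟩ := isPreconnected_connectedComponentIn.intermediate_value
    (mem_connectedComponentIn hp) hz (hg.comp (continuous_devExt hD)).continuousOn
    (show (0 : ℝ) ∈ Icc _ _ from ⟨by simp only [Function.comp]; rw [hwm]; exact hwn.le,
      hgZ z ⟨hzb.1, hzX⟩⟩)
  have hzb' := hC hz'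
  rcases hg0 _ (h.map_mem_frontier hD hzb'.1) hz0 with he | he
  · exact hzb'.2 (Or.inl (h.injOn_devExt hD hzb'.1 hx.1 he))
  · exact hzb'.2 (Or.inr (h.injOn_devExt hD hzb'.1 hy.1 he))

/-- Adjacency in planar terms: `w` develops a point of the component free of frontier points, and a
connected piece of the curve through `w` avoiding the two end points lifts into that component. -/
theorem exists_of_adjacent (hD : IsDevelopingMap D) (h : IsSheet D U {w | F.eval w < 0})
    (hF : ∀ v, 0 ≤ F.lead v) (hU : U.Nonempty) (hxy : Adjacent U x y) :
    ∃ w, F.eval w = 0 ∧ w ≠ devExt D x ∧ w ≠ devExt D y ∧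
      ∀ K, IsPreconnected K → (∀ w ∈ K, F.eval w = 0) → w ∈ K → devExt D x ∉ K → devExt D y ∉ K →
        ∀ z ∈ bdry U ∩ surfaceFrontier X, devExt D z ∉ K := by
  obtain ⟨hx, hy, p, hp, hdis⟩ := hxy
  refine ⟨devExt D p, h.eval_eq_zero hD hF hU hp.1,
    fun he => hp.2 (Or.inl (h.injOn_devExt hD hp.1 hx.1 he)),
    fun he => hp.2 (Or.inr (h.injOn_devExt hD hp.1 hy.1 he)), fun K hK hKF hpK hxK hyK z hz hzK => ?_⟩
  refine Set.disjoint_left.1 hdis (h.image_ext_subset hD hF hU hK hKF ?_ hp.1 hpK hz.1 hzK) hz.2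
  rintro _ (rfl | rfl)
  · exact hxK
  · exact hyK

end IsSheet

end Adjacent

end Subconic

end

/-! ### Chords and tangents of an ellipse, lines of a strip. -/

section

/-- The affine function `κ l`. -/
def AffForm.scale (κ : ℝ) (l : AffForm) : AffForm := ⟨κ * l.c, κ * l.p, κ * l.q⟩

theorem AffForm.eval_scale (κ : ℝ) (l : AffForm) (w : Plane) :
    (l.scale κ).eval w = κ * l.eval w := by
  simp only [scale, eval]; ring

/-- The affine function vanishing on the tangent of the conic at `x`. -/
def Conic.tangent (F : Conic) (x : Plane) : AffForm :=
  ⟨(2 * F.a * x 0 + F.b * x 1 + F.d) * x 0 + (F.b * x 0 + 2 * F.c * x 1 + F.e) * x 1,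
    -(2 * F.a * x 0 + F.b * x 1 + F.d), -(F.b * x 0 + 2 * F.c * x 1 + F.e)⟩

/-- Taylor expansion at `x`: on the curve the linear term is minus the quadratic one. For an ellipse
the tangent is thus nonnegative on the curve and vanishes there only at `x`. -/
theorem Conic.eval_tangent {F : Conic} {x w : Plane} (hx : F.eval x = 0) (hw : F.eval w = 0) :
    (F.tangent x).eval w = F.lead (w - x) := by
  simp only [tangent, AffForm.eval, lead, PiLp.sub_apply]
  simp only [eval] at hx hw
  linear_combination hx - hw

theorem Conic.eval_lineMap_neg {F : Conic} (hF : F.IsElliptic) {x y : Plane}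
    (hx : F.eval x = 0) (hy : F.eval y = 0) (hxy : x ≠ y) {t : ℝ} (ht : t ∈ Ioo (0 : ℝ) 1) :
    F.eval (x + t • (y - x)) < 0 := by
  rw [F.eval_lineMap, hx, hy]
  have := hF.lead_pos (sub_ne_zero.2 hxy.symm)
  nlinarith [mul_pos (mul_pos ht.1 (sub_pos.2 ht.2)) this]

theorem AffForm.eval_line_lineMap (x y : Plane) (t : ℝ) :
    (AffForm.line x y).eval (x + t • (y - x)) = 0 := by
  rw [eval_add_smul, lin_sub, line_left, line_right]; ring

theorem AffForm.lin_line_pos {x y : Plane} (hxy : x ≠ y) :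
    ∃ v : Plane, 0 < (AffForm.line x y).lin v := by
  refine ⟨!₂[-(y 1 - x 1), y 0 - x 0], ?_⟩
  simp only [lin, line, Matrix.cons_val_zero, Matrix.cons_val_one]
  by_contra! h
  refine hxy ?_
  ext i; fin_cases i
  · change x 0 = y 0; nlinarith [sq_nonneg (y 0 - x 0), sq_nonneg (y 1 - x 1)]
  · change x 1 = y 1; nlinarith [sq_nonneg (y 0 - x 0), sq_nonneg (y 1 - x 1)]

theorem AffForm.IsCoord.isPreconnected {S T : AffForm} (h : S.IsCoord T) (s : ℝ) {J : Set ℝ}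
    (hJ : IsPreconnected J) : IsPreconnected {w | S.eval w = s ∧ T.eval w ∈ J} := by
  have hc : Continuous fun t : ℝ => point S T s t := by unfold point; fun_prop
  convert hJ.image _ hc.continuousOn
  ext w
  constructor
  · rintro ⟨rfl, ht⟩
    exact ⟨_, ht, h.eq (h.eval_point_left _ _) (h.eval_point_right _ _)⟩
  · rintro ⟨t, ht, rfl⟩
    exact ⟨h.eval_point_left _ _, (h.eval_point_right _ _).symm ▸ ht⟩

variable {X : Type*} [MetricSpace X] [ChartedSpace Plane X] [TranslationSurface X] [Nonempty X]
  {D : X → Plane} {U V : Set X} {A B : Set Plane} {F G : Conic} {S T : AffForm}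
  {x y : Completion X} {Z Z' : Set (Completion X)}

namespace IsSheet

section Ellipse

theorem adjacent_of_line (hD : IsDevelopingMap D) (h : IsSheet D U {w | F.eval w < 0})
    (hF : F.IsElliptic) (hU : U.Nonempty) (hx : x ∈ bdry U ∩ surfaceFrontier X)
    (hy : y ∈ bdry U ∩ surfaceFrontier X) (hxy : x ≠ y) {κ : ℝ} (hκ : κ ≠ 0)
    (hZ : ∀ z ∈ bdry U ∩ surfaceFrontier X,
      0 ≤ κ * (AffForm.line (devExt D x) (devExt D y)).eval (devExt D z)) :
    Adjacent U x y := by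
  have hx0 := h.eval_eq_zero hD hF.lead_nonneg hU hx.1
  have hy0 := h.eval_eq_zero hD hF.lead_nonneg hU hy.1
  have hne : devExt D x ≠ devExt D y := fun he => hxy (h.injOn_devExt hD hx.1 hy.1 he)
  have ho := Conic.eval_lineMap_neg hF hx0 hy0 hne (t := 1 / 2) (by norm_num)
  have hfr := F.frontier_lt hF.lead_nonneg ho
  refine h.adjacent_of_pos hD hx hy (g := fun w => κ * (AffForm.line _ _).eval w)
    (by fun_prop) (fun w hw hw0 => ?_) hZ ?_
  · rw [hfr] at hw
    by_contra! hcon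
    exact line_ne_zero_of_isElliptic hF hw hx0 hy0 hcon.1 hcon.2 hne
      ((mul_eq_zero.1 hw0).resolve_left hκ)
  · obtain ⟨v, hv⟩ := AffForm.lin_line_pos hne
    have hv' : (-κ) • v ≠ 0 := by
      refine smul_ne_zero (neg_ne_zero.2 hκ) ?_
      rintro rfl
      simp [AffForm.lin] at hv
    -- Leaving the midpoint of the chord in the direction `-κ v` reaches the arc on the negative
    -- side.
    obtain ⟨h1, ρ, hρ, h2⟩ := hF.radial_spec ho hv'
    refine ⟨_, by rw [hfr]; exact h1, ?_⟩
    rw [h2, AffForm.eval_add_smul, AffForm.eval_line_lineMap, AffForm.lin_smul]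
    have h3 : κ * (0 + ρ * (-κ * (AffForm.line (devExt D x) (devExt D y)).lin v)) =
      -(κ ^ 2 * (ρ * (AffForm.line (devExt D x) (devExt D y)).lin v)) := by ring
    rw [h3, neg_lt_zero]
    positivity

/-- The open arc on the side of the chord containing `w` is connected and avoids `x` and `y`, so it
carries no frontier point. The sign of `κ` is chosen to make that side negative. -/
theorem exists_line_of_adjacent (hD : IsDevelopingMap D) (h : IsSheet D U {w | F.eval w < 0})
    (hF : F.IsElliptic) (hU : U.Nonempty) (hxy : x ≠ y) (hadj : Adjacent U x y) :
    ∃ κ : ℝ, κ ≠ 0 ∧ ∀ z ∈ bdry U ∩ surfaceFrontier X,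
      0 ≤ κ * (AffForm.line (devExt D x) (devExt D y)).eval (devExt D z) := by
  have hx := hadj.1
  have hy := hadj.2.1
  have hx0 := h.eval_eq_zero hD hF.lead_nonneg hU hx.1
  have hy0 := h.eval_eq_zero hD hF.lead_nonneg hU hy.1
  have hne : devExt D x ≠ devExt D y := fun he => hxy (h.injOn_devExt hD hx.1 hy.1 he)
  have ho := Conic.eval_lineMap_neg hF hx0 hy0 hne (t := 1 / 2) (by norm_num)
  obtain ⟨w, hw, hwx, hwy, hK⟩ := h.exists_of_adjacent hD hF.lead_nonneg hU hadj
  have hlw := line_ne_zero_of_isElliptic hF hw hx0 hy0 hwx hwy hne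
  rcases hlw.lt_or_gt with hlt | hlt
  · refine ⟨1, one_ne_zero, fun z hz => ?_⟩
    by_contra! hcon
    have hpre := hF.isPreconnected_zero_inter ho (l := AffForm.line (devExt D y) (devExt D x))
      (by rw [AffForm.line_swap, AffForm.eval_line_lineMap, neg_zero])
    refine hK _ hpre (fun w hw => hw.1) ⟨hw, ?_⟩ (fun hc => ?_) (fun hc => ?_) z hz
      ⟨h.eval_eq_zero hD hF.lead_nonneg hU hz.1, ?_⟩
    · rw [AffForm.line_swap]; linarith
    · exact hc.2.ne' (AffForm.line_right _ _)
    · exact hc.2.ne' (AffForm.line_left _ _)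
    · rw [AffForm.line_swap]; linarith
  · refine ⟨-1, by norm_num, fun z hz => ?_⟩
    by_contra! hcon
    have hpre := hF.isPreconnected_zero_inter ho (l := AffForm.line (devExt D x) (devExt D y))
      (AffForm.eval_line_lineMap _ _ _)
    refine hK _ hpre (fun w hw => hw.1) ⟨hw, hlt⟩ (fun hc => ?_) (fun hc => ?_) z hz
      ⟨h.eval_eq_zero hD hF.lead_nonneg hU hz.1, by linarith⟩
    · exact hc.2.ne' (AffForm.line_left _ _)
    · exact hc.2.ne' (AffForm.line_right _ _)

theorem subconicsOf_nonempty_of_mul (hX : DiscreteTopology (surfaceFrontier X))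
    (hD : IsDevelopingMap D) (h : IsSheet D U {w | F.eval w < 0}) (hF : F.IsElliptic)
    (hU : U.Nonempty) {l m : AffForm} (hZ : Z ⊆ bdry U ∩ surfaceFrontier X) (hne : Z.Nonempty)
    (hl : ∀ z ∈ bdry U ∩ surfaceFrontier X, 0 ≤ l.eval (devExt D z))
    (hm : ∀ z ∈ bdry U ∩ surfaceFrontier X, 0 ≤ m.eval (devExt D z))
    (hlm : ∀ z ∈ bdry U ∩ surfaceFrontier X,
      z ∈ Z ↔ l.eval (devExt D z) = 0 ∨ m.eval (devExt D z) = 0) :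
    (subconicsOf Z).Nonempty := by
  refine h.subconicsOf_nonempty hX hD hF.lead_nonneg hU (hF.isAdmissible (l.mul m)) hZ hne
    (fun z hz => ?_) fun z hz hzZ => ?_
  · rw [Conic.eval_mul, mul_eq_zero]; exact (hlm z (hZ hz)).1 hz
  · rw [hlm z hz, not_or] at hzZ
    rw [Conic.eval_mul]
    exact mul_pos ((hl z hz).lt_of_ne' hzZ.1) ((hm z hz).lt_of_ne' hzZ.2)

theorem line_eq_zero_iff (hD : IsDevelopingMap D) (h : IsSheet D U {w | F.eval w < 0})
    (hF : F.IsElliptic) (hU : U.Nonempty) (hx : x ∈ bdry U) (hy : y ∈ bdry U) (hxy : x ≠ y)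
    {z : Completion X} (hz : z ∈ bdry U) :
    (AffForm.line (devExt D x) (devExt D y)).eval (devExt D z) = 0 ↔ z = x ∨ z = y := by
  constructor
  · intro h0
    by_contra! hcon
    have hinj := h.injOn_devExt hD
    have h1 := fun {z} => h.eval_eq_zero hD hF.lead_nonneg hU (z := z)
    exact line_ne_zero_of_isElliptic hF (h1 hz) (h1 hx) (h1 hy)
      (fun he => hcon.1 (hinj hz hx he)) (fun he => hcon.2 (hinj hz hy he))
      (fun he => hxy (hinj hx hy he)) h0
  · rintro (rfl | rfl)
    · exact AffForm.line_left _ _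
    · exact AffForm.line_right _ _

end Ellipse

section Strip

theorem sq_eval_of_mem_bdry (hD : IsDevelopingMap D)
    (h : IsSheet D U {w | (Conic.strip S).eval w < 0}) (hU : U.Nonempty) {z : Completion X}
    (hz : z ∈ bdry U) : S.eval (devExt D z) ^ 2 = 1 := by
  have := h.eval_eq_zero hD (Conic.lead_strip_nonneg S) hU hz
  rw [Conic.eval_strip] at this
  linarith

theorem eq_of_strip (hD : IsDevelopingMap D) (h : IsSheet D U {w | (Conic.strip S).eval w < 0})
    (hST : S.IsCoord T) (hx : x ∈ bdry U) (hy : y ∈ bdry U)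
    (hs : S.eval (devExt D x) = S.eval (devExt D y))
    (ht : T.eval (devExt D x) = T.eval (devExt D y)) : x = y :=
  h.injOn_devExt hD hx hy (hST.eq hs ht)

/-- `S` takes only the values `1` and `-1` on `∂U`, so no connected part of `∂U` touches both lines.
-/
theorem exists_mem_of_meetsEachComponent (hD : IsDevelopingMap D)
    (h : IsSheet D U {w | (Conic.strip S).eval w < 0}) (hU : U.Nonempty) (hST : S.IsCoord T)
    (hZ : MeetsEachComponent Z U) {s : ℝ} (hs : s ^ 2 = 1) :
    ∃ z ∈ Z, S.eval (devExt D z) = s := by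
  obtain ⟨hb, hm⟩ := h.ext_mem_bdry_of_eval hD (Conic.lead_strip_nonneg S) hU
    (w := AffForm.point S T s 0) (by rw [Conic.eval_strip, hST.eval_point_left, hs, sub_self])
  obtain ⟨z, hzZ, hz⟩ := hZ _ hb
  have hsub := connectedComponentIn_subset (bdry U) (sheetExt D U (AffForm.point S T s 0))
  refine ⟨z, hzZ, ?_⟩
  have hc : Continuous fun z => s * S.eval (devExt D z) :=
    continuous_const.mul (S.continuous_eval.comp (continuous_devExt hD))
  have h1 := h.sq_eval_of_mem_bdry hD hU (hsub hz)
  rcases sq_eq_sq_iff_eq_or_eq_neg.1 (h1.trans hs.symm) with h2 | h2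
  · exact h2
  · obtain ⟨z', hz', h0⟩ := isPreconnected_connectedComponentIn.intermediate_value hz
      (mem_connectedComponentIn hb) hc.continuousOn
      (show (0 : ℝ) ∈ Icc _ _ by
        rw [h2, hm, hST.eval_point_left]; constructor <;> nlinarith)
    have h3 := h.sq_eval_of_mem_bdry hD hU (hsub hz')
    have h4 : s * S.eval (devExt D z') = 0 := h0
    have h5 : (s * S.eval (devExt D z')) ^ 2 = 1 := by rw [mul_pow, hs, h3, one_mul]
    rw [h4] at h5
    norm_num at h5

theorem meetsEachComponent_of_strip (hD : IsDevelopingMap D)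
    (h : IsSheet D U {w | (Conic.strip S).eval w < 0}) (hU : U.Nonempty) (hST : S.IsCoord T)
    (hZ : Z ⊆ bdry U) (hs : ∀ s : ℝ, s ^ 2 = 1 → ∃ z ∈ Z, S.eval (devExt D z) = s) :
    MeetsEachComponent Z U := by
  intro z hz
  have h1 := h.sq_eval_of_mem_bdry hD hU hz
  obtain ⟨z', hz', hzz'⟩ := hs _ h1
  refine ⟨z', hz', ?_⟩
  have := h.image_ext_subset hD (Conic.lead_strip_nonneg S) hU
    (hST.isPreconnected (S.eval (devExt D z)) isPreconnected_univ)
    (fun w hw => by rw [Conic.eval_strip, hw.1, h1, sub_self]) (C := ∅) (fun z hz => hz.elim) hz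
    ⟨rfl, mem_univ _⟩ (hZ hz') ⟨hzz', mem_univ _⟩
  rwa [Set.sdiff_empty] at this

theorem adjacent_of_strip (hD : IsDevelopingMap D)
    (h : IsSheet D U {w | (Conic.strip S).eval w < 0}) (hU : U.Nonempty) (hST : S.IsCoord T)
    (hx : x ∈ bdry U ∩ surfaceFrontier X) (hy : y ∈ bdry U ∩ surfaceFrontier X) (hxy : x ≠ y)
    (hSxy : S.eval (devExt D x) = S.eval (devExt D y))
    (hZ : ∀ z ∈ bdry U ∩ surfaceFrontier X, S.eval (devExt D z) = S.eval (devExt D x) →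
      0 ≤ (T.eval (devExt D z) - T.eval (devExt D x)) *
        (T.eval (devExt D z) - T.eval (devExt D y))) : Adjacent U x y := by
  have hs := h.sq_eval_of_mem_bdry hD hU hx.1
  have hT : T.eval (devExt D x) ≠ T.eval (devExt D y) := fun he =>
    hxy (h.eq_of_strip hD hST hx.1 hy.1 hSxy he)
  have hfr : frontier {w | (Conic.strip S).eval w < 0} = {w | (Conic.strip S).eval w = 0} := by
    obtain ⟨o, ho⟩ := hU
    exact Conic.frontier_lt _ (Conic.lead_strip_nonneg S) (h.bijOn.mapsTo ho)
  have hfr' : ∀ w ∈ frontier {w | (Conic.strip S).eval w < 0},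
      S.eval w = S.eval (devExt D x) ∨ S.eval w = -S.eval (devExt D x) := fun w hw => by
    rw [hfr] at hw
    have hw' : (Conic.strip S).eval w = 0 := hw
    rw [Conic.eval_strip] at hw'
    exact sq_eq_sq_iff_eq_or_eq_neg.1 (by linarith)
  set s := S.eval (devExt D x)
  set t₁ := T.eval (devExt D x) with ht₁
  set t₂ := T.eval (devExt D y) with ht₂
  -- On the line of `x` and `y` the second entry is `-1`, so the sign is that of the quadratic in
  -- `T`. On the other line it is `1`, which makes the maximum positive.
  refine h.adjacent_of_pos hD hx hy
    (g := fun w => max ((T.eval w - t₁) * (T.eval w - t₂)) (-(s * S.eval w))) (by fun_prop)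
    (fun w hw hw0 => ?_) (fun z hz => ?_) ⟨AffForm.point S T s ((t₁ + t₂) / 2), ?_, ?_⟩
  · rcases hfr' w hw with h1 | h1
    · have h2 : -(s * S.eval w) = -1 := by rw [h1]; linarith
      simp only [h2] at hw0
      have h3 : (T.eval w - t₁) * (T.eval w - t₂) = 0 := by
        rcases max_choice ((T.eval w - t₁) * (T.eval w - t₂)) (-1) with h4 | h4
        · rwa [h4] at hw0
        · rw [h4] at hw0; norm_num at hw0
      rcases mul_eq_zero.1 h3 with h4 | h4
      · exact Or.inl (hST.eq h1 (by linarith))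
      · exact Or.inr (hST.eq (by rw [h1, hSxy]) (by linarith))
    · have h2 : -(s * S.eval w) = 1 := by rw [h1]; linarith
      simp only [h2] at hw0
      have := le_max_right ((T.eval w - t₁) * (T.eval w - t₂)) 1
      linarith
  · rcases hfr' _ (h.map_mem_frontier hD hz.1) with h1 | h1
    · exact le_max_of_le_left (hZ z hz h1)
    · refine le_max_of_le_right ?_
      rw [h1]; nlinarith
  · rw [hfr]
    change (Conic.strip S).eval _ = 0
    rw [Conic.eval_strip, hST.eval_point_left, hs, sub_self]
  · refine max_lt ?_ ?_
    · rw [hST.eval_point_right]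
      have := sq_pos_of_ne_zero (sub_ne_zero.2 hT)
      nlinarith
    · rw [hST.eval_point_left]; nlinarith

end Strip

end IsSheet

end

section

/-! ### Adjacency in strips, and conics realizing finite sets. -/

section Strip

variable {X Y : Type*} [MetricSpace X] [ChartedSpace Plane X] [TranslationSurface X] [Nonempty X]
  [MetricSpace Y] [ChartedSpace Plane Y] [TranslationSurface Y] {p : X → Y}
  {D : X → Plane} {U V : Set X} {S T : AffForm} {x y : Completion X} {Z Z' : Set (Completion X)}

namespace IsSheet

/-- By periodicity the line of `w` has frontier points arbitrarily far in both directions. The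
interval of that line around `w` free of them must therefore be stopped by one of `x`, `y` above and
by the other below. -/
theorem between_of_adjacent (hD : IsDevelopingMap D)
    (h : IsSheet D U {w | (Conic.strip S).eval w < 0}) (hU : U.Nonempty) (hST : S.IsCoord T)
    (hp : IsCoveringMap p) (hpt : IsTranslationMap p) (hY : TotallyBounded (univ : Set Y))
    (hm : ∀ s : ℝ, s ^ 2 = 1 → ∃ z ∈ bdry U ∩ surfaceFrontier X, S.eval (devExt D z) = s)
    (hadj : Adjacent U x y) :
    S.eval (devExt D x) = S.eval (devExt D y) ∧
      ∀ z ∈ bdry U ∩ surfaceFrontier X, S.eval (devExt D z) = S.eval (devExt D x) →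
        0 ≤ (T.eval (devExt D z) - T.eval (devExt D x)) *
          (T.eval (devExt D z) - T.eval (devExt D y)) := by
  obtain ⟨w, hw, hwx, hwy, hK⟩ := h.exists_of_adjacent hD (Conic.lead_strip_nonneg S) hU hadj
  rw [Conic.eval_strip] at hw
  have hw1 : S.eval w ^ 2 = 1 := by linarith
  obtain ⟨z₀, hz₀, hSz₀⟩ := hm _ hw1
  have hgt := fun M => h.exists_gt_of_strip hD hST hp hpt hY (hm 1 (by norm_num))
    (hm (-1) (by norm_num)) hz₀ M
  have hJ : ∀ J : Set ℝ, IsPreconnected J → T.eval w ∈ J →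
      ¬ (S.eval (devExt D x) = S.eval w ∧ T.eval (devExt D x) ∈ J) →
      ¬ (S.eval (devExt D y) = S.eval w ∧ T.eval (devExt D y) ∈ J) →
      ∀ z ∈ bdry U ∩ surfaceFrontier X, S.eval (devExt D z) = S.eval w →
        T.eval (devExt D z) ∉ J := fun J hJ hwJ hxJ hyJ z hz hzS hzJ =>
    hK _ (hST.isPreconnected (S.eval w) hJ)
      (fun w' hw' => by rw [Conic.eval_strip, hw'.1, hw1, sub_self]) ⟨rfl, hwJ⟩ hxJ hyJ z hz
      ⟨hzS, hzJ⟩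
  have hup : (S.eval (devExt D x) = S.eval w ∧ T.eval w < T.eval (devExt D x)) ∨
      (S.eval (devExt D y) = S.eval w ∧ T.eval w < T.eval (devExt D y)) := by
    by_contra! hcon
    obtain ⟨z, hz, hzS, hzT⟩ := (hgt (T.eval w)).1
    refine hJ (Ici (T.eval w)) isPreconnected_Ici self_mem_Ici ?_ ?_ z hz (hzS.trans hSz₀) hzT.le
    · exact fun hc => hwx (hST.eq hc.1.symm (le_antisymm hc.2 (hcon.1 hc.1)))
    · exact fun hc => hwy (hST.eq hc.1.symm (le_antisymm hc.2 (hcon.2 hc.1)))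
  have hdown : (S.eval (devExt D x) = S.eval w ∧ T.eval (devExt D x) < T.eval w) ∨
      (S.eval (devExt D y) = S.eval w ∧ T.eval (devExt D y) < T.eval w) := by
    by_contra! hcon
    obtain ⟨z, hz, hzS, hzT⟩ := (hgt (T.eval w)).2
    refine hJ (Iic (T.eval w)) isPreconnected_Iic self_mem_Iic ?_ ?_ z hz (hzS.trans hSz₀) hzT.le
    · exact fun hc => hwx (hST.eq hc.1.symm (le_antisymm (hcon.1 hc.1) hc.2))
    · exact fun hc => hwy (hST.eq hc.1.symm (le_antisymm (hcon.2 hc.1) hc.2))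
  have key : ∀ {a b : ℝ}, a < T.eval w → T.eval w < b →
      (T.eval (devExt D x) = a ∧ T.eval (devExt D y) = b ∨
        T.eval (devExt D x) = b ∧ T.eval (devExt D y) = a) →
      ∀ z ∈ bdry U ∩ surfaceFrontier X, S.eval (devExt D z) = S.eval w →
        0 ≤ (T.eval (devExt D z) - a) * (T.eval (devExt D z) - b) := by
    intro a b ha hb hab z hz hzS
    have := hJ (Ioo a b) isPreconnected_Ioo ⟨ha, hb⟩
      (fun hc => by rcases hab with hab | hab <;> linarith [hc.2.1, hc.2.2])
      (fun hc => by rcases hab with hab | hab <;> linarith [hc.2.1, hc.2.2]) z hz hzS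
    by_contra! hcon
    refine this ⟨?_, ?_⟩ <;> nlinarith
  rcases hup with hup | hup <;> rcases hdown with hdown | hdown
  · linarith [hup.2, hdown.2]
  · refine ⟨hup.1.trans hdown.1.symm, fun z hz hzS => ?_⟩
    have := key hdown.2 hup.2 (Or.inr ⟨rfl, rfl⟩) z hz (hzS.trans hup.1)
    rwa [mul_comm]
  · exact ⟨hdown.1.trans hup.1.symm, fun z hz hzS =>
      key hdown.2 hup.2 (Or.inl ⟨rfl, rfl⟩) z hz (hzS.trans hdown.1)⟩
  · linarith [hup.2, hdown.2]

/-- The perturbing conic is the product of the lines through `x₁`, `x₂` and through `y₁`, `y₂`. On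
each boundary line it restricts to the quadratic in `T` with roots at the pair there. The points of
a pair may coincide, which serves the case of three points. -/
theorem subconicsOf_nonempty_of_strip (hX : DiscreteTopology (surfaceFrontier X))
    (hD : IsDevelopingMap D) (h : IsSheet D U {w | (Conic.strip S).eval w < 0})
    (hU : U.Nonempty) (hST : S.IsCoord T) {x₁ y₁ x₂ y₂ : Completion X}
    (hZ : {x₁, y₁, x₂, y₂} ⊆ bdry U ∩ surfaceFrontier X)
    (hs₁ : S.eval (devExt D x₁) = S.eval (devExt D y₁))
    (hs₂ : S.eval (devExt D x₂) = S.eval (devExt D y₂))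
    (hs : S.eval (devExt D x₂) = -S.eval (devExt D x₁))
    (hZ₁ : ∀ z ∈ bdry U ∩ surfaceFrontier X, S.eval (devExt D z) = S.eval (devExt D x₁) →
        0 ≤ (T.eval (devExt D z) - T.eval (devExt D x₁)) *
          (T.eval (devExt D z) - T.eval (devExt D y₁)))
    (hZ₂ : ∀ z ∈ bdry U ∩ surfaceFrontier X, S.eval (devExt D z) = S.eval (devExt D x₂) →
        0 ≤ (T.eval (devExt D z) - T.eval (devExt D x₂)) *
          (T.eval (devExt D z) - T.eval (devExt D y₂))) :
    (subconicsOf ({x₁, y₁, x₂, y₂} : Set (Completion X))).Nonempty := by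
  have hx₁ : x₁ ∈ bdry U ∩ surfaceFrontier X := hZ (by simp)
  have hy₁ : y₁ ∈ bdry U ∩ surfaceFrontier X := hZ (by simp)
  have hx₂ : x₂ ∈ bdry U ∩ surfaceFrontier X := hZ (by simp)
  have hy₂ : y₂ ∈ bdry U ∩ surfaceFrontier X := hZ (by simp)
  have hsq := h.sq_eval_of_mem_bdry hD hU hx₁.1
  obtain ⟨s, hsdef⟩ : ∃ s, s = S.eval (devExt D x₁) := ⟨_, rfl⟩
  -- With `s ^ 2 = 1`, these coefficients give the line through height `t` on `S = s` and height
  -- `t'` on `S = -s`.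
  have hgr₁ : ∀ {t t' : ℝ} {z : Completion X}, S.eval (devExt D z) = S.eval (devExt D x₁) →
      (AffForm.graph S T ((t + t') / 2) (s * (t - t') / 2)).eval (devExt D z) =
        T.eval (devExt D z) - t := fun {t t' z} hz => by
    rw [AffForm.eval_graph, hz, ← hsdef]
    rw [← hsdef] at hsq
    linear_combination -(t - t') / 2 * hsq
  have hgr₂ : ∀ {t t' : ℝ} {z : Completion X}, S.eval (devExt D z) = S.eval (devExt D x₂) →
      (AffForm.graph S T ((t + t') / 2) (s * (t - t') / 2)).eval (devExt D z) =
        T.eval (devExt D z) - t' := fun {t t' z} hz => by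
    rw [AffForm.eval_graph, hz, hs, ← hsdef]
    rw [← hsdef] at hsq
    linear_combination (t - t') / 2 * hsq
  refine h.subconicsOf_nonempty hX hD (Conic.lead_strip_nonneg S) hU
    (Conic.isAdmissible_strip hST
      ((T.eval (devExt D x₁) + T.eval (devExt D x₂)) / 2)
      (s * (T.eval (devExt D x₁) - T.eval (devExt D x₂)) / 2)
      ((T.eval (devExt D y₁) + T.eval (devExt D y₂)) / 2)
      (s * (T.eval (devExt D y₁) - T.eval (devExt D y₂)) / 2)) hZ ⟨x₁, by simp⟩
    (fun z hz => ?_) fun z hz hzZ => ?_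
  · rw [Conic.eval_mul]
    rcases hz with rfl | rfl | rfl | rfl
    · rw [hgr₁ rfl, sub_self, zero_mul]
    · rw [hgr₁ (t := T.eval (devExt D z)) hs₁.symm, sub_self, mul_zero]
    · rw [hgr₂ rfl, sub_self, zero_mul]
    · rw [hgr₂ (t' := T.eval (devExt D z)) hs₂.symm, sub_self, mul_zero]
  · simp only [mem_insert_iff, mem_singleton_iff, not_or] at hzZ
    rw [Conic.eval_mul]
    have hzs := h.sq_eval_of_mem_bdry hD hU hz.1
    have hneT : ∀ {z' : Completion X}, z' ∈ bdry U ∩ surfaceFrontier X → z ≠ z' →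
        S.eval (devExt D z) = S.eval (devExt D z') →
        T.eval (devExt D z) - T.eval (devExt D z') ≠ 0 := fun {z'} hz' hne he h0 =>
      hne (h.eq_of_strip hD hST hz.1 hz'.1 he (sub_eq_zero.1 h0))
    rcases sq_eq_sq_iff_eq_or_eq_neg.1 (hzs.trans hsq.symm) with h1 | h1
    · rw [hgr₁ h1, hgr₁ h1]
      exact (hZ₁ z hz h1).lt_of_ne' (mul_ne_zero (hneT hx₁ hzZ.1 h1)
        (hneT hy₁ hzZ.2.1 (h1.trans hs₁)))
    · rw [← hs] at h1
      rw [hgr₂ h1, hgr₂ h1]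
      exact (hZ₂ z hz h1).lt_of_ne' (mul_ne_zero (hneT hx₂ hzZ.2.2.1 h1)
        (hneT hy₂ hzZ.2.2.2 (h1.trans hs₂)))

end IsSheet

/-- The conic `F` precomposed with the translation by `c`. -/
def Conic.translate (F : Conic) (c : Plane) : Conic :=
  ⟨F.a, F.b, F.c, F.d + 2 * F.a * c 0 + F.b * c 1, F.e + F.b * c 0 + 2 * F.c * c 1, F.eval c⟩

theorem Conic.eval_translate (F : Conic) (c w : Plane) :
    (F.translate c).eval w = F.eval (w + c) := by
  simp [translate, eval]; ring

theorem exists_developingMap (hZ : (subconicsOf Z).Nonempty) : ∃ D : X → Plane, IsDevelopingMap D := by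
  obtain ⟨U, ⟨-, D, hD, -⟩, -⟩ := hZ
  exact ⟨D, hD⟩

theorem nonempty_of_mem_subconicsOf (hU : U ∈ subconicsOf Z) (hZ : Z.Nonempty) : U.Nonempty := by
  obtain ⟨z, hz⟩ := hZ
  rw [hU.2.1] at hz
  by_contra hcon
  have := hz.1
  rw [not_nonempty_iff_eq_empty.1 hcon, bdry, image_empty, frontier_empty] at this
  exact this

theorem exists_isSheet_of_mem_subconicsOf [PreconnectedSpace X] (hD : IsDevelopingMap D)
    (hU : U ∈ subconicsOf Z) : ∃ F : Conic, IsSheet D U {w | F.eval w < 0} := by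
  obtain ⟨⟨hconv, D', hD', q, hq⟩, -⟩ := hU
  obtain ⟨F, hF⟩ := Conic.exists_eq_quadraticForm q
  obtain ⟨c, hc⟩ := hD'.exists_eq_add hD
  have himg : D '' U = {w | (F.translate (-c)).eval w < 0} := by
    have h1 : D '' U = (fun w => w + c) '' (D' '' U) := by
      rw [image_image]; simp only [hc]
    rw [h1, hq, hF]
    ext w
    simp only [image_add_right, mem_preimage, mem_ofPred_eq, Conic.eval_translate]
  have := hconv.isSheet hD (by rw [himg]; exact Conic.isOpen_lt _)
  rw [himg] at this
  exact ⟨_, this⟩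

/-- Over a precompact surface with nonempty frontier, subconics are bounded by ellipses or
strips. -/
theorem isElliptic_or_strip_of_mem_subconicsOf [PreconnectedSpace X] (hD : IsDevelopingMap D)
    (hp : IsCoveringMap p) (hpt : IsTranslationMap p) (hY : TotallyBounded (univ : Set Y))
    (hYne : (surfaceFrontier Y).Nonempty) (hU : U ∈ subconicsOf Z) (hne : U.Nonempty) :
    (∃ F : Conic, F.IsElliptic ∧ IsSheet D U {w | F.eval w < 0}) ∨
      ∃ S T : AffForm, S.IsCoord T ∧ IsSheet D U {w | (Conic.strip S).eval w < 0} := by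
  obtain ⟨F, hF⟩ := exists_isSheet_of_mem_subconicsOf hD hU
  obtain ⟨R, -, hR⟩ := exists_radius_not_ball_subset hp hpt hY hYne hD
  obtain ⟨o, ho⟩ := hne
  rcases F.isElliptic_or_strip (hF.bijOn.mapsTo ho) (hR U _ hF) with hell | ⟨S, T, hST, heq⟩
  · exact Or.inl ⟨F, hell, hF⟩
  · exact Or.inr ⟨S, T, hST, heq ▸ hF⟩

theorem IsSheet.exists_mem_of_strip (hD : IsDevelopingMap D)
    (h : IsSheet D U {w | (Conic.strip S).eval w < 0}) (hU : U ∈ subconicsOf Z)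
    (hne : U.Nonempty) (hST : S.IsCoord T) (s : ℝ) (hs : s ^ 2 = 1) :
    ∃ z ∈ bdry U ∩ surfaceFrontier X, S.eval (devExt D z) = s := by
  have := h.exists_mem_of_meetsEachComponent hD hne hST hU.2.2 hs
  rwa [hU.2.1] at this

/-- In a strip, periodicity would produce a frontier point higher than the highest point of the
finite set `Z`. -/
theorem exists_isElliptic_of_finite [PreconnectedSpace X] (hD : IsDevelopingMap D)
    (hp : IsCoveringMap p) (hpt : IsTranslationMap p) (hY : TotallyBounded (univ : Set Y))
    (hYne : (surfaceFrontier Y).Nonempty) (hU : U ∈ subconicsOf Z) (hZ : Z.Nonempty)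
    (hfin : Z.Finite) : ∃ F : Conic, F.IsElliptic ∧ IsSheet D U {w | F.eval w < 0} := by
  have hne := nonempty_of_mem_subconicsOf hU hZ
  refine (isElliptic_or_strip_of_mem_subconicsOf hD hp hpt hY hYne hU hne).resolve_right ?_
  rintro ⟨S, T, hST, h⟩
  have hm := fun s => h.exists_mem_of_strip hD hU hne hST s
  obtain ⟨z, hz, hmax⟩ := Set.exists_max_image Z (fun z => T.eval (devExt D z)) hfin hZ
  obtain ⟨⟨z', hz', -, hlt⟩, -⟩ := h.exists_gt_of_strip hD hST hp hpt hY (hm 1 (by norm_num))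
    (hm (-1) (by norm_num)) (hU.2.1 ▸ hz) (T.eval (devExt D z))
  exact (hmax z' (hU.2.1 ▸ hz')).not_gt hlt

/-- A realizable finite set of boundary points of a sheet is cut out by an ellipse that is positive
on the other frontier points. -/
theorem IsSheet.exists_conic_of_realizable [SimplyConnectedSpace X] {A : Set Plane}
    (hD : IsDevelopingMap D) (h : IsSheet D U A)
    (hp : IsCoveringMap p) (hpt : IsTranslationMap p) (hY : TotallyBounded (univ : Set Y))
    (hYne : (surfaceFrontier Y).Nonempty) (hZ : Z ⊆ bdry U ∩ surfaceFrontier X)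
    (hfin : Z.Finite) (hr : Realizable Z) :
    ∃ G : Conic, G.IsElliptic ∧ (∀ z ∈ Z, G.eval (devExt D z) = 0) ∧
      ∀ z ∈ bdry U ∩ surfaceFrontier X, z ∉ Z → 0 < G.eval (devExt D z) := by
  obtain ⟨hcard, V, hV⟩ := hr
  obtain ⟨z₁, hz₁, z₂, hz₂, z₃, hz₃, h₁₂, h₁₃, h₂₃⟩ :
      ∃ z₁ ∈ Z, ∃ z₂ ∈ Z, ∃ z₃ ∈ Z, z₁ ≠ z₂ ∧ z₁ ≠ z₃ ∧ z₂ ≠ z₃ := by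
    obtain ⟨Z₀, hZ₀, hc⟩ := exists_subset_encard_eq hcard
    obtain ⟨a, b, c, hab, hac, hbc, rfl⟩ := encard_eq_three.1 hc
    exact ⟨a, hZ₀ (by simp), b, hZ₀ (by simp), c, hZ₀ (by simp), hab, hac, hbc⟩
  have hVne := nonempty_of_mem_subconicsOf hV ⟨z₁, hz₁⟩
  obtain ⟨G, hG, hs⟩ := exists_isElliptic_of_finite hD hp hpt hY hYne hV ⟨z₁, hz₁⟩ hfin
  have hZV : ∀ {z}, z ∈ Z → z ∈ bdry V ∩ surfaceFrontier X := fun hz => hV.2.1 ▸ hz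
  have hZU : ∀ {z}, z ∈ Z → z ∈ closure ((↑) '' U : Set (Completion X)) := fun hz =>
    ((h.mem_bdry_iff hD).1 (hZ hz).1).1
  -- Without an overlap, the sign of `G` at the development of a frontier point of `U` would say
  -- nothing about `V`.
  have hUV := hs.inter_nonempty hD hG (h.isPreconnected hD) h₁₂ h₁₃ h₂₃ (hZV hz₁) (hZV hz₂)
    (hZV hz₃) (hZU hz₁) (hZU hz₂) (hZU hz₃)
  refine ⟨G, hG, fun z hz => hs.eval_eq_zero hD hG.lead_nonneg hVne (hZV hz).1,
    fun z hz hzZ => h.eval_pos_of_overlap hD hs hG.lead_nonneg hUV hz fun hzV => hzZ ?_⟩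
  rw [hV.2.1]
  exact ⟨hzV, hz.2⟩

end Strip

end

section Finite

variable {α : Type*}

theorem exists_eq_insert_of_encard_eq_three {Z : Set α} (hZ : Z.encard = 3) {x y : α}
    (hx : x ∈ Z) (hy : y ∈ Z) (hxy : x ≠ y) : ∃ z, z ≠ x ∧ z ≠ y ∧ Z = {x, y, z} := by
  obtain ⟨a, b, c, hab, hac, hbc, rfl⟩ := encard_eq_three.1 hZ
  have key : ∃ z ∈ ({a, b, c} : Set α), z ≠ x ∧ z ≠ y := by
    by_contra! hcon
    have ha := hcon a (by simp)
    have hb := hcon b (by simp)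
    have hc := hcon c (by simp)
    grind
  obtain ⟨z, hz, hzx, hzy⟩ := key
  refine ⟨z, hzx, hzy, ?_⟩
  ext w
  simp only [mem_insert_iff, mem_singleton_iff] at *
  grind

theorem ne_of_encard_eq_four {x₁ y₁ x₂ y₂ : α} (h : ({x₁, y₁, x₂, y₂} : Set α).encard = 4) :
    x₁ ≠ y₁ ∧ x₂ ≠ y₂ := by
  have key : ∀ a b c : α, ({a, b, c} : Set α).encard ≠ 4 := fun a b c he => by
    have h1 : ({a, b, c} : Set α).encard ≤ 3 := by
      refine (encard_insert_le _ _).trans ?_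
      have := encard_insert_le {c} b
      rw [encard_singleton] at this
      exact (add_le_add_left this 1).trans (by norm_num)
    rw [he] at h1
    exact absurd h1 (by norm_num)
  constructor
  · rintro rfl
    exact key x₁ x₂ y₂ (by simpa using h)
  · rintro rfl
    exact key x₁ y₁ x₂ (by simpa using h)

end Finite

/-! ### Transfer of the planar results to ellipses and strips. -/

section Main

variable {X Y : Type*} [MetricSpace X] [ChartedSpace Plane X] [TranslationSurface X] [Nonempty X]
  [MetricSpace Y] [ChartedSpace Plane Y] [TranslationSurface Y] {p : X → Y}
  {D : X → Plane} {U : Set X} {F G : Conic} {S T : AffForm} {x y : Completion X}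
  {Z Z' : Set (Completion X)}

namespace IsSheet

section Ellipse

theorem adjacent_of_oneSided (hD : IsDevelopingMap D) (h : IsSheet D U {w | F.eval w < 0})
    (hF : F.IsElliptic) (hU : U.Nonempty) (hZ : Z ⊆ bdry U ∩ surfaceFrontier X)
    (hG : ∀ z ∈ bdry U ∩ surfaceFrontier X, z ∉ Z → 0 < G.eval (devExt D z)) (hx : x ∈ Z)
    (hy : y ∈ Z) (hxy : x ≠ y)
    (hos : F.OneSided G (devExt D '' Z) (devExt D x) (devExt D y)) : Adjacent U x y := by
  obtain ⟨κ, hκ, hos⟩ := hos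
  refine h.adjacent_of_line hD hF hU (hZ hx) (hZ hy) hxy hκ fun z hz => ?_
  refine hos _ (h.eval_eq_zero hD hF.lead_nonneg hU hz.1) ?_
  by_cases hzZ : z ∈ Z
  · exact Or.inr (mem_image_of_mem _ hzZ)
  · exact Or.inl (hG z hz hzZ)

theorem exists_adjacent_four_of_isElliptic (hD : IsDevelopingMap D)
    (h : IsSheet D U {w | F.eval w < 0}) (hF : F.IsElliptic) (hU : U.Nonempty)
    (hZ : Z ⊆ bdry U ∩ surfaceFrontier X) (hG0 : ∀ z ∈ Z, G.eval (devExt D z) = 0)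
    (hG : ∀ z ∈ bdry U ∩ surfaceFrontier X, z ∉ Z → 0 < G.eval (devExt D z))
    (hcard : Z.encard = 4) :
    ∃ x₁ y₁ x₂ y₂, Z = {x₁, y₁, x₂, y₂} ∧ Adjacent U x₁ y₁ ∧ Adjacent U x₂ y₂ := by
  have hinj := (h.injOn_devExt hD).mono (hZ.trans inter_subset_left)
  obtain ⟨p₁, q₁, p₂, q₂, hP, hne₁, hne₂, ho₁, ho₂⟩ := Conic.exists_oneSided_four (F := F) (G := G)
    (P := devExt D '' Z) hF
    (by rintro _ ⟨z, hz, rfl⟩; exact h.eval_eq_zero hD hF.lead_nonneg hU (hZ hz).1)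
    (by rintro _ ⟨z, hz, rfl⟩; exact hG0 z hz) (by rw [hinj.encard_image, hcard])
  obtain ⟨x₁, hx₁, rfl⟩ : p₁ ∈ devExt D '' Z := by rw [hP]; simp
  obtain ⟨y₁, hy₁, rfl⟩ : q₁ ∈ devExt D '' Z := by rw [hP]; simp
  obtain ⟨x₂, hx₂, rfl⟩ : p₂ ∈ devExt D '' Z := by rw [hP]; simp
  obtain ⟨y₂, hy₂, rfl⟩ : q₂ ∈ devExt D '' Z := by rw [hP]; simp
  refine ⟨x₁, y₁, x₂, y₂, ?_, ?_, ?_⟩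
  · refine (hinj.image_eq_image_iff Subset.rfl ?_).1 ?_
    · rintro _ (rfl | rfl | rfl | rfl) <;> assumption
    · rw [hP]; simp only [image_insert_eq, image_singleton]
  · exact h.adjacent_of_oneSided hD hF hU hZ hG hx₁ hy₁ (fun he => hne₁ (by rw [he])) ho₁
  · exact h.adjacent_of_oneSided hD hF hU hZ hG hx₂ hy₂ (fun he => hne₂ (by rw [he])) ho₂

theorem exists_adjacent_three_of_isElliptic (hD : IsDevelopingMap D)
    (h : IsSheet D U {w | F.eval w < 0}) (hF : F.IsElliptic) (hU : U.Nonempty)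
    (hZ : Z ⊆ bdry U ∩ surfaceFrontier X) (hG0 : ∀ z ∈ Z, G.eval (devExt D z) = 0)
    (hG : ∀ z ∈ bdry U ∩ surfaceFrontier X, z ∉ Z → 0 < G.eval (devExt D z))
    (hcard : Z.encard = 3) : ∃ x ∈ Z, ∃ y ∈ Z, x ≠ y ∧ Adjacent U x y := by
  have hinj := (h.injOn_devExt hD).mono (hZ.trans inter_subset_left)
  obtain ⟨_, ⟨x, hx, rfl⟩, _, ⟨y, hy, rfl⟩, hne, ho⟩ := Conic.exists_oneSided_three (F := F) (G := G)
    (P := devExt D '' Z) hF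
    (by rintro _ ⟨z, hz, rfl⟩; exact h.eval_eq_zero hD hF.lead_nonneg hU (hZ hz).1)
    (by rintro _ ⟨z, hz, rfl⟩; exact hG0 z hz) (by rw [hinj.encard_image, hcard])
  have hxy : x ≠ y := fun he => hne (by rw [he])
  exact ⟨x, hx, y, hy, hxy, h.adjacent_of_oneSided hD hF hU hZ hG hx hy hxy ho⟩

theorem subconicsOf_nonempty_four_of_isElliptic (hX : DiscreteTopology (surfaceFrontier X))
    (hD : IsDevelopingMap D) (h : IsSheet D U {w | F.eval w < 0}) (hF : F.IsElliptic)
    (hU : U.Nonempty) {x₁ y₁ x₂ y₂ : Completion X} (h₁ : Adjacent U x₁ y₁)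
    (h₂ : Adjacent U x₂ y₂) (hne₁ : x₁ ≠ y₁) (hne₂ : x₂ ≠ y₂) :
    (subconicsOf ({x₁, y₁, x₂, y₂} : Set (Completion X))).Nonempty := by
  obtain ⟨κ₁, hκ₁, hl₁⟩ := h.exists_line_of_adjacent hD hF hU hne₁ h₁
  obtain ⟨κ₂, hκ₂, hl₂⟩ := h.exists_line_of_adjacent hD hF hU hne₂ h₂
  refine h.subconicsOf_nonempty_of_mul hX hD hF hU
    (l := (AffForm.line (devExt D x₁) (devExt D y₁)).scale κ₁)
    (m := (AffForm.line (devExt D x₂) (devExt D y₂)).scale κ₂) ?_ ⟨x₁, by simp⟩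
    (fun z hz => ?_) (fun z hz => ?_) fun z hz => ?_
  · rintro _ (rfl | rfl | rfl | rfl)
    exacts [h₁.1, h₁.2.1, h₂.1, h₂.2.1]
  · rw [AffForm.eval_scale]; exact hl₁ z hz
  · rw [AffForm.eval_scale]; exact hl₂ z hz
  · rw [AffForm.eval_scale, AffForm.eval_scale, mul_eq_zero_iff_left hκ₁, mul_eq_zero_iff_left hκ₂,
      h.line_eq_zero_iff hD hF hU h₁.1.1 h₁.2.1.1 hne₁ hz.1,
      h.line_eq_zero_iff hD hF hU h₂.1.1 h₂.2.1.1 hne₂ hz.1]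
    simp only [mem_insert_iff, mem_singleton_iff, or_assoc]

theorem subconicsOf_nonempty_three_of_isElliptic (hX : DiscreteTopology (surfaceFrontier X))
    (hD : IsDevelopingMap D) (h : IsSheet D U {w | F.eval w < 0}) (hF : F.IsElliptic)
    (hU : U.Nonempty) {x y z : Completion X} (hxy : Adjacent U x y) (hne : x ≠ y)
    (hz : z ∈ bdry U ∩ surfaceFrontier X) :
    (subconicsOf ({x, y, z} : Set (Completion X))).Nonempty := by
  obtain ⟨κ, hκ, hl⟩ := h.exists_line_of_adjacent hD hF hU hne hxy
  have h0 := fun {w} => h.eval_eq_zero hD hF.lead_nonneg hU (z := w)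
  refine h.subconicsOf_nonempty_of_mul hX hD hF hU
    (l := (AffForm.line (devExt D x) (devExt D y)).scale κ)
    (m := F.tangent (devExt D z)) ?_ ⟨x, by simp⟩
    (fun w hw => ?_) (fun w hw => ?_) fun w hw => ?_
  · rintro _ (rfl | rfl | rfl)
    exacts [hxy.1, hxy.2.1, hz]
  · rw [AffForm.eval_scale]; exact hl w hw
  · rw [Conic.eval_tangent (h0 hz.1) (h0 hw.1)]; exact hF.lead_nonneg _
  · rw [AffForm.eval_scale, mul_eq_zero_iff_left hκ,
      h.line_eq_zero_iff hD hF hU hxy.1.1 hxy.2.1.1 hne hw.1, Conic.eval_tangent (h0 hz.1) (h0 hw.1)]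
    have : F.lead (devExt D w - devExt D z) = 0 ↔ w = z := by
      refine ⟨fun h1 => ?_, fun h1 => by rw [h1, sub_self]; simp [Conic.lead]⟩
      by_contra hwz
      exact (hF.lead_pos (sub_ne_zero.2 fun he =>
        hwz (h.injOn_devExt hD hw.1 hz.1 he))).ne' h1
    rw [this]
    simp only [mem_insert_iff, mem_singleton_iff, or_assoc]

end Ellipse

section Strip

/-- `G` is negative strictly between two of its zeros on a line, so `w` cannot lie between `a` and
`b`. -/
theorem between_of_strip (hG : G.IsElliptic) (hST : S.IsCoord T) {a b w : Plane} (hab : a ≠ b)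
    (ha : G.eval a = 0) (hb : G.eval b = 0) (hw : 0 ≤ G.eval w) (hSab : S.eval a = S.eval b)
    (hSw : S.eval w = S.eval a) : 0 ≤ (T.eval w - T.eval a) * (T.eval w - T.eval b) := by
  by_contra! hcon
  have hT : T.eval b - T.eval a ≠ 0 := fun h0 => by
    rw [sub_eq_zero.1 h0] at hcon
    exact (mul_self_nonneg _).not_gt hcon
  have ht : (T.eval w - T.eval a) / (T.eval b - T.eval a) ∈ Ioo (0 : ℝ) 1 := by
    rcases hT.lt_or_gt with hlt | hlt
    · refine ⟨div_pos_of_neg_of_neg ?_ hlt, (div_lt_one_of_neg hlt).2 ?_⟩ <;> nlinarith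
    · refine ⟨div_pos ?_ hlt, (div_lt_one hlt).2 ?_⟩ <;> nlinarith
  have heq : w = a + ((T.eval w - T.eval a) / (T.eval b - T.eval a)) • (b - a) := by
    refine hST.eq ?_ ?_
    · rw [AffForm.eval_add_smul, AffForm.lin_sub, hSab, sub_self, mul_zero, add_zero, hSw, hSab]
    · rw [AffForm.eval_add_smul, AffForm.lin_sub, div_mul_cancel₀ _ hT]; ring
  have := Conic.eval_lineMap_neg hG ha hb hab ht
  rw [← heq] at this
  exact hw.not_gt this

theorem adjacent_of_strip_of_isElliptic (hD : IsDevelopingMap D)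
    (h : IsSheet D U {w | (Conic.strip S).eval w < 0}) (hU : U.Nonempty) (hST : S.IsCoord T)
    (hG : G.IsElliptic) (hZ : Z ⊆ bdry U ∩ surfaceFrontier X)
    (hG0 : ∀ z ∈ Z, G.eval (devExt D z) = 0)
    (hG' : ∀ z ∈ bdry U ∩ surfaceFrontier X, z ∉ Z → 0 < G.eval (devExt D z)) (hx : x ∈ Z)
    (hy : y ∈ Z) (hxy : x ≠ y) (hs : S.eval (devExt D x) = S.eval (devExt D y)) :
    Adjacent U x y := by
  refine h.adjacent_of_strip hD hU hST (hZ hx) (hZ hy) hxy hs fun z hz hzs => ?_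
  refine between_of_strip hG hST (fun he => hxy (h.injOn_devExt hD (hZ hx).1 (hZ hy).1 he))
    (hG0 x hx) (hG0 y hy) ?_ hs hzs
  by_cases hzZ : z ∈ Z
  · exact (hG0 z hzZ).ge
  · exact (hG' z hz hzZ).le

/-- Of three distinct points on a line, one is between the others. Algebraically, the product of the
three nonnegative betweenness expressions is minus a nonzero square. -/
theorem false_of_strip_of_isElliptic (hD : IsDevelopingMap D)
    (h : IsSheet D U {w | (Conic.strip S).eval w < 0}) (hST : S.IsCoord T)
    (hG : G.IsElliptic) (hZ : Z ⊆ bdry U ∩ surfaceFrontier X)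
    (hG0 : ∀ z ∈ Z, G.eval (devExt D z) = 0) {x y z : Completion X} (hx : x ∈ Z) (hy : y ∈ Z)
    (hz : z ∈ Z) (hxy : x ≠ y) (hxz : x ≠ z) (hyz : y ≠ z)
    (hs : S.eval (devExt D x) = S.eval (devExt D y))
    (hs' : S.eval (devExt D x) = S.eval (devExt D z)) : False := by
  have hinj : ∀ {a b}, a ∈ Z → b ∈ Z → a ≠ b → devExt D a ≠ devExt D b := fun ha hb hab he =>
    hab (h.injOn_devExt hD (hZ ha).1 (hZ hb).1 he)
  have h1 := between_of_strip hG hST (hinj hx hy hxy) (hG0 x hx) (hG0 y hy) (hG0 z hz).ge hs hs'.symm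
  have h2 := between_of_strip hG hST (hinj hx hz hxz) (hG0 x hx) (hG0 z hz) (hG0 y hy).ge hs' hs.symm
  have h3 := between_of_strip hG hST (hinj hy hz hyz) (hG0 y hy) (hG0 z hz) (hG0 x hx).ge
    (hs.symm.trans hs') hs
  have hT : ∀ {a b}, a ∈ Z → b ∈ Z → a ≠ b → S.eval (devExt D a) = S.eval (devExt D b) →
      T.eval (devExt D a) - T.eval (devExt D b) ≠ 0 := fun ha hb hab he h0 =>
    hab (h.eq_of_strip hD hST (hZ ha).1 (hZ hb).1 he (sub_eq_zero.1 h0))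
  have k1 := hT hx hy hxy hs
  have k2 := hT hx hz hxz hs'
  have k3 := hT hy hz hyz (hs.symm.trans hs')
  have h4 := mul_nonneg (mul_nonneg h1 h2) h3
  set a := T.eval (devExt D x)
  set b := T.eval (devExt D y)
  set c := T.eval (devExt D z)
  have h5 : (c - a) * (c - b) * ((b - a) * (b - c)) * ((a - b) * (a - c)) =
      -((a - b) * (a - c) * (b - c)) ^ 2 := by ring
  have h6 : 0 < ((a - b) * (a - c) * (b - c)) ^ 2 := by positivity
  linarith

theorem meetsEachComponent_of_strip_of_isElliptic (hD : IsDevelopingMap D)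
    (h : IsSheet D U {w | (Conic.strip S).eval w < 0}) (hU : U.Nonempty) (hST : S.IsCoord T)
    (hG : G.IsElliptic) (hZ : Z ⊆ bdry U ∩ surfaceFrontier X)
    (hG0 : ∀ z ∈ Z, G.eval (devExt D z) = 0) {x y z : Completion X} (hx : x ∈ Z) (hy : y ∈ Z)
    (hz : z ∈ Z) (hxy : x ≠ y) (hxz : x ≠ z) (hyz : y ≠ z) : MeetsEachComponent Z U := by
  refine h.meetsEachComponent_of_strip hD hU hST (hZ.trans inter_subset_left) fun s hs => ?_
  by_contra! hcon
  have hneg : ∀ w ∈ Z, S.eval (devExt D w) = -s := fun w hw =>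
    (sq_eq_sq_iff_eq_or_eq_neg.1 ((h.sq_eval_of_mem_bdry hD hU (hZ hw).1).trans
      hs.symm)).resolve_left (hcon w hw)
  exact h.false_of_strip_of_isElliptic hD hST hG hZ hG0 hx hy hz hxy hxz hyz
    ((hneg x hx).trans (hneg y hy).symm) ((hneg x hx).trans (hneg z hz).symm)

end Strip

end IsSheet

end Main

/-! ### The two equivalences. -/

section Realizable

variable {X Y : Type*} [MetricSpace X] [ChartedSpace Plane X] [TranslationSurface X]
  [SimplyConnectedSpace X] [MetricSpace Y] [ChartedSpace Plane Y] [TranslationSurface Y] {p : X → Y}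
  {Z Z' : Set (Completion X)}

theorem exists_adjacent_four (hp : IsCoveringMap p) (hpt : IsTranslationMap p)
    (hY : TotallyBounded (univ : Set Y)) (hYne : (surfaceFrontier Y).Nonempty)
    (hZ : Realizable Z) (hZ' : Z' ⊆ Z) (hcard : Z'.encard = 4) (hr : Realizable Z') :
    ∃ U ∈ subconicsOf Z, MeetsEachComponent Z' U ∧ ∃ x₁ y₁ x₂ y₂ : Completion X,
      Z' = {x₁, y₁, x₂, y₂} ∧ Adjacent U x₁ y₁ ∧ Adjacent U x₂ y₂ := by
  obtain ⟨U, hU⟩ := hZ.2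
  have hfin : Z'.Finite := finite_of_encard_eq_coe hcard
  obtain ⟨D, hD⟩ := exists_developingMap hZ.2
  have hZne : Z'.Nonempty := by
    rw [← encard_ne_zero, hcard]; norm_num
  have hne := nonempty_of_mem_subconicsOf hU (hZne.mono hZ')
  have hZU : Z' ⊆ bdry U ∩ surfaceFrontier X := hU.2.1 ▸ hZ'
  refine ⟨U, hU, ?_⟩
  rcases isElliptic_or_strip_of_mem_subconicsOf hD hp hpt hY hYne hU hne with
    ⟨F, hF, h⟩ | ⟨S, T, hST, h⟩
  · obtain ⟨G, hG, hG0, hG'⟩ := h.exists_conic_of_realizable hD hp hpt hY hYne hZU hfin hr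
    exact ⟨h.meetsEachComponent_of_isElliptic hD hF hne (hZU.trans inter_subset_left) hZne,
      h.exists_adjacent_four_of_isElliptic hD hF hne hZU hG0 hG' hcard⟩
  · obtain ⟨G, hG, hG0, hG'⟩ := h.exists_conic_of_realizable hD hp hpt hY hYne hZU hfin hr
    obtain ⟨a, b, c, d, hab, hac, had, hbc, hbd, hcd, rfl⟩ := encard_eq_four.1 hcard
    have ha : a ∈ ({a, b, c, d} : Set (Completion X)) := by simp
    have hb : b ∈ ({a, b, c, d} : Set (Completion X)) := by simp
    have hc : c ∈ ({a, b, c, d} : Set (Completion X)) := by simp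
    have hd : d ∈ ({a, b, c, d} : Set (Completion X)) := by simp
    refine ⟨h.meetsEachComponent_of_strip_of_isElliptic hD hne hST hG hZU hG0 ha hb hc hab hac hbc, ?_⟩
    have hadj := fun {x y} => h.adjacent_of_strip_of_isElliptic hD hne hST hG hZU hG0 hG'
      (x := x) (y := y)
    have h3 := fun {x y z} => h.false_of_strip_of_isElliptic hD hST hG hZU hG0
      (x := x) (y := y) (z := z)
    have e1 := h3 ha hb hc hab hac hbc
    have e2 := h3 ha hb hd hab had hbd
    have e3 := h3 ha hc hd hac had hcd
    have e4 := h3 hb hc hd hbc hbd hcd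
    have hsq : ∀ z ∈ ({a, b, c, d} : Set (Completion X)),
        S.eval (devExt D z) = 1 ∨ S.eval (devExt D z) = -1 := fun z hz =>
      h.mem_bdry_strip hD hne (hZU hz).1
    -- No three of the four points are on one line of the strip, so they split two and two.
    have hpair : (S.eval (devExt D a) = S.eval (devExt D b) ∧
        S.eval (devExt D c) = S.eval (devExt D d)) ∨ (S.eval (devExt D a) = S.eval (devExt D c) ∧
        S.eval (devExt D b) = S.eval (devExt D d)) ∨ (S.eval (devExt D a) = S.eval (devExt D d) ∧
        S.eval (devExt D b) = S.eval (devExt D c)) := by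
      have sa := hsq a ha
      have sb := hsq b hb
      have sc := hsq c hc
      have sd := hsq d hd
      grind
    rcases hpair with ⟨h1, h2⟩ | ⟨h1, h2⟩ | ⟨h1, h2⟩
    · exact ⟨a, b, c, d, rfl, hadj ha hb hab h1, hadj hc hd hcd h2⟩
    · exact ⟨a, c, b, d, by rw [insert_comm b c], hadj ha hc hac h1, hadj hb hd hbd h2⟩
    · refine ⟨a, d, b, c, ?_, hadj ha hd had h1, hadj hb hc hbc h2⟩
      rw [insert_comm d b, pair_comm d c]

theorem exists_adjacent_three (hp : IsCoveringMap p) (hpt : IsTranslationMap p)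
    (hY : TotallyBounded (univ : Set Y)) (hYne : (surfaceFrontier Y).Nonempty)
    (hZ : Realizable Z) (hZ' : Z' ⊆ Z) (hcard : Z'.encard = 3) (hr : Realizable Z') :
    ∃ U ∈ subconicsOf Z, MeetsEachComponent Z' U ∧
      ∃ x ∈ Z', ∃ x' ∈ Z', x ≠ x' ∧ Adjacent U x x' := by
  obtain ⟨U, hU⟩ := hZ.2
  have hfin : Z'.Finite := finite_of_encard_eq_coe hcard
  obtain ⟨D, hD⟩ := exists_developingMap hZ.2
  have hZne : Z'.Nonempty := by
    rw [← encard_ne_zero, hcard]; norm_num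
  have hne := nonempty_of_mem_subconicsOf hU (hZne.mono hZ')
  have hZU : Z' ⊆ bdry U ∩ surfaceFrontier X := hU.2.1 ▸ hZ'
  refine ⟨U, hU, ?_⟩
  rcases isElliptic_or_strip_of_mem_subconicsOf hD hp hpt hY hYne hU hne with
    ⟨F, hF, h⟩ | ⟨S, T, hST, h⟩
  · obtain ⟨G, hG, hG0, hG'⟩ := h.exists_conic_of_realizable hD hp hpt hY hYne hZU hfin hr
    exact ⟨h.meetsEachComponent_of_isElliptic hD hF hne (hZU.trans inter_subset_left) hZne,
      h.exists_adjacent_three_of_isElliptic hD hF hne hZU hG0 hG' hcard⟩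
  · obtain ⟨G, hG, hG0, hG'⟩ := h.exists_conic_of_realizable hD hp hpt hY hYne hZU hfin hr
    obtain ⟨a, b, c, hab, hac, hbc, rfl⟩ := encard_eq_three.1 hcard
    have ha : a ∈ ({a, b, c} : Set (Completion X)) := by simp
    have hb : b ∈ ({a, b, c} : Set (Completion X)) := by simp
    have hc : c ∈ ({a, b, c} : Set (Completion X)) := by simp
    refine ⟨h.meetsEachComponent_of_strip_of_isElliptic hD hne hST hG hZU hG0 ha hb hc hab hac hbc, ?_⟩
    have hadj := fun {x y} => h.adjacent_of_strip_of_isElliptic hD hne hST hG hZU hG0 hG'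
      (x := x) (y := y)
    have hpair : S.eval (devExt D a) = S.eval (devExt D b) ∨
        S.eval (devExt D a) = S.eval (devExt D c) ∨
        S.eval (devExt D b) = S.eval (devExt D c) := by
      have sa := h.mem_bdry_strip hD hne (hZU ha).1
      have sb := h.mem_bdry_strip hD hne (hZU hb).1
      have sc := h.mem_bdry_strip hD hne (hZU hc).1
      grind
    rcases hpair with h1 | h1 | h1
    · exact ⟨a, ha, b, hb, hab, hadj ha hb hab h1⟩
    · exact ⟨a, ha, c, hc, hac, hadj ha hc hac h1⟩
    · exact ⟨b, hb, c, hc, hbc, hadj hb hc hbc h1⟩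

theorem realizable_four (hp : IsCoveringMap p) (hpt : IsTranslationMap p)
    (hY : TotallyBounded (univ : Set Y)) (hYne : (surfaceFrontier Y).Nonempty)
    (hX : DiscreteTopology (surfaceFrontier X)) {U : Set X} (hU : U ∈ subconicsOf Z)
    (hcard : Z'.encard = 4) (hm : MeetsEachComponent Z' U)
    {x₁ y₁ x₂ y₂ : Completion X} (hZ' : Z' = {x₁, y₁, x₂, y₂}) (h₁ : Adjacent U x₁ y₁)
    (h₂ : Adjacent U x₂ y₂) : Realizable Z' := by
  refine ⟨by rw [hcard]; norm_num, ?_⟩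
  obtain ⟨D, hD⟩ := exists_developingMap ⟨U, hU⟩
  obtain ⟨hne₁, hne₂⟩ := ne_of_encard_eq_four (hZ' ▸ hcard)
  have hne := nonempty_of_mem_subconicsOf hU ⟨x₁, hU.2.1 ▸ h₁.1⟩
  rcases isElliptic_or_strip_of_mem_subconicsOf hD hp hpt hY hYne hU hne with
    ⟨F, hF, h⟩ | ⟨S, T, hST, h⟩
  · exact hZ' ▸ h.subconicsOf_nonempty_four_of_isElliptic hX hD hF hne h₁ h₂ hne₁ hne₂
  · have hb := fun {x y} => h.between_of_adjacent hD hne hST hp hpt hY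
      (h.exists_mem_of_strip hD hU hne hST) (x := x) (y := y)
    obtain ⟨hs₁, hb₁⟩ := hb h₁
    obtain ⟨hs₂, hb₂⟩ := hb h₂
    -- The first pair lies on one line of the strip. Since `Z'` meets both lines, the second pair
    -- must lie on the other.
    obtain ⟨z, hz, hzs⟩ := h.exists_mem_of_meetsEachComponent hD hne hST hm
      (s := -S.eval (devExt D x₁)) (by rw [neg_sq]; exact h.sq_eval_of_mem_bdry hD hne h₁.1.1)
    have hx0 : S.eval (devExt D x₁) ≠ -S.eval (devExt D x₁) := by
      have := h.sq_eval_of_mem_bdry hD hne h₁.1.1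
      intro h0
      have h1 : S.eval (devExt D x₁) = 0 := by linarith
      rw [h1] at this; norm_num at this
    have hs : S.eval (devExt D x₂) = -S.eval (devExt D x₁) := by
      rw [hZ'] at hz
      rcases hz with rfl | rfl | rfl | rfl
      · exact absurd hzs hx0
      · exact absurd (hs₁.trans hzs) hx0
      · exact hzs
      · exact hs₂.trans hzs
    rw [hZ']
    refine h.subconicsOf_nonempty_of_strip hX hD hne hST ?_ hs₁ hs₂ hs hb₁ hb₂
    rintro _ (rfl | rfl | rfl | rfl)
    exacts [h₁.1, h₁.2.1, h₂.1, h₂.2.1]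

theorem realizable_three (hp : IsCoveringMap p) (hpt : IsTranslationMap p)
    (hY : TotallyBounded (univ : Set Y)) (hYne : (surfaceFrontier Y).Nonempty)
    (hX : DiscreteTopology (surfaceFrontier X)) {U : Set X} (hU : U ∈ subconicsOf Z)
    (hZ' : Z' ⊆ Z) (hcard : Z'.encard = 3) (hm : MeetsEachComponent Z' U)
    {x y : Completion X} (hx : x ∈ Z') (hy : y ∈ Z') (hne : x ≠ y) (hxy : Adjacent U x y) :
    Realizable Z' := by
  refine ⟨hcard.ge, ?_⟩
  obtain ⟨D, hD⟩ := exists_developingMap ⟨U, hU⟩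
  have hUne := nonempty_of_mem_subconicsOf hU ⟨x, hU.2.1 ▸ hxy.1⟩
  obtain ⟨z, hzx, hzy, hZeq⟩ := exists_eq_insert_of_encard_eq_three hcard hx hy hne
  have hz : z ∈ bdry U ∩ surfaceFrontier X := hU.2.1 ▸ hZ' (hZeq ▸ by simp)
  rcases isElliptic_or_strip_of_mem_subconicsOf hD hp hpt hY hYne hU hUne with
    ⟨F, hF, h⟩ | ⟨S, T, hST, h⟩
  · exact hZeq ▸ h.subconicsOf_nonempty_three_of_isElliptic hX hD hF hUne hxy hne hz
  · obtain ⟨hs, hb⟩ := h.between_of_adjacent hD hUne hST hp hpt hY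
      (h.exists_mem_of_strip hD hU hUne hST) hxy
    obtain ⟨z', hz', hzs⟩ := h.exists_mem_of_meetsEachComponent hD hUne hST hm
      (s := -S.eval (devExt D x)) (by rw [neg_sq]; exact h.sq_eval_of_mem_bdry hD hUne hxy.1.1)
    have hx0 : S.eval (devExt D x) ≠ -S.eval (devExt D x) := by
      have := h.sq_eval_of_mem_bdry hD hUne hxy.1.1
      intro h0
      have h1 : S.eval (devExt D x) = 0 := by linarith
      rw [h1] at this; norm_num at this
    have hsz : S.eval (devExt D z) = -S.eval (devExt D x) := by
      rw [hZeq] at hz'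
      rcases hz' with rfl | rfl | rfl
      · exact absurd hzs hx0
      · exact absurd (hs.trans hzs) hx0
      · exact hzs
    -- The third point counts as a double pair: both lines of the perturbing product pass through
    -- `z`, and the condition on its line is that a square is nonnegative.
    have hZeq' : Z' = {x, y, z, z} := by rw [hZeq, pair_eq_singleton]
    rw [hZeq']
    refine h.subconicsOf_nonempty_of_strip hX hD hUne hST ?_ hs rfl hsz hb
      fun w _ _ => mul_self_nonneg _
    rintro _ (rfl | rfl | rfl | rfl)
    exacts [hxy.1, hxy.2.1, hz, hz]

end Realizable

/-- `X` is the universal cover of a precompact translation surface `Y` with finite nonempty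
frontier, and the frontier of `X` is discrete. -/
theorem mainTheorem9 {X Y : Type*}
    [MetricSpace X] [ChartedSpace Plane X] [TranslationSurface X] [SimplyConnectedSpace X]
    [MetricSpace Y] [ChartedSpace Plane Y] [TranslationSurface Y]
    (p : X → Y) (hp : IsCoveringMap p) (hpsurj : Function.Surjective p)
    (hptrans : IsTranslationMap p)
    (hYprecompact : TotallyBounded (univ : Set Y))
    (hYfin : (surfaceFrontier Y).Finite) (hYne : (surfaceFrontier Y).Nonempty)
    (hXdisc : DiscreteTopology (surfaceFrontier X))
    (Z Z' : Set (Completion X)) (hZ : Realizable Z) (hZ' : Z' ⊆ Z) :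
    (Z'.encard = 4 →
      (Realizable Z' ↔
        ∃ U ∈ subconicsOf Z, MeetsEachComponent Z' U ∧
          ∃ x₁ y₁ x₂ y₂ : Completion X, Z' = {x₁, y₁, x₂, y₂} ∧
            Adjacent U x₁ y₁ ∧ Adjacent U x₂ y₂)) ∧
    (Z'.encard = 3 →
      (Realizable Z' ↔
        ∃ U ∈ subconicsOf Z, MeetsEachComponent Z' U ∧
          ∃ x ∈ Z', ∃ x' ∈ Z', x ≠ x' ∧ Adjacent U x x')) := by
  refine ⟨fun hcard => ⟨exists_adjacent_four hp hptrans hYprecompact hYne hZ hZ' hcard, ?_⟩,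
    fun hcard => ⟨exists_adjacent_three hp hptrans hYprecompact hYne hZ hZ' hcard, ?_⟩⟩
  · rintro ⟨U, hU, hm, x₁, y₁, x₂, y₂, heq, h₁, h₂⟩
    exact realizable_four hp hptrans hYprecompact hYne hXdisc hU hcard hm heq h₁ h₂
  · rintro ⟨U, hU, hm, x, hx, x', hx', hne, hadj⟩
    exact realizable_three hp hptrans hYprecompact hYne hXdisc hU hZ' hcard hm hx hx' hne hadj

end
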